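/- **Theorem (Reliability of the residual estimator for the neural enrichment finite element method).** *Problem.* Let $d\ge 2$ and let $\Omega\subset\mathbb R^d$ be a bounded domain with $\operatorname{int}(\overline\Omega)=\Omega$ (the domain lies on one side of its boundary). Let $a\in W^{1,\infty}(\Omega)^{d\times d}$ (continuous representative) be symmetric with $\alpha|\xi|^2\le \xi\cdot a(x)\xi\le\beta|\xi|^2$ for all $x\in\Omega$, $\xi\in\mathbb R^d$, where $\alpha>0$, and let $f\in L^2(\Omega)$. Put $a(u,v)=\int_\Omega a\nabla u\cdot\nabla v\,dx$ and $\|u\|_E=\sqrt{a(u,u)}$. Let $u\in H^1_0(\Omega)$ be the weak solution of $$-\nabla\cdot(a\nabla u)=f\ \text{ in }\Omega,\qquad u|_{\partial\Omega}=0,$$ i.e. $a(u,v)=\int_\Omega fv\,dx$ for all $v\in H_0^1(\Omega)$. *Mesh.* Let $\mathcal T_h$ be a finite conforming simplicial mesh (a triangle mesh if $d=2$) with $\bigcup_{K\in\mathcal T_h}K=\overline\Omega$. Assume it is quasi-uniform with constant $\kappa$: with $h=\max_K h_K$, $h_K=\operatorname{diam}K$, every $K$ contains a ball of radius $r>0$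 with $h\le\kappa r$. Let $I_h$ be the set of nodes, $L_i$ the hat function of the node $i$ with coordinate $p_i$, $\mathcal I_h$ the piecewise linear nodal interpolation, and $\mathcal E$ the set of interior facets (edges if $d=2$), i.e. those shared by two elements. *Enriched space.* Let $I_h^{enr}\subset I_h$. For $i\in I_h^{enr}$ let $\phi_i(x)=\mathcal N_i(x-p_i;\theta_i)$, where $\mathcal N_i(\cdot;\theta_i)$ is a fully connected feed-forward network with parameters $\theta_i$, with any number and widths of hidden layers, an affine output layer, and an activation function of class $C^2$. Let $$V_N(\mathcal T_h,I_h^{enr};\theta)=V_{FEM}+\operatorname{span}\{L_i(\phi_i-\mathcal I_h\phi_i): i\in I_h^{enr}\},$$ where $V_{FEM}=\operatorname{span}\{L_i: p_i\notin\partial\Omega\}$. Assume that the enrichment is conforming, i.e. $L_i(\phi_i-\mathcal I_h\phi_i)=0$ on $\partial\Omega$ for $i\in I_h^{enr}$ (automatic if every enriched node lies in $\Omega$). Let $u_h\in V_N(\mathcal T_h,I_h^{enr};\theta)$ be the Galerkin approximation: $a(u_h,v_h)=\int_\Omega fv_h\,dx$ for all $v_h\in V_N(\mathcal T_h,I_h^{enr};\theta)$.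 *Estimator.* For $K\in\mathcal T_h$ let $$\eta_K^2=h_K^2\,\|f+\nabla\cdot(a\nabla u_h)\|_{L^2(K)}^2+\frac12\sum_{l\subset\partial K,\ l\in\mathcal E}h_l\,\|[a\,\partial_{\boldsymbol n}u_h]\|^2_{L^2(l)},$$ where $h_l=\operatorname{diam}l$ and $[a\,\partial_{\boldsymbol n}u_h]=\boldsymbol n\cdot\big(a\nabla u_h|_{K}-a\nabla u_h|_{K'}\big)$ is the jump of the normal flux across the facet $l$ shared by $K$ and $K'$, $\boldsymbol n$ being a unit normal of $l$. *Claim.* There is a constant $C>0$ depending only on $d,\kappa,\alpha,\beta$ (in particular independent of $h$, the mesh, $f$, $u$, the enriched nodes, the networks and their parameters) such that $$\|u-u_h\|_E^2\le C\sum_{K\in\mathcal T_h}\eta_K^2 .$$ -/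

import Mathlib

open MeasureTheory Set Filter Topology
open scoped ENNReal ContDiff InnerProductSpace

noncomputable section

namespace NEFEM

/-- Points and vectors of `ℝ^d` with the Euclidean norm. -/
abbrev Pt (d : ℕ) : Type := EuclideanSpace ℝ (Fin d)

/-! ### Sobolev spaces -/

/-- Test functions: smooth with compact support inside `Ω`. -/
def IsTest {d : ℕ} (Ω : Set (Pt d)) (φ : Pt d → ℝ) : Prop :=
  ContDiff ℝ ∞ φ ∧ HasCompactSupport φ ∧ tsupport φ ⊆ Ω

/-- `G` is the weak (distributional) gradient of `u` in `Ω`. -/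
def IsWeakGrad {d : ℕ} (Ω : Set (Pt d)) (u : Pt d → ℝ) (G : Pt d → Pt d) : Prop :=
  LocallyIntegrableOn u Ω volume ∧ LocallyIntegrableOn G Ω volume ∧
    ∀ φ : Pt d → ℝ, IsTest Ω φ →
      ∫ x in Ω, u x • gradient φ x = - ∫ x in Ω, φ x • G x

open Classical in
/-- The weak gradient `∇u` in `Ω` (unique almost everywhere in `Ω` whenever it exists). -/
def weakGrad {d : ℕ} (Ω : Set (Pt d)) (u : Pt d → ℝ) : Pt d → Pt d :=
  if h : ∃ G, IsWeakGrad Ω u G then h.choose else 0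

/-- `u ∈ H¹(Ω)`. -/
def MemH1 {d : ℕ} (Ω : Set (Pt d)) (u : Pt d → ℝ) : Prop :=
  MemLp u 2 (volume.restrict Ω) ∧
    ∃ G, IsWeakGrad Ω u G ∧ MemLp G 2 (volume.restrict Ω)

/-- `u ∈ H¹₀(Ω)`: the closure of the test functions in `H¹(Ω)`. -/
def MemH10 {d : ℕ} (Ω : Set (Pt d)) (u : Pt d → ℝ) : Prop :=
  MemH1 Ω u ∧ ∃ φ : ℕ → Pt d → ℝ, (∀ n, IsTest Ω (φ n)) ∧
    Tendsto (fun n => eLpNorm (fun x => φ n x - u x) 2 (volume.restrict Ω)) atTop (𝓝 0) ∧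
    Tendsto (fun n => eLpNorm (fun x => gradient (φ n) x - weakGrad Ω u x) 2
      (volume.restrict Ω)) atTop (𝓝 0)

/-- `g ∈ W^{1,∞}(Ω)`. -/
def MemW1Inf {d : ℕ} (Ω : Set (Pt d)) (g : Pt d → ℝ) : Prop :=
  MemLp g ∞ (volume.restrict Ω) ∧
    ∃ G, IsWeakGrad Ω g G ∧ MemLp G ∞ (volume.restrict Ω)

/-! ### The elliptic problem -/

/-- The matrix field `a ∈ W^{1,∞}(Ω)` (its continuous representative) is symmetric with
`α |ξ|² ≤ ξ · a(x) ξ ≤ β |ξ|²`. -/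
structure IsCoefficient {d : ℕ} (Ω : Set (Pt d)) (α β : ℝ)
    (a : Pt d → Matrix (Fin d) (Fin d) ℝ) : Prop where
  memW1Inf : ∀ i j, MemW1Inf Ω (fun x => a x i j)
  continuousOn : ∀ i j, ContinuousOn (fun x => a x i j) Ω
  symm : ∀ x ∈ Ω, (a x).IsSymm
  lower : ∀ x ∈ Ω, ∀ ξ : Pt d, α * ‖ξ‖ ^ 2 ≤ ⟪ξ, (a x).toEuclideanLin ξ⟫_ℝ
  upper : ∀ x ∈ Ω, ∀ ξ : Pt d, ⟪ξ, (a x).toEuclideanLin ξ⟫_ℝ ≤ β * ‖ξ‖ ^ 2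

/-- `a(u, v) = ∫_Ω a ∇u · ∇v dx`. -/
def aForm {d : ℕ} (Ω : Set (Pt d)) (a : Pt d → Matrix (Fin d) (Fin d) ℝ)
    (u v : Pt d → ℝ) : ℝ :=
  ∫ x in Ω, ⟪(a x).toEuclideanLin (weakGrad Ω u x), weakGrad Ω v x⟫_ℝ

/-- The load `f(v) = ∫_Ω f v dx`. -/
def load {d : ℕ} (Ω : Set (Pt d)) (f v : Pt d → ℝ) : ℝ := ∫ x in Ω, f x * v x

/-- The energy norm `‖u‖_E = √a(u, u)`. -/
def energyNorm {d : ℕ} (Ω : Set (Pt d)) (a : Pt d → Matrix (Fin d) (Fin d) ℝ)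
    (u : Pt d → ℝ) : ℝ :=
  Real.sqrt (aForm Ω a u u)

/-- `u` is the (weak) solution of `-∇·(a ∇u) = f` in `Ω`, `u = 0` on `∂Ω`. -/
def IsSolution {d : ℕ} (Ω : Set (Pt d)) (a : Pt d → Matrix (Fin d) (Fin d) ℝ)
    (f u : Pt d → ℝ) : Prop :=
  MemH10 Ω u ∧ ∀ v, MemH10 Ω v → aForm Ω a u v = load Ω f v

/-! ### Meshes -/

/-- The closed simplex with vertex set `K`. -/
def cell {d : ℕ} (K : Finset (Pt d)) : Set (Pt d) := convexHull ℝ (K : Set (Pt d))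

/-- A conforming simplicial mesh of `Ω` (a triangle mesh if `d = 2`); an element is represented
by its set of `d + 1` vertices. -/
structure Mesh {d : ℕ} (Ω : Set (Pt d)) where
  elems : Finset (Finset (Pt d))
  card_eq : ∀ K ∈ elems, K.card = d + 1
  indep : ∀ K ∈ elems, AffineIndependent ℝ ((↑) : K → Pt d)
  conforming : ∀ K ∈ elems, ∀ K' ∈ elems,
    cell K ∩ cell K' = convexHull ℝ ((K : Set (Pt d)) ∩ (K' : Set (Pt d)))
  cover : ⋃ K ∈ elems, cell K = closure Ω

open Classical in
/-- The nodes `I_h`: all vertices of elements. -/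
def Mesh.nodes {d : ℕ} {Ω : Set (Pt d)} (T : Mesh Ω) : Finset (Pt d) :=
  T.elems.biUnion id

/-- Quasi-uniformity with constant `κ`: every element contains a ball whose radius `r` satisfies
`h ≤ κ r`, where `h` is the largest diameter of an element. -/
def Mesh.QuasiUniform {d : ℕ} {Ω : Set (Pt d)} (T : Mesh Ω) (κ : ℝ) : Prop :=
  ∀ K ∈ T.elems, ∃ (c : Pt d) (r : ℝ), 0 < r ∧ Metric.closedBall c r ⊆ cell K ∧
    ∀ K' ∈ T.elems, Metric.diam (cell K') ≤ κ * r

open Classical in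
/-- The barycentric weights of `x ∈ closure Ω`: the weights of `x` with respect to the vertices
of an element containing `x`, and `0` at all other points. By conformity they do not depend on
the element. (Outside `closure Ω` they are set to `0`.) -/
def Mesh.weights {d : ℕ} {Ω : Set (Pt d)} (T : Mesh Ω) (x : Pt d) : Pt d → ℝ :=
  if h : ∃ w : Pt d → ℝ, ∃ K ∈ T.elems, (∀ p ∈ K, 0 ≤ w p) ∧ (∀ p ∉ K, w p = 0) ∧
      ∑ p ∈ K, w p = 1 ∧ ∑ p ∈ K, w p • p = x
  then h.choose else 0

/-- The hat function `L_p` of the node `p`. -/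
def Mesh.hat {d : ℕ} {Ω : Set (Pt d)} (T : Mesh Ω) (p : Pt d) : Pt d → ℝ :=
  fun x => T.weights x p

/-- The piecewise linear nodal interpolant `I_h φ = ∑_p φ(p) L_p`. -/
def Mesh.interp {d : ℕ} {Ω : Set (Pt d)} (T : Mesh Ω) (φ : Pt d → ℝ) : Pt d → ℝ :=
  fun x => ∑ p ∈ T.nodes, φ p * T.hat p x

/-! ### Neural networks and the enriched space -/

/-- Parameters of a fully connected network with `n` inputs, hidden layers of the given widths
and one output: a weight matrix and a bias for each hidden layer, and those of the affine
output layer. -/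
def NetParams : ℕ → List ℕ → Type
  | n, [] => (Fin n → ℝ) × ℝ
  | n, m :: ws => (Matrix (Fin m) (Fin n) ℝ × (Fin m → ℝ)) × NetParams m ws

/-- The function realized by a network with activation function `σ`. -/
def netEval (σ : ℝ → ℝ) : (n : ℕ) → (ws : List ℕ) → NetParams n ws → (Fin n → ℝ) → ℝ
  | _, [], θ, x => (∑ i, θ.1 i * x i) + θ.2
  | _, m :: ws, θ, x => netEval σ m ws θ.2 (fun j => σ ((θ.1.1.mulVec x) j + θ.1.2 j))

/-- Neural enrichment function `φ_p(x) = 𝒩_p(x - p; θ_p)` of the node `p`. -/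
def neuralEnrichment {d : ℕ} (σ : Pt d → ℝ → ℝ) (ws : Pt d → List ℕ)
    (θ : (p : Pt d) → NetParams d (ws p)) (p : Pt d) : Pt d → ℝ :=
  fun x => netEval (σ p) d (ws p) (θ p) (fun i => (x - p) i)

/-- The enrichment basis function `L_p (φ - I_h φ)`. -/
def Mesh.enrBasis {d : ℕ} {Ω : Set (Pt d)} (T : Mesh Ω) (p : Pt d) (φ : Pt d → ℝ) :
    Pt d → ℝ :=
  fun x => T.hat p x * (φ x - T.interp φ x)

/-- The standard linear finite element space with zero boundary values. -/
def Mesh.VFEM {d : ℕ} {Ω : Set (Pt d)} (T : Mesh Ω) : Submodule ℝ (Pt d → ℝ) :=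
  Submodule.span ℝ {v | ∃ p ∈ T.nodes, p ∉ frontier Ω ∧ v = T.hat p}

/-- The space `V_N(T_h, I_h^enr; θ)`: the linear finite element space enriched by
`L_p (φ_p - I_h φ_p)`, where `p` runs over the enriched nodes. -/
def Mesh.VN {d : ℕ} {Ω : Set (Pt d)} (T : Mesh Ω) (Ienr : Finset (Pt d))
    (φ : Pt d → Pt d → ℝ) : Submodule ℝ (Pt d → ℝ) :=
  T.VFEM ⊔ Submodule.span ℝ {v | ∃ p ∈ Ienr, v = T.enrBasis p (φ p)}

/-- `u_h` is the Galerkin approximation in the space `V`. -/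
def IsGalerkin {d : ℕ} (Ω : Set (Pt d)) (a : Pt d → Matrix (Fin d) (Fin d) ℝ)
    (f : Pt d → ℝ) (V : Submodule ℝ (Pt d → ℝ)) (uh : Pt d → ℝ) : Prop :=
  uh ∈ V ∧ ∀ v ∈ V, aForm Ω a uh v = load Ω f v

/-! ### The residual estimator -/

/-- The flux `a ∇(v|_K)` on the closed element `K`. -/
def flux {d : ℕ} (a : Pt d → Matrix (Fin d) (Fin d) ℝ) (v : Pt d → ℝ) (K : Finset (Pt d)) :
    Pt d → Pt d :=
  fun x => (a x).toEuclideanLin (gradientWithin v (cell K) x)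

/-- The divergence on the element `K` (defined almost everywhere for Lipschitz fields). -/
def divOn {d : ℕ} (K : Finset (Pt d)) (F : Pt d → Pt d) (x : Pt d) : ℝ :=
  ∑ i : Fin d, fderivWithin ℝ F (cell K) x (EuclideanSpace.single i 1) i

/-- A unit normal vector of the facet with vertex set `l` (unique up to its sign). -/
def unitNormal {d : ℕ} (l : Finset (Pt d)) : Pt d :=
  Classical.epsilon fun n : Pt d => ‖n‖ = 1 ∧ ∀ x ∈ l, ∀ y ∈ l, ⟪n, x - y⟫_ℝ = 0

open Classical in
/-- The elements that share a facet with `K`. The interior facets of `K` are the sets `K ∩ K'`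
with `K'` running over these neighbours. -/
def Mesh.neighbors {d : ℕ} {Ω : Set (Pt d)} (T : Mesh Ω) (K : Finset (Pt d)) :
    Finset (Finset (Pt d)) :=
  T.elems.filter fun K' => K' ≠ K ∧ (K ∩ K').card = d

open Classical in
/-- The jump `[a ∂_n v]` across the common facet of `K` and `K'` (its square does not depend on
the orientation of `n`). -/
def fluxJump {d : ℕ} (a : Pt d → Matrix (Fin d) (Fin d) ℝ) (v : Pt d → ℝ)
    (K K' : Finset (Pt d)) (x : Pt d) : ℝ :=
  ⟪unitNormal (K ∩ K'), flux a v K x - flux a v K' x⟫_ℝ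

open Classical in
/-- The squared local estimator
`η_K² = h_K² ‖f + ∇·(a ∇u_h)‖²_{L²(K)} + ½ ∑_l h_l ‖[a ∂_n u_h]‖²_{L²(l)}`,
with `l` running over the interior facets of `K`; `μHE[d - 1]` is the surface measure. -/
def Mesh.etaSq {d : ℕ} {Ω : Set (Pt d)} (T : Mesh Ω) (a : Pt d → Matrix (Fin d) (Fin d) ℝ)
    (f uh : Pt d → ℝ) (K : Finset (Pt d)) : ℝ :=
  Metric.diam (cell K) ^ 2 * (∫ x in cell K, (f x + divOn K (flux a uh K) x) ^ 2) +
    ∑ K' ∈ T.neighbors K, 1 / 2 * Metric.diam (cell (K ∩ K')) *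
      ∫ x in cell (K ∩ K'), fluxJump a uh K K' x ^ 2 ∂μHE[d - 1]

end NEFEM

end

open NEFEM

/-!
# Reliability of the residual error estimator for enriched finite element spaces

The networks enter only through one property of the trial space: its functions vanish outside `Ω`
and are restrictions of `C²` functions on each element (`Mesh.piecewiseC2`). For any Galerkin space
of such functions that contains the linear finite elements, the classical argument gives a constant
depending only on `d`, `κ` and `α` (`Mesh.HasSize.energyNorm_sub_sq_le`).

Let `e = u - u_h`. For a test function `φ`, Galerkin orthogonality gives
`a(e, φ) = f(ψ) - a(u_h, ψ)` with `ψ = φ - w` for every `w` in the linear finite element space. The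
divergence theorem on each element (`integral_parts`) turns the right-hand side into the integrals
of `(f + ∇·(a∇u_h)) ψ` over the elements and of the flux jumps times `ψ` over the interior facets
(`Mesh.integral_cell_residual`, `Mesh.abs_facetTerm_add_le`). With a quasi-interpolant `w` of `φ` the
norms of `ψ` on an element and its facets are bounded by powers of `h` times local energies of `φ`,
which overlap boundedly. The Cauchy–Schwarz inequality then gives
`|a(e, φ)| ≤ C (∑ η_K²)^(1/2) ‖∇φ‖` (`Mesh.HasSize.abs_residual_le`). Letting `φ` tend to `e` in `H¹`
and using coercivity finishes the proof.

Nothing is assumed about the boundary of `Ω` beyond what the mesh provides, and the ingredients are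
arranged accordingly.

* Radial integration over a simplex, seen as a cone over a facet (`map_coneMap`, `integral_radial`),
  yields the divergence theorem and the trace inequality `integral_facet_sq_le`.
* Lipschitz functions vanishing outside `Ω` lie in `H¹₀(Ω)` (`memH10_of_lipschitz`), by
  soft thresholding and mollification. Hence no trace theorem is needed for the discrete functions.
* The coefficient is Lipschitz on convex open subsets of `Ω` (`MemW1Inf.exists_lipschitzOnWith`), so
  that the flux of a discrete function is Lipschitz on each element (`exists_lipschitz_flux`).
* The nodal value of the quasi-interpolant is an average over a ball at an interior node and zero at
  a boundary node. The error is controlled by Poincaré's inequality on the ball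
  (`integral_sub_average_sq_le`). A boundary node lies on a boundary facet
  (`Mesh.exists_boundary_facet`), where `φ` vanishes, and the trace inequality for that facet turns
  Poincaré's inequality into Friedrichs' inequality (`Mesh.HasSize.integral_sq_le_of_notMem`).
-/

noncomputable section

open scoped NNReal

namespace NEFEM

section

/-! ### Barycentric coordinates -/

variable {d : ℕ}

/-- `K` is the vertex set of a nondegenerate `d`-simplex. -/
structure IsSimplex (K : Finset (Pt d)) : Prop where
  card_eq : K.card = d + 1
  indep : AffineIndependent ℝ ((↑) : K → Pt d)

/-- The vertices of a nondegenerate simplex as an affine basis. -/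
def IsSimplex.basis {K : Finset (Pt d)} (hK : IsSimplex K) : AffineBasis K ℝ (Pt d) where
  toFun := (↑)
  ind' := hK.indep
  tot' := by
    have := hK.indep.affineSpan_eq_top_iff_card_eq_finrank_add_one
    rw [this]
    simp [hK.card_eq]

open Classical in
/-- The barycentric coordinate of the vertex `p` of the simplex `K`; it is `0` if `p` is not a
vertex of `K`. -/
def bary (K : Finset (Pt d)) (p x : Pt d) : ℝ :=
  if h : IsSimplex K ∧ p ∈ K then h.1.basis.coord ⟨p, h.2⟩ x else 0

/-- The constant gradient of the barycentric coordinate `bary K p`. -/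
def baryGrad (K : Finset (Pt d)) (p : Pt d) : Pt d := gradient (bary K p) 0

variable {K : Finset (Pt d)}

lemma bary_of_notMem {p : Pt d} (hp : p ∉ K) (x : Pt d) : bary K p x = 0 := by
  simp [bary, hp]

lemma IsSimplex.bary_eq (hK : IsSimplex K) {p : Pt d} (hp : p ∈ K) (x : Pt d) :
    bary K p x = hK.basis.coord ⟨p, hp⟩ x := by
  simp [bary, hp, hK]

lemma IsSimplex.sum_bary (hK : IsSimplex K) (x : Pt d) : ∑ p ∈ K, bary K p x = 1 := by
  rw [← Finset.sum_coe_sort, ← hK.basis.sum_coord_apply_eq_one x]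
  exact Finset.sum_congr rfl fun p _ => hK.bary_eq p.2 x

lemma IsSimplex.sum_bary_smul (hK : IsSimplex K) (x : Pt d) : ∑ p ∈ K, bary K p x • p = x := by
  rw [← Finset.sum_coe_sort]
  conv_rhs => rw [← hK.basis.linear_combination_coord_eq_self x]
  exact Finset.sum_congr rfl fun p _ => by rw [hK.bary_eq p.2 x]; rfl

lemma IsSimplex.bary_unique (hK : IsSimplex K) {w : Pt d → ℝ} {x : Pt d}
    (h1 : ∑ p ∈ K, w p = 1) (h2 : ∑ p ∈ K, w p • p = x) {p : Pt d} (hp : p ∈ K) :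
    bary K p x = w p := by
  rw [hK.bary_eq hp]
  have hs : ∑ q : K, w q = 1 := by rw [Finset.sum_coe_sort K (fun q => w q), h1]
  have := hK.basis.coord_apply_combination_of_mem (s := Finset.univ) (i := ⟨p, hp⟩)
    (Finset.mem_univ _) (w := fun q : K => w q) hs
  rw [Finset.affineCombination_eq_linear_combination _ _ _ hs] at this
  rw [← this, ← h2, ← Finset.sum_coe_sort K (fun q => w q • q)]
  rfl

lemma IsSimplex.bary_self (hK : IsSimplex K) {p : Pt d} (hp : p ∈ K) : bary K p p = 1 := by
  rw [hK.bary_eq hp]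
  exact hK.basis.coord_apply_eq ⟨p, hp⟩

lemma IsSimplex.bary_ne (hK : IsSimplex K) {p q : Pt d} (hq : q ∈ K) (h : p ≠ q) :
    bary K p q = 0 := by
  by_cases hp : p ∈ K
  · rw [hK.bary_eq hp]
    exact hK.basis.coord_apply_ne (i := ⟨p, hp⟩) (j := ⟨q, hq⟩) (by simpa using h)
  · exact bary_of_notMem hp q

/-- A barycentric coordinate as a continuous affine function. -/
lemma IsSimplex.exists_bary_eq_affine (hK : IsSimplex K) (p : Pt d) :
    ∃ (L : Pt d →L[ℝ] ℝ) (c : ℝ), ∀ x, bary K p x = L x + c := by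
  by_cases hp : p ∈ K
  · refine ⟨(hK.basis.coord ⟨p, hp⟩).linear.toContinuousLinearMap, bary K p 0, fun x => ?_⟩
    rw [hK.bary_eq hp, hK.bary_eq hp]
    have := (hK.basis.coord ⟨p, hp⟩).map_vadd 0 x
    simpa using this
  · exact ⟨0, 0, fun x => by simp [bary_of_notMem hp]⟩

/-- A barycentric coordinate is affine with gradient `baryGrad K p`. -/
lemma IsSimplex.bary_eq_add_inner (hK : IsSimplex K) (p x y : Pt d) :
    bary K p y = bary K p x + ⟪baryGrad K p, y - x⟫_ℝ := by
  obtain ⟨L, c, h⟩ := hK.exists_bary_eq_affine p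
  have hL : HasFDerivAt (bary K p) L 0 := by
    have : bary K p = fun x => L x + c := funext h
    rw [this]
    exact L.hasFDerivAt.add_const c
  have : baryGrad K p = (InnerProductSpace.toDual ℝ (Pt d)).symm L := hL.hasGradientAt.gradient
  rw [this, InnerProductSpace.toDual_symm_apply, h, h, map_sub]
  ring

lemma IsSimplex.hasFDerivAt_bary (hK : IsSimplex K) (p x : Pt d) :
    HasFDerivAt (bary K p) (innerSL ℝ (baryGrad K p)) x := by
  have : bary K p = fun y => innerSL ℝ (baryGrad K p) y
      + (bary K p x - ⟪baryGrad K p, x⟫_ℝ) := by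
    funext y
    rw [hK.bary_eq_add_inner p x y, innerSL_apply_apply, inner_sub_right]
    ring
  rw [this]
  exact (innerSL ℝ (baryGrad K p)).hasFDerivAt.add_const _

lemma IsSimplex.contDiff_bary (hK : IsSimplex K) (p : Pt d) {n : WithTop ℕ∞} :
    ContDiff ℝ n (bary K p) := by
  obtain ⟨L, c, h⟩ := hK.exists_bary_eq_affine p
  have : bary K p = fun x => L x + c := funext h
  rw [this]
  exact L.contDiff.add contDiff_const

lemma IsSimplex.continuous_bary (hK : IsSimplex K) (p : Pt d) : Continuous (bary K p) :=
  (hK.contDiff_bary p (n := 0)).continuous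

lemma IsSimplex.bary_lineMap (hK : IsSimplex K) (p x y : Pt d) (t : ℝ) :
    bary K p (x + t • (y - x)) = (1 - t) * bary K p x + t * bary K p y := by
  rw [hK.bary_eq_add_inner p x y, hK.bary_eq_add_inner p x (x + t • (y - x))]
  simp [inner_smul_right]
  ring

lemma IsSimplex.sum_baryGrad (hK : IsSimplex K) : ∑ p ∈ K, baryGrad K p = 0 := by
  refine ext_inner_right ℝ fun v => ?_
  have h : ∀ p ∈ K, ⟪baryGrad K p, v⟫_ℝ = bary K p v - bary K p 0 := fun p _ => by
    rw [hK.bary_eq_add_inner p 0 v]; simp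
  rw [sum_inner, Finset.sum_congr rfl h, Finset.sum_sub_distrib, hK.sum_bary, hK.sum_bary]
  simp

lemma mem_cell_iff_exists (S : Finset (Pt d)) (x : Pt d) :
    x ∈ cell S ↔ ∃ w : Pt d → ℝ, (∀ p ∈ S, 0 ≤ w p) ∧ ∑ p ∈ S, w p = 1 ∧
      ∑ p ∈ S, w p • p = x := by
  rw [cell, Finset.mem_convexHull]
  constructor
  · rintro ⟨w, h0, h1, h2⟩
    refine ⟨w, h0, h1, ?_⟩
    rw [← h2, Finset.centerMass_eq_of_sum_1 _ _ h1]
    rfl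
  · rintro ⟨w, h0, h1, h2⟩
    refine ⟨w, h0, h1, ?_⟩
    rw [← h2, Finset.centerMass_eq_of_sum_1 _ _ h1]
    rfl

/-- The face of the simplex `K` spanned by a subset `S` of the vertices. -/
lemma IsSimplex.mem_cell_subset_iff (hK : IsSimplex K) {S : Finset (Pt d)} (hS : S ⊆ K)
    (x : Pt d) :
    x ∈ cell S ↔ (∀ p ∈ S, 0 ≤ bary K p x) ∧ ∀ p ∈ K, p ∉ S → bary K p x = 0 := by
  rw [mem_cell_iff_exists]
  constructor
  · rintro ⟨w, h0, h1, h2⟩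
    have key : ∀ p ∈ K, bary K p x = if p ∈ S then w p else 0 := fun p hp => by
      refine hK.bary_unique (w := fun p => if p ∈ S then w p else 0) ?_ ?_ hp
      · rw [← h1, ← Finset.sum_filter, Finset.filter_mem_eq_inter, Finset.inter_eq_right.2 hS]
      · rw [← h2]
        simp only [ite_smul, zero_smul]
        rw [← Finset.sum_filter, Finset.filter_mem_eq_inter, Finset.inter_eq_right.2 hS]
    refine ⟨fun p hp => ?_, fun p hp hpS => ?_⟩
    · rw [key p (hS hp), if_pos hp]; exact h0 p hp
    · rw [key p hp, if_neg hpS]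
  · rintro ⟨h0, h1⟩
    refine ⟨fun p => bary K p x, h0, ?_, ?_⟩
    · rw [← hK.sum_bary x]
      exact Finset.sum_subset hS fun p hp hpS => h1 p hp hpS
    · conv_rhs => rw [← hK.sum_bary_smul x]
      exact Finset.sum_subset hS fun p hp hpS => by simp only [h1 p hp hpS, zero_smul]

lemma IsSimplex.mem_cell_iff (hK : IsSimplex K) (x : Pt d) :
    x ∈ cell K ↔ ∀ p ∈ K, 0 ≤ bary K p x := by
  rw [hK.mem_cell_subset_iff subset_rfl]
  exact ⟨fun h => h.1, fun h => ⟨h, fun p hp hp' => absurd hp hp'⟩⟩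

lemma IsSimplex.mem_facet_iff (hK : IsSimplex K) {q : Pt d} (hq : q ∈ K) (x : Pt d) :
    x ∈ cell (K.erase q) ↔ x ∈ cell K ∧ bary K q x = 0 := by
  rw [hK.mem_cell_subset_iff (Finset.erase_subset _ _), hK.mem_cell_iff]
  constructor
  · rintro ⟨h1, h2⟩
    have := h2 q hq (by simp)
    refine ⟨fun p hp => ?_, this⟩
    by_cases h : p = q
    · rw [h, this]
    · exact h1 p (Finset.mem_erase.2 ⟨h, hp⟩)
  · rintro ⟨h1, h2⟩
    refine ⟨fun p hp => h1 p (Finset.mem_of_mem_erase hp), fun p hp hpS => ?_⟩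
    have : p = q := by by_contra h; exact hpS (Finset.mem_erase.2 ⟨h, hp⟩)
    rw [this, h2]

lemma IsSimplex.interior_cell (hK : IsSimplex K) :
    interior (cell K) = {x | ∀ p ∈ K, 0 < bary K p x} := by
  have h := hK.basis.interior_convexHull
  have hr : range hK.basis = (K : Set (Pt d)) := Subtype.range_coe
  rw [hr] at h
  rw [cell, h]
  ext x
  simp only [mem_ofPred_eq, Subtype.forall]
  exact forall₂_congr fun p hp => by rw [hK.bary_eq hp]

lemma bary_nonneg (hK : IsSimplex K) {x : Pt d} (hx : x ∈ cell K) (p : Pt d) :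
    0 ≤ bary K p x := by
  by_cases hp : p ∈ K
  · exact (hK.mem_cell_iff x).1 hx p hp
  · rw [bary_of_notMem hp]

lemma bary_le_one (hK : IsSimplex K) {x : Pt d} (hx : x ∈ cell K) (p : Pt d) :
    bary K p x ≤ 1 := by
  by_cases hp : p ∈ K
  · rw [← hK.sum_bary x]
    exact Finset.single_le_sum (fun p _ => bary_nonneg hK hx p) hp
  · rw [bary_of_notMem hp]; exact zero_le_one

lemma isCompact_cell (S : Finset (Pt d)) : IsCompact (cell S) :=
  S.finite_toSet.isCompact_convexHull ℝ

lemma measurableSet_cell (S : Finset (Pt d)) : MeasurableSet (cell S) :=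
  (isCompact_cell S).isClosed.measurableSet

lemma convex_cell (S : Finset (Pt d)) : Convex ℝ (cell S) := convex_convexHull ℝ _

lemma mem_cell_of_mem {S : Finset (Pt d)} {p : Pt d} (hp : p ∈ S) : p ∈ cell S :=
  subset_convexHull ℝ _ hp

lemma cell_mono {S S' : Finset (Pt d)} (h : S ⊆ S') : cell S ⊆ cell S' :=
  convexHull_mono (by exact_mod_cast h)

lemma baryGrad_ne_zero (hd : 1 ≤ d) (hK : IsSimplex K) {q : Pt d} (hq : q ∈ K) :
    baryGrad K q ≠ 0 := by
  intro h0
  have : 1 < K.card := by rw [hK.card_eq]; omega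
  obtain ⟨p, hp, hpq⟩ := Finset.exists_mem_ne this q
  have h := hK.bary_eq_add_inner q p q
  rw [hK.bary_self hq, hK.bary_ne hp hpq.symm, h0] at h
  simp at h

/-- An inscribed ball of radius `r` lies between the level sets `0` and `1` of each barycentric
coordinate, whose distance is therefore at least `2 r`. -/
lemma norm_baryGrad_le (hK : IsSimplex K) {c : Pt d} {r : ℝ} (hr : 0 < r)
    (hc : Metric.closedBall c r ⊆ cell K) (p : Pt d) : ‖baryGrad K p‖ ≤ 1 / (2 * r) := by
  rcases eq_or_ne (baryGrad K p) 0 with h0 | h0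
  · rw [h0, norm_zero]; positivity
  have hn : 0 < ‖baryGrad K p‖ := norm_pos_iff.2 h0
  set e : Pt d := (r / ‖baryGrad K p‖) • baryGrad K p with he
  have hne : ‖e‖ = r := by
    rw [he, norm_smul, Real.norm_of_nonneg (by positivity)]
    field_simp
  have h1 : c + e ∈ cell K := hc (by simp [hne])
  have h2 : c - e ∈ cell K := hc (by simp [hne])
  have h := hK.bary_eq_add_inner p (c - e) (c + e)
  have e1 : c + e - (c - e) = (2 : ℝ) • e := by module
  rw [e1, inner_smul_right, he, inner_smul_right, real_inner_self_eq_norm_sq] at h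
  have h3 := bary_nonneg hK h2 p
  have h4 := bary_le_one hK h1 p
  rw [le_div_iff₀ (by positivity)]
  have : 2 * (r / ‖baryGrad K p‖ * ‖baryGrad K p‖ ^ 2) = 2 * r * ‖baryGrad K p‖ := by
    field_simp
  rw [this] at h
  nlinarith

lemma volume_cell_diff_interior (K : Finset (Pt d)) :
    volume (cell K \ interior (cell K)) = 0 := by
  have := (convex_cell K).addHaar_frontier volume
  rwa [(isCompact_cell K).isClosed.frontier_eq] at this

lemma ae_mem_interior_cell (K : Finset (Pt d)) :
    ∀ᵐ x ∂(volume.restrict (cell K)), x ∈ interior (cell K) := by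
  rw [ae_restrict_iff' (measurableSet_cell K)]
  have := volume_cell_diff_interior K
  rw [measure_eq_zero_iff_ae_notMem] at this
  filter_upwards [this] with x hx hxK
  by_contra h
  exact hx ⟨hxK, h⟩

end

section

variable {d : ℕ} {K : Finset (Pt d)}

/-! ### A simplex as a cone over one of its facets -/

/-- The surface measure on the face spanned by `l`. -/
def facetMeasure (l : Finset (Pt d)) : Measure (Pt d) := μHE[d - 1].restrict (cell l)

/-- The parametrization `(t, y) ↦ q + t (y - q)` of a cone with apex `q`. -/
def coneMap (q : Pt d) (z : ℝ × Pt d) : Pt d := q + z.1 • (z.2 - q)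

/-- The radial measure `H t^(d-1) dt` on `(0, 1]` of a cone of height `H = 1 / |∇λ_q|`. -/
def coneWeight (K : Finset (Pt d)) (q : Pt d) : Measure ℝ :=
  (volume.restrict (Ioc 0 1)).withDensity
    fun t => ENNReal.ofReal (‖baryGrad K q‖⁻¹ * t ^ (d - 1))

lemma continuous_coneMap (q : Pt d) : Continuous (coneMap q) := by
  unfold coneMap; fun_prop

lemma bary_coneMap (hK : IsSimplex K) (p q y : Pt d) (t : ℝ) :
    bary K p (coneMap q (t, y)) = (1 - t) * bary K p q + t * bary K p y :=
  hK.bary_lineMap p q y t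

lemma coneMap_mem_cell_iff (hK : IsSimplex K) {q y : Pt d} (hq : q ∈ K) {t : ℝ} (ht : 0 < t)
    (ht1 : t ≤ 1) (hy : bary K q y = 0) : coneMap q (t, y) ∈ cell K ↔ y ∈ cell (K.erase q) := by
  rw [hK.mem_facet_iff hq, hK.mem_cell_iff, hK.mem_cell_iff]
  constructor
  · refine fun h => ⟨fun p hp => ?_, hy⟩
    by_cases hpq : p = q
    · rw [hpq, hy]
    · have := h p hp
      rw [bary_coneMap hK, hK.bary_ne hq hpq, mul_zero, zero_add] at this
      exact nonneg_of_mul_nonneg_right this ht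
  · rintro ⟨h, -⟩ p hp
    rw [bary_coneMap hK]
    have h1 : 0 ≤ bary K p q := bary_nonneg hK (mem_cell_of_mem hq) p
    have := h p hp
    have : 0 ≤ 1 - t := by linarith
    positivity

/-- Fubini's theorem for a simplex sliced parallel to the facet opposite `q`; the slices are
scaled copies of the facet. -/
lemma volume_inter_cell (hd : 1 ≤ d) (hK : IsSimplex K) {q : Pt d} (hq : q ∈ K) {t : Set (Pt d)}
    (ht : MeasurableSet t) :
    volume (t ∩ cell K) = ∫⁻ x in Ioc (0 : ℝ) 1, ENNReal.ofReal (‖baryGrad K q‖⁻¹ * x ^ (d - 1)) *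
      facetMeasure (K.erase q) {y | coneMap q (x, y) ∈ t} := by
  set g := baryGrad K q with hg
  have hg0 : g ≠ 0 := baryGrad_ne_zero hd hK hq
  have hgn : 0 < ‖g‖ := norm_pos_iff.2 hg0
  set v : Pt d := -(‖g‖ ^ 2)⁻¹ • g with hv
  have hv0 : v ≠ 0 := by
    rw [hv]; exact smul_ne_zero (neg_ne_zero.2 (by positivity)) hg0
  have hvn : ‖v‖ = ‖g‖⁻¹ := by
    rw [hv, norm_smul, norm_neg, norm_inv, norm_pow, norm_norm]; field_simp
  have hslice : ∀ (x : ℝ) (y : Pt d), y ∈ (AffineSubspace.mk' (x • v +ᵥ q) (ℝ ∙ v)ᗮ) ↔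
      bary K q y = 1 - x := by
    intro x y
    rw [AffineSubspace.mem_mk', Submodule.mem_orthogonal_singleton_iff_inner_right,
      hK.bary_eq_add_inner q q y, hK.bary_self hq, ← hg]
    have e1 : y -ᵥ (x • v +ᵥ q) = (y - q) - x • v := by
      simp only [vsub_eq_sub, vadd_eq_add]; abel
    rw [e1, inner_sub_right, inner_smul_right, real_inner_self_eq_norm_sq, hvn]
    have e2 : ⟪v, y - q⟫_ℝ = -(‖g‖ ^ 2)⁻¹ * ⟪g, y - q⟫_ℝ := by
      rw [hv, real_inner_smul_left]
    rw [e2]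
    constructor
    · intro h; field_simp at h; linarith
    · intro h
      have : ⟪g, y - q⟫_ℝ = -x := by linarith
      rw [this]; field_simp; ring
  have hmeas : MeasurableSet (t ∩ cell K) := ht.inter (measurableSet_cell K)
  have hF := EuclideanGeometry.euclideanHausdorffMeasure_eq_lintegral q hv0 hmeas
  have hfr : Module.finrank ℝ (Pt d) = d := by simp
  rw [InnerProductSpace.euclideanHausdorffMeasure_eq_volume, hfr] at hF
  rw [hF, ← lintegral_const_mul' _ _ (by simp)]
  -- the slice through the apex has measure zero in the outer variable
  have hae : ∀ᵐ x : ℝ, x ≠ 0 := by simp [ae_iff]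
  rw [← lintegral_indicator measurableSet_Ioc]
  refine lintegral_congr_ae ?_
  filter_upwards [hae] with x hx0
  by_cases hx : x ∈ Ioc (0 : ℝ) 1
  · rw [indicator_of_mem hx]
    have himg : t ∩ cell K ∩ (AffineSubspace.mk' (x • v +ᵥ q) (ℝ ∙ v)ᗮ : Set (Pt d)) =
        AffineMap.homothety q x '' ({y | coneMap q (x, y) ∈ t} ∩ cell (K.erase q)) := by
      have hh : ∀ y, AffineMap.homothety q x y = coneMap q (x, y) := fun y => by
        simp [AffineMap.homothety_apply, coneMap, add_comm]
      ext z
      simp only [mem_inter_iff, SetLike.mem_coe, hslice, mem_image, hh, mem_ofPred_eq]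
      constructor
      · rintro ⟨⟨hz1, hz2⟩, hz3⟩
        have hcz : coneMap q (x, q + x⁻¹ • (z - q)) = z := by
          simp [coneMap, smul_smul, mul_inv_cancel₀ hx0]
        have hb : bary K q (q + x⁻¹ • (z - q)) = 0 := by
          rw [hK.bary_lineMap, hK.bary_self hq, hz3]; field_simp; ring
        refine ⟨q + x⁻¹ • (z - q), ⟨by rwa [hcz], ?_⟩, hcz⟩
        rw [← coneMap_mem_cell_iff hK hq hx.1 hx.2 hb, hcz]
        exact hz2
      · rintro ⟨y, ⟨hy1, hy2⟩, rfl⟩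
        have hb := ((hK.mem_facet_iff hq y).1 hy2).2
        refine ⟨⟨hy1, (coneMap_mem_cell_iff hK hq hx.1 hx.2 hb).2 hy2⟩, ?_⟩
        rw [bary_coneMap hK, hK.bary_self hq, hb]; ring
    have hmt : MeasurableSet {y | coneMap q (x, y) ∈ t} :=
      ((continuous_coneMap q).comp (Continuous.prodMk_right x)).measurable ht
    rw [himg, euclideanHausdorffMeasure_homothety_image _ _ hx0, facetMeasure,
      Measure.restrict_apply hmt,
      ENNReal.ofReal_mul (by positivity), ENNReal.smul_def, smul_eq_mul, mul_assoc]
    congr 1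
    · rw [← hvn, ofReal_norm]
    · congr 1
      rw [ENNReal.ofReal_pow hx.1.le, ENNReal.coe_pow]
      congr 1
      rw [← enorm_eq_nnnorm, ← ofReal_norm, Real.norm_of_nonneg hx.1.le]
  · rw [indicator_of_notMem hx]
    have : t ∩ cell K ∩ (AffineSubspace.mk' (x • v +ᵥ q) (ℝ ∙ v)ᗮ : Set (Pt d)) = ∅ := by
      rw [eq_empty_iff_forall_notMem]
      rintro z ⟨⟨-, hz⟩, hz3⟩
      rw [SetLike.mem_coe, hslice] at hz3
      have h1 := bary_nonneg hK hz q
      have h2 := bary_le_one hK hz q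
      exact hx ⟨lt_of_le_of_ne (by linarith) hx0.symm, by linarith⟩
    rw [this, measure_empty, mul_zero]

/-- The facet has finite area, since otherwise the cone over it would have infinite volume. -/
lemma facetMeasure_lt_top (hd : 1 ≤ d) (hK : IsSimplex K) {q : Pt d} (hq : q ∈ K) :
    facetMeasure (K.erase q) univ < ⊤ := by
  by_contra h
  rw [not_lt, top_le_iff] at h
  have h1 := volume_inter_cell hd hK hq MeasurableSet.univ
  have h2 : volume (univ ∩ cell K) < ⊤ := by
    rw [univ_inter]; exact (isCompact_cell K).measure_lt_top
  rw [h1] at h2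
  have h3 : ∫⁻ x in Ioc (0 : ℝ) 1, ENNReal.ofReal (‖baryGrad K q‖⁻¹ * x ^ (d - 1)) *
      facetMeasure (K.erase q) {y | coneMap q (x, y) ∈ univ} = ∫⁻ x in Ioc (0 : ℝ) 1, (⊤ : ℝ≥0∞) := by
    refine setLIntegral_congr_fun measurableSet_Ioc fun x hx => ?_
    have : 0 < ‖baryGrad K q‖ := norm_pos_iff.2 (baryGrad_ne_zero hd hK hq)
    have hx0 := hx.1
    simp only [mem_univ, ofPred_true, h]
    rw [ENNReal.mul_top]
    rw [ne_eq, ENNReal.ofReal_eq_zero, not_le]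
    positivity
  rw [h3] at h2
  simp at h2

lemma isFiniteMeasure_facetMeasure (hd : 1 ≤ d) (hK : IsSimplex K) {q : Pt d} (hq : q ∈ K) :
    IsFiniteMeasure (facetMeasure (K.erase q)) := ⟨facetMeasure_lt_top hd hK hq⟩

instance (K : Finset (Pt d)) (q : Pt d) : SFinite (coneWeight K q) := by
  unfold coneWeight; infer_instance

/-- Polar coordinates centred at a vertex of a simplex. -/
theorem map_coneMap (hd : 1 ≤ d) (hK : IsSimplex K) {q : Pt d} (hq : q ∈ K) :
    Measure.map (coneMap q) ((coneWeight K q).prod (facetMeasure (K.erase q))) =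
      volume.restrict (cell K) := by
  have := isFiniteMeasure_facetMeasure hd hK hq
  ext t ht
  have hm : MeasurableSet (coneMap q ⁻¹' t) := (continuous_coneMap q).measurable ht
  rw [Measure.map_apply (continuous_coneMap q).measurable ht, Measure.restrict_apply ht,
    volume_inter_cell hd hK hq ht, Measure.prod_apply hm, coneWeight,
    lintegral_withDensity_eq_lintegral_mul _ (by fun_prop) (measurable_measure_prodMk_left hm)]
  rfl

/-- Almost every point of a facet lies in its relative interior. -/
lemma ae_facetMeasure_bary_pos (hd : 1 ≤ d) (hK : IsSimplex K) {q : Pt d} (hq : q ∈ K) :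
    ∀ᵐ y ∂(facetMeasure (K.erase q)), ∀ p ∈ K, p ≠ q → 0 < bary K p y := by
  have := isFiniteMeasure_facetMeasure hd hK hq
  have h1 := ae_mem_interior_cell K
  rw [← map_coneMap hd hK hq] at h1
  have h2 := ae_of_ae_map (continuous_coneMap q).aemeasurable h1
  rw [← Measure.prod_swap] at h2
  have h3 := ae_of_ae_map measurable_swap.aemeasurable h2
  have h4 := Measure.ae_ae_of_ae_prod h3
  have hw : ∃ᵐ t ∂(coneWeight K q), 0 < t := by
    intro h
    rw [coneWeight, ae_withDensity_iff (by fun_prop), ae_restrict_iff' measurableSet_Ioc,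
      ae_iff] at h
    have hsub : Ioc (0 : ℝ) 1 ⊆ {a | ¬(a ∈ Ioc (0:ℝ) 1 →
        ENNReal.ofReal (‖baryGrad K q‖⁻¹ * a ^ (d - 1)) ≠ 0 → ¬0 < a)} := by
      intro t ht
      have : 0 < ‖baryGrad K q‖ := norm_pos_iff.2 (baryGrad_ne_zero hd hK hq)
      have ht0 := ht.1
      simp only [mem_ofPred_eq, not_forall, not_not]
      refine ⟨ht, ?_, ht0⟩
      rw [ne_eq, ENNReal.ofReal_eq_zero, not_le]
      positivity
    have := measure_mono_null hsub h
    simp at this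
  filter_upwards [h4] with y hy p hp hpq
  obtain ⟨t, ht0, ht⟩ := (hw.and_eventually hy).exists
  rw [hK.interior_cell] at ht
  have h5 := ht p hp
  change 0 < bary K p (coneMap q (t, y)) at h5
  rw [bary_coneMap hK, hK.bary_ne hq hpq, mul_zero, zero_add] at h5
  exact pos_of_mul_pos_right h5 ht0.le

/-! ### Lipschitz functions on a simplex -/

/-- A Lipschitz function on a simplex has a Lipschitz extension to the whole space, with the same
derivative in the interior. -/
lemma exists_lipschitz_extension {g : Pt d → ℝ} {C : ℝ≥0} {s : Set (Pt d)}
    (hg : LipschitzOnWith C g s) :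
    ∃ g' : Pt d → ℝ, LipschitzWith C g' ∧ EqOn g g' s ∧
      ∀ x ∈ interior s, fderiv ℝ g x = fderiv ℝ g' x := by
  obtain ⟨g', h1, h2⟩ := hg.extend_real
  refine ⟨g', h1, h2, fun x hx => Filter.EventuallyEq.fderiv_eq ?_⟩
  filter_upwards [mem_interior_iff_mem_nhds.1 hx] with y hy using h2 hy

lemma ae_differentiableAt_of_lipschitzOn {g : Pt d → ℝ} {C : ℝ≥0}
    (hg : LipschitzOnWith C g (cell K)) :
    ∀ᵐ x ∂(volume.restrict (cell K)), DifferentiableAt ℝ g x := by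
  obtain ⟨g', h1, h2⟩ := hg.extend_real
  filter_upwards [ae_mem_interior_cell K, ae_restrict_of_ae h1.ae_differentiableAt] with x hx hx'
  refine hx'.congr_of_eventuallyEq ?_
  filter_upwards [mem_interior_iff_mem_nhds.1 hx] with y hy using h2 hy

lemma aestronglyMeasurable_fderiv_of_lipschitzOn {g : Pt d → ℝ} {C : ℝ≥0}
    (hg : LipschitzOnWith C g (cell K)) :
    AEStronglyMeasurable (fderiv ℝ g) (volume.restrict (cell K)) := by
  obtain ⟨g', h1, h2, h3⟩ := exists_lipschitz_extension hg
  refine AEStronglyMeasurable.congr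
    (measurable_fderiv ℝ g').aestronglyMeasurable ?_
  filter_upwards [ae_mem_interior_cell K] with x hx using (h3 x hx).symm

lemma ae_norm_fderiv_le_of_lipschitzOn {g : Pt d → ℝ} {C : ℝ≥0}
    (hg : LipschitzOnWith C g (cell K)) :
    ∀ᵐ x ∂(volume.restrict (cell K)), ‖fderiv ℝ g x‖ ≤ C := by
  obtain ⟨g', h1, h2, h3⟩ := exists_lipschitz_extension hg
  filter_upwards [ae_mem_interior_cell K] with x hx
  rw [h3 x hx]
  exact norm_fderiv_le_of_lipschitz ℝ h1

/-- Radial part of the divergence theorem on a simplex: the field `(x - q) g` is tangential on all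
facets but the one opposite `q`. -/
theorem integral_radial (hd : 1 ≤ d) (hK : IsSimplex K) {q : Pt d} (hq : q ∈ K) {g : Pt d → ℝ}
    {C : ℝ≥0} (hg : LipschitzOnWith C g (cell K)) :
    ∫ x in cell K, (d * g x + fderiv ℝ g x (x - q)) =
      ‖baryGrad K q‖⁻¹ * ∫ y, g y ∂(facetMeasure (K.erase q)) := by
  have := isFiniteMeasure_facetMeasure hd hK hq
  obtain ⟨g', hg', hEq, hfd⟩ := exists_lipschitz_extension hg
  set D : Pt d → ℝ := fun x => d * g' x + fderiv ℝ g' x (x - q) with hD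
  have e1 : ∫ x in cell K, (d * g x + fderiv ℝ g x (x - q)) = ∫ x in cell K, D x := by
    refine integral_congr_ae ?_
    filter_upwards [ae_mem_interior_cell K] with x hx
    rw [hD, hEq (interior_subset hx), hfd x hx]
  have e2 : ∫ y, g y ∂(facetMeasure (K.erase q)) = ∫ y, g' y ∂(facetMeasure (K.erase q)) :=
    setIntegral_congr_fun (measurableSet_cell _) fun y hy =>
      hEq (cell_mono (Finset.erase_subset _ _) hy)
  rw [e1, e2]
  have hDm : Measurable D := by
    have h1 : Measurable (fderiv ℝ g') := measurable_fderiv ℝ g'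
    have h2 : Measurable g' := hg'.continuous.measurable
    have h3 : Measurable fun x => fderiv ℝ g' x (x - q) := by
      have : Continuous fun z : (Pt d →L[ℝ] ℝ) × Pt d => z.1 z.2 := by fun_prop
      exact this.measurable.comp (h1.prodMk (measurable_id.sub_const q))
    exact (h2.const_mul _).add h3
  have hDi : IntegrableOn D (cell K) := by
    have hc : ContinuousOn (fun x => d * |g' x| + C * ‖x - q‖) (cell K) := by
      have := hg'.continuous
      fun_prop
    refine Integrable.mono' (hc.integrableOn_compact (isCompact_cell K))
      hDm.aestronglyMeasurable (Eventually.of_forall fun x => ?_)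
    refine (norm_add_le _ _).trans (add_le_add ?_ ?_)
    · simp
    · exact ((fderiv ℝ g' x).le_opNorm _).trans (mul_le_mul_of_nonneg_right
        (norm_fderiv_le_of_lipschitz ℝ hg') (norm_nonneg _))
  have hdiff : ∀ᵐ x ∂(volume.restrict (cell K)), DifferentiableAt ℝ g' x :=
    ae_restrict_of_ae hg'.ae_differentiableAt
  rw [IntegrableOn, ← map_coneMap hd hK hq, integrable_map_measure
    hDm.aestronglyMeasurable (continuous_coneMap q).aemeasurable] at hDi
  rw [← map_coneMap hd hK hq] at hdiff ⊢
  rw [integral_map (continuous_coneMap q).aemeasurable hDm.aestronglyMeasurable]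
  have h2 := ae_of_ae_map (continuous_coneMap q).aemeasurable hdiff
  rw [← Measure.prod_swap] at h2
  have h4 := Measure.ae_ae_of_ae_prod (ae_of_ae_map measurable_swap.aemeasurable h2)
  have e5 := integral_prod_symm _ hDi
  simp only [Function.comp_apply] at e5
  rw [e5, ← integral_const_mul]
  refine integral_congr_ae ?_
  filter_upwards [h4] with y hy
  have hgpos : 0 < ‖baryGrad K q‖ := norm_pos_iff.2 (baryGrad_ne_zero hd hK hq)
  rw [coneWeight, integral_withDensity_eq_integral_toReal_smul (by fun_prop)
    (Eventually.of_forall fun _ => ENNReal.ofReal_lt_top)]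
  rw [coneWeight, ae_withDensity_iff (by fun_prop), ae_restrict_iff' measurableSet_Ioc] at hy
  -- along the ray through `y` the integrand is a derivative
  set k : ℝ → ℝ := fun t => t ^ d * g' (coneMap q (t, y)) with hk
  have hline : LipschitzWith (C * ‖y - q‖₊) fun t : ℝ => g' (coneMap q (t, y)) := by
    refine hg'.comp (LipschitzWith.of_dist_le_mul fun s t => ?_)
    rw [coneMap, coneMap, dist_add_left, dist_eq_norm, ← sub_smul, norm_smul, mul_comm]
    rfl
  have hac : AbsolutelyContinuousOnInterval k 0 1 := by
    refine AbsolutelyContinuousOnInterval.fun_mul ?_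
      (hline.lipschitzOnWith.absolutelyContinuousOnInterval)
    exact ContDiffOn.absolutelyContinuousOnInterval (by fun_prop)
  have hftc := hac.integral_deriv_eq_sub
  have hk1 : k 1 = g' y := by simp [hk, coneMap]
  have hk0 : k 0 = 0 := by simp [hk, show d ≠ 0 by omega]
  rw [hk1, hk0, sub_zero, intervalIntegral.integral_of_le zero_le_one] at hftc
  rw [← hftc, ← integral_const_mul]
  refine setIntegral_congr_ae measurableSet_Ioc ?_
  filter_upwards [hy] with t ht htm
  have ht0 := htm.1
  have hdt : DifferentiableAt ℝ g' (coneMap q (t, y)) := by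
    refine ht htm ?_
    rw [ne_eq, ENNReal.ofReal_eq_zero, not_le]
    positivity
  have hcm : HasDerivAt (fun s : ℝ => coneMap q (s, y)) (y - q) t := by
    have := ((hasDerivAt_id t).smul_const (y - q)).const_add q
    simpa [coneMap] using this
  have hder : HasDerivAt k (d * t ^ (d - 1) * g' (coneMap q (t, y)) +
      t ^ d * fderiv ℝ g' (coneMap q (t, y)) (y - q)) t :=
    (hasDerivAt_pow d t).mul (hdt.hasFDerivAt.comp_hasDerivAt t hcm)
  rw [hder.deriv, ENNReal.toReal_ofReal (by positivity), hD]
  have e3 : coneMap q (t, y) - q = t • (y - q) := by simp [coneMap]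
  have e4 : t ^ d = t ^ (d - 1) * t := by rw [← pow_succ]; congr 1; omega
  simp only [e3, map_smul, smul_eq_mul, e4]
  ring

end

section

variable {d : ℕ} {K : Finset (Pt d)}

/-! ### The divergence theorem on a simplex -/

/-- The inner unit normal of the facet of `K` opposite the vertex `q`. -/
def innerNormal (K : Finset (Pt d)) (q : Pt d) : Pt d := ‖baryGrad K q‖⁻¹ • baryGrad K q

lemma integrable_cell_of_bounded {g : Pt d → ℝ}
    (hg : AEStronglyMeasurable g (volume.restrict (cell K))) {M : ℝ}
    (hM : ∀ᵐ x ∂(volume.restrict (cell K)), ‖g x‖ ≤ M) :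
    Integrable g (volume.restrict (cell K)) := by
  have : IsFiniteMeasure (volume.restrict (cell K)) :=
    ⟨by rw [Measure.restrict_apply_univ]; exact (isCompact_cell K).measure_lt_top⟩
  exact Integrable.of_bound hg M hM

lemma integrable_facet_of_continuousOn (hd : 1 ≤ d) (hK : IsSimplex K) {q : Pt d} (hq : q ∈ K)
    {g : Pt d → ℝ} (hg : ContinuousOn g (cell (K.erase q))) :
    Integrable g (facetMeasure (K.erase q)) := by
  have := isFiniteMeasure_facetMeasure hd hK hq
  obtain ⟨M, hM⟩ := (isCompact_cell (K.erase q)).exists_bound_of_continuousOn hg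
  exact Integrable.of_bound (hg.aestronglyMeasurable (measurableSet_cell _)) M
    (by rw [facetMeasure, ae_restrict_iff' (measurableSet_cell _)]; exact Eventually.of_forall hM)

lemma integrable_fderiv_apply (v : Pt d) {g : Pt d → ℝ} {C : ℝ≥0}
    (hg : LipschitzOnWith C g (cell K)) :
    Integrable (fun x => fderiv ℝ g x v) (volume.restrict (cell K)) := by
  refine integrable_cell_of_bounded (M := C * ‖v‖)
    ((ContinuousLinearMap.apply ℝ ℝ v).continuous.comp_aestronglyMeasurable
      (aestronglyMeasurable_fderiv_of_lipschitzOn hg)) ?_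
  filter_upwards [ae_norm_fderiv_le_of_lipschitzOn hg] with x hx
  exact ((fderiv ℝ g x).le_opNorm v).trans (mul_le_mul_of_nonneg_right hx (norm_nonneg v))

lemma integrable_radial (q : Pt d) {g : Pt d → ℝ} {C : ℝ≥0}
    (hg : LipschitzOnWith C g (cell K)) :
    Integrable (fun x => d * g x + fderiv ℝ g x (x - q)) (volume.restrict (cell K)) := by
  have h1 : Integrable (fun x => d * g x) (volume.restrict (cell K)) :=
    (hg.continuousOn.integrableOn_compact (isCompact_cell K)).const_mul _
  refine h1.add ?_
  obtain ⟨M, hM⟩ := (isCompact_cell K).exists_bound_of_continuousOn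
    (f := fun x => x - q) (by fun_prop)
  refine integrable_cell_of_bounded (M := C * M) ?_ ?_
  · have : Continuous fun z : (Pt d →L[ℝ] ℝ) × Pt d => z.1 z.2 := by fun_prop
    exact this.comp_aestronglyMeasurable ((aestronglyMeasurable_fderiv_of_lipschitzOn hg).prodMk
      (continuous_id.sub continuous_const).aestronglyMeasurable)
  · filter_upwards [ae_norm_fderiv_le_of_lipschitzOn hg,
      ae_restrict_mem (measurableSet_cell K)] with x hx hxK
    exact ((fderiv ℝ g x).le_opNorm _).trans
      (mul_le_mul hx (hM x hxK) (norm_nonneg _) C.coe_nonneg)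

/-- The directions `p - q` from one vertex to the others span the space, with the derivatives of the
barycentric coordinates as coefficients. -/
lemma IsSimplex.sum_inner_baryGrad_smul (hK : IsSimplex K) (q v : Pt d) :
    ∑ p ∈ K, ⟪baryGrad K p, v⟫_ℝ • (p - q) = v := by
  have h : ∀ p ∈ K, ⟪baryGrad K p, v⟫_ℝ • (p - q) =
      (bary K p v • p - bary K p 0 • p) - ⟪baryGrad K p, v⟫_ℝ • q := fun p _ => by
    rw [hK.bary_eq_add_inner p 0 v, sub_zero]; module
  rw [Finset.sum_congr rfl h, Finset.sum_sub_distrib, Finset.sum_sub_distrib, hK.sum_bary_smul,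
    hK.sum_bary_smul, ← Finset.sum_smul, ← sum_inner, hK.sum_baryGrad]
  simp

/-- The divergence theorem for a field of constant direction. Subtracting the radial identities of two
vertices `p` and `q` gives the case `v = p - q`, and these directions span the space. -/
theorem integral_fderiv_apply (hd : 1 ≤ d) (hK : IsSimplex K) (v : Pt d) {g : Pt d → ℝ} {C : ℝ≥0}
    (hg : LipschitzOnWith C g (cell K)) :
    ∫ x in cell K, fderiv ℝ g x v =
      -∑ p ∈ K, ⟪innerNormal K p, v⟫_ℝ * ∫ y, g y ∂(facetMeasure (K.erase p)) := by
  obtain ⟨q, hq⟩ : K.Nonempty := Finset.card_pos.1 (by rw [hK.card_eq]; omega)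
  have hdiff : ∀ p ∈ K, ∫ x in cell K, fderiv ℝ g x (p - q) =
      ‖baryGrad K q‖⁻¹ * (∫ y, g y ∂(facetMeasure (K.erase q))) -
        ‖baryGrad K p‖⁻¹ * ∫ y, g y ∂(facetMeasure (K.erase p)) := fun p hp => by
    rw [← integral_radial hd hK hq hg, ← integral_radial hd hK hp hg,
      ← integral_sub (integrable_radial q hg) (integrable_radial p hg)]
    refine integral_congr_ae (Eventually.of_forall fun x => ?_)
    have : p - q = (x - q) - (x - p) := by abel
    simp only [this, map_sub]
    ring
  have hv : ∀ x, fderiv ℝ g x v = ∑ p ∈ K, ⟪baryGrad K p, v⟫_ℝ * fderiv ℝ g x (p - q) := fun x => by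
    conv_lhs => rw [← hK.sum_inner_baryGrad_smul q v]
    rw [map_sum]
    exact Finset.sum_congr rfl fun p _ => by rw [map_smul, smul_eq_mul]
  simp only [hv]
  rw [integral_finsetSum _ fun p _ => (integrable_fderiv_apply _ hg).const_mul _]
  have h2 : ∀ p ∈ K, ∫ x in cell K, ⟪baryGrad K p, v⟫_ℝ * fderiv ℝ g x (p - q) =
      ⟪baryGrad K p, v⟫_ℝ * (‖baryGrad K q‖⁻¹ * (∫ y, g y ∂(facetMeasure (K.erase q)))) -
        ⟪innerNormal K p, v⟫_ℝ * ∫ y, g y ∂(facetMeasure (K.erase p)) := fun p hp => by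
    rw [integral_const_mul, hdiff p hp, innerNormal, real_inner_smul_left]
    ring
  rw [Finset.sum_congr rfl h2, Finset.sum_sub_distrib, ← Finset.sum_mul, ← sum_inner,
    hK.sum_baryGrad]
  simp

lemma lipschitzOnWith_mul {s : Set (Pt d)} {g k : Pt d → ℝ} {C D : ℝ≥0} {A B : ℝ≥0}
    (hg : LipschitzOnWith C g s) (hk : LipschitzOnWith D k s) (hA : ∀ x ∈ s, |g x| ≤ A)
    (hB : ∀ x ∈ s, |k x| ≤ B) : LipschitzOnWith (A * D + B * C) (fun x => g x * k x) s := by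
  refine LipschitzOnWith.of_dist_le_mul fun x hx y hy => ?_
  have h1 := hg.dist_le_mul x hx y hy
  have h2 := hk.dist_le_mul x hx y hy
  rw [Real.dist_eq] at h1 h2 ⊢
  have e : g x * k x - g y * k y = g x * (k x - k y) + k y * (g x - g y) := by ring
  rw [e]
  refine (abs_add_le _ _).trans ?_
  rw [abs_mul, abs_mul]
  push_cast
  have h3 := mul_le_mul (hA x hx) h2 (abs_nonneg _) A.coe_nonneg
  have h4 := mul_le_mul (hB y hy) h1 (abs_nonneg _) B.coe_nonneg
  nlinarith

lemma exists_lipschitzOnWith_mul {s : Set (Pt d)} (hs : IsCompact s) {g k : Pt d → ℝ} {C D : ℝ≥0}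
    (hg : LipschitzOnWith C g s) (hk : LipschitzOnWith D k s) :
    ∃ E : ℝ≥0, LipschitzOnWith E (fun x => g x * k x) s := by
  obtain ⟨A, hA⟩ := hs.exists_bound_of_continuousOn hg.continuousOn
  obtain ⟨B, hB⟩ := hs.exists_bound_of_continuousOn hk.continuousOn
  exact ⟨_, lipschitzOnWith_mul (A := A.toNNReal) (B := B.toNNReal) hg hk
    (fun x hx => (hA x hx).trans (Real.le_coe_toNNReal A))
    (fun x hx => (hB x hx).trans (Real.le_coe_toNNReal B))⟩

/-- Integration by parts on a simplex for a Lipschitz function `ψ` and a field with Lipschitz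
components `P i`. -/
theorem integral_parts (hd : 1 ≤ d) (hK : IsSimplex K) {ψ : Pt d → ℝ} {C : ℝ≥0}
    (hψ : LipschitzOnWith C ψ (cell K)) {P : Fin d → Pt d → ℝ} {D : Fin d → ℝ≥0}
    (hP : ∀ i, LipschitzOnWith (D i) (P i) (cell K)) :
    ∫ x in cell K, (ψ x * ∑ i, fderiv ℝ (P i) x (EuclideanSpace.single i 1) +
        ∑ i, fderiv ℝ ψ x (EuclideanSpace.single i 1) * P i x) =
      -∑ p ∈ K, ∫ y, ψ y * ∑ i, innerNormal K p i * P i y ∂(facetMeasure (K.erase p)) := by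
  choose E hE using fun i => exists_lipschitzOnWith_mul (isCompact_cell K) hψ (hP i)
  have h1 : ∫ x in cell K, (ψ x * ∑ i, fderiv ℝ (P i) x (EuclideanSpace.single i 1) +
        ∑ i, fderiv ℝ ψ x (EuclideanSpace.single i 1) * P i x) =
      ∫ x in cell K, ∑ i, fderiv ℝ (fun x => ψ x * P i x) x (EuclideanSpace.single i 1) := by
    refine integral_congr_ae ?_
    have hPd : ∀ᵐ x ∂(volume.restrict (cell K)), ∀ i, DifferentiableAt ℝ (P i) x :=
      ae_all_iff.2 fun i => ae_differentiableAt_of_lipschitzOn (hP i)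
    filter_upwards [hPd, ae_differentiableAt_of_lipschitzOn hψ] with x hx hx'
    rw [Finset.mul_sum, ← Finset.sum_add_distrib]
    refine Finset.sum_congr rfl fun i _ => ?_
    rw [fderiv_fun_mul hx' (hx i)]
    simp
    ring
  rw [h1, integral_finsetSum _ fun i _ => integrable_fderiv_apply _ (hE i)]
  simp only [fun i => integral_fderiv_apply hd hK (EuclideanSpace.single i 1) (hE i)]
  rw [Finset.sum_neg_distrib, Finset.sum_comm]
  congr 1
  refine Finset.sum_congr rfl fun p hp => ?_
  have hc : ∀ i, ContinuousOn (fun y => ψ y * P i y) (cell (K.erase p)) := fun i =>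
    (hE i).continuousOn.mono (cell_mono (Finset.erase_subset _ _))
  have h3 : ∀ y, ψ y * ∑ i, innerNormal K p i * P i y =
      ∑ i, innerNormal K p i * (ψ y * P i y) := fun y => by
    rw [Finset.mul_sum]
    exact Finset.sum_congr rfl fun i _ => by ring
  simp only [h3]
  rw [integral_finsetSum _ fun i _ =>
    (integrable_facet_of_continuousOn hd hK hp (hc i)).const_mul _]
  refine Finset.sum_congr rfl fun i _ => ?_
  rw [integral_const_mul]
  congr 1
  rw [EuclideanSpace.inner_single_right]
  simp

/-- The volume of a simplex is `1/d` times height times area of the base. -/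
lemma facetMeasure_univ (hd : 1 ≤ d) (hK : IsSimplex K) {q : Pt d} (hq : q ∈ K) :
    (facetMeasure (K.erase q)).real univ = ‖baryGrad K q‖ * (d * volume.real (cell K)) := by
  have h := integral_radial hd hK hq (g := fun _ => 1) (C := 0)
    (LipschitzWith.const 1).lipschitzOnWith
  have : 0 < ‖baryGrad K q‖ := norm_pos_iff.2 (baryGrad_ne_zero hd hK hq)
  simp at h
  rw [measureReal_def, measureReal_def] at *
  field_simp at h
  linarith

/-- Trace inequality: the square integral over a facet is controlled by that over the simplex. -/
theorem integral_facet_sq_le (hd : 1 ≤ d) (hK : IsSimplex K) {q : Pt d} (hq : q ∈ K)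
    {ψ : Pt d → ℝ} {C : ℝ≥0} (hψ : LipschitzOnWith C ψ (cell K)) {h : ℝ}
    (hh : ∀ x ∈ cell K, ‖x - q‖ ≤ h) :
    ‖baryGrad K q‖⁻¹ * ∫ y, ψ y ^ 2 ∂(facetMeasure (K.erase q)) ≤
      (d + 1) * (∫ x in cell K, ψ x ^ 2) + h ^ 2 * ∫ x in cell K, ‖fderiv ℝ ψ x‖ ^ 2 := by
  obtain ⟨E, hE⟩ := exists_lipschitzOnWith_mul (isCompact_cell K) hψ hψ
  have e : ∀ x, ψ x ^ 2 = ψ x * ψ x := fun x => sq _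
  have hrad := integral_radial hd hK hq hE
  simp only [← e] at hrad
  have i1 : Integrable (fun x => ψ x ^ 2) (volume.restrict (cell K)) :=
    (hψ.continuousOn.pow 2).integrableOn_compact (isCompact_cell K)
  have i2 : Integrable (fun x => ‖fderiv ℝ ψ x‖ ^ 2) (volume.restrict (cell K)) := by
    refine integrable_cell_of_bounded (M := (C : ℝ) ^ 2)
      ((aestronglyMeasurable_fderiv_of_lipschitzOn hψ).norm.pow 2) ?_
    filter_upwards [ae_norm_fderiv_le_of_lipschitzOn hψ] with x hx
    rw [norm_pow, norm_norm]
    gcongr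
  rw [← hrad, ← integral_const_mul, ← integral_const_mul, ← integral_add (i1.const_mul _)
    (i2.const_mul _)]
  have i3 := integrable_radial q hE
  simp only [← e] at i3
  refine integral_mono_ae i3 ((i1.const_mul _).add (i2.const_mul _)) ?_
  filter_upwards [ae_differentiableAt_of_lipschitzOn hψ,
    ae_restrict_mem (measurableSet_cell K)] with x hx hxK
  have e2 : fderiv ℝ (fun x => ψ x ^ 2) x (x - q) = 2 * ψ x * fderiv ℝ ψ x (x - q) := by
    have : (fun x => ψ x ^ 2) = fun x => ψ x * ψ x := funext e
    rw [this, fderiv_fun_mul hx hx]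
    simp
    ring
  simp only [e2]
  have h1 : |fderiv ℝ ψ x (x - q)| ≤ h * ‖fderiv ℝ ψ x‖ := by
    refine ((fderiv ℝ ψ x).le_opNorm _).trans ?_
    rw [mul_comm]
    exact mul_le_mul_of_nonneg_right (hh x hxK) (norm_nonneg _)
  have h2 : (fderiv ℝ ψ x (x - q)) ^ 2 ≤ h ^ 2 * ‖fderiv ℝ ψ x‖ ^ 2 := by
    rw [← sq_abs, ← mul_pow]; gcongr
  nlinarith [sq_nonneg (ψ x - fderiv ℝ ψ x (x - q))]

end

section

variable {d : ℕ} {Ω : Set (Pt d)} (T : Mesh Ω) {K K' : Finset (Pt d)}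

/-! ### Hat functions and the geometry of a conforming mesh -/

variable {T} in
lemma Mesh.isSimplex (hK : K ∈ T.elems) : IsSimplex K := ⟨T.card_eq K hK, T.indep K hK⟩

lemma Mesh.cell_inter (hK : K ∈ T.elems) (hK' : K' ∈ T.elems) :
    cell K ∩ cell K' = cell (K ∩ K') := by
  rw [T.conforming K hK K' hK', cell, Finset.coe_inter]

/-- On the intersection of two elements their barycentric coordinates agree. -/
lemma Mesh.bary_eq_bary (hK : K ∈ T.elems) (hK' : K' ∈ T.elems) {x : Pt d} (hx : x ∈ cell K)
    (hx' : x ∈ cell K') (p : Pt d) : bary K p x = bary K' p x := by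
  have hs := Mesh.isSimplex hK
  have hs' := Mesh.isSimplex hK'
  have hm : x ∈ cell (K ∩ K') := by rw [← T.cell_inter hK hK']; exact ⟨hx, hx'⟩
  have h1 := (hs.mem_cell_subset_iff Finset.inter_subset_left x).1 hm
  have h2 := (hs'.mem_cell_subset_iff Finset.inter_subset_right x).1 hm
  by_cases hp' : p ∈ K'
  · refine (hs'.bary_unique (w := fun p => bary K p x) ?_ ?_ hp').symm
    · rw [← Finset.sum_subset (Finset.inter_subset_right (s₁ := K)) fun p hp hpS =>
        bary_of_notMem (fun hpK => hpS (Finset.mem_inter.2 ⟨hpK, hp⟩)) x,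
        Finset.sum_subset (Finset.inter_subset_left (s₂ := K')) h1.2, hs.sum_bary]
    · conv_rhs => rw [← hs.sum_bary_smul x]
      rw [← Finset.sum_subset (Finset.inter_subset_right (s₁ := K)) fun p hp hpS => by
          rw [bary_of_notMem (fun hpK => hpS (Finset.mem_inter.2 ⟨hpK, hp⟩)) x, zero_smul]]
      exact Finset.sum_subset (Finset.inter_subset_left (s₂ := K')) fun p hp hpS => by
        rw [h1.2 p hp hpS, zero_smul]
  · rw [bary_of_notMem hp']
    by_cases hp : p ∈ K
    · exact h1.2 p hp fun h => hp' (Finset.mem_of_mem_inter_right h)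
    · exact bary_of_notMem hp x

lemma Mesh.mem_closure_iff (x : Pt d) : x ∈ closure Ω ↔ ∃ K ∈ T.elems, x ∈ cell K := by
  rw [← T.cover]; simp

lemma Mesh.cell_subset (hK : K ∈ T.elems) : cell K ⊆ closure Ω := fun x hx =>
  (T.mem_closure_iff x).2 ⟨K, hK, hx⟩

lemma Mesh.hat_eq_bary (hK : K ∈ T.elems) {x : Pt d} (hx : x ∈ cell K) (p : Pt d) :
    T.hat p x = bary K p x := by
  have hs := Mesh.isSimplex hK
  have hex : ∃ w : Pt d → ℝ, ∃ K ∈ T.elems, (∀ p ∈ K, 0 ≤ w p) ∧ (∀ p ∉ K, w p = 0) ∧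
      ∑ p ∈ K, w p = 1 ∧ ∑ p ∈ K, w p • p = x :=
    ⟨fun p => bary K p x, K, hK, fun p _ => bary_nonneg hs hx p, fun p hp => bary_of_notMem hp x,
      hs.sum_bary x, hs.sum_bary_smul x⟩
  have e : T.hat p x = hex.choose p := by simp only [Mesh.hat, Mesh.weights, dif_pos hex]
  obtain ⟨K', hK', h0, h1, h2, h3⟩ := hex.choose_spec
  have hx' : x ∈ cell K' := (mem_cell_iff_exists K' x).2 ⟨_, h0, h2, h3⟩
  rw [e, T.bary_eq_bary hK hK' hx hx']
  by_cases hp : p ∈ K'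
  · exact ((Mesh.isSimplex hK').bary_unique h2 h3 hp).symm
  · rw [h1 p hp, bary_of_notMem hp]

lemma Mesh.hat_of_notMem {x : Pt d} (hx : x ∉ closure Ω) (p : Pt d) : T.hat p x = 0 := by
  have hex : ¬∃ w : Pt d → ℝ, ∃ K ∈ T.elems, (∀ p ∈ K, 0 ≤ w p) ∧ (∀ p ∉ K, w p = 0) ∧
      ∑ p ∈ K, w p = 1 ∧ ∑ p ∈ K, w p • p = x := by
    rintro ⟨w, K', hK', h0, h1, h2, h3⟩
    exact hx ((T.mem_closure_iff x).2 ⟨K', hK', (mem_cell_iff_exists K' x).2 ⟨_, h0, h2, h3⟩⟩)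
  simp only [Mesh.hat, Mesh.weights, dif_neg hex, Pi.zero_apply]

/-- Continuity on `closure Ω` can be checked element by element. -/
lemma Mesh.continuousOn_closure {g : Pt d → ℝ} (h : ∀ K ∈ T.elems, ContinuousOn g (cell K)) :
    ContinuousOn g (closure Ω) := by
  have hc : closure Ω = ⋃ K' : T.elems, cell (K' : Finset (Pt d)) := by
    rw [← T.cover, iUnion_subtype]
  rw [hc]
  exact (locallyFinite_of_finite _).continuousOn_iUnion
    (fun _ => (isCompact_cell _).isClosed) fun K => h K K.2

lemma Mesh.continuousOn_hat (p : Pt d) : ContinuousOn (T.hat p) (closure Ω) :=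
  T.continuousOn_closure fun _ hK =>
    ((Mesh.isSimplex hK).continuous_bary p).continuousOn.congr fun _ hx => T.hat_eq_bary hK hx p

/-- A vertex with positive weight at a point is a vertex of every element containing the point. -/
lemma Mesh.mem_of_bary_pos (hK : K ∈ T.elems) (hK' : K' ∈ T.elems) {x p : Pt d}
    (hx : x ∈ cell K) (hx' : x ∈ cell K') (hp : 0 < bary K p x) : p ∈ K' := by
  by_contra h
  rw [T.bary_eq_bary hK hK' hx hx', bary_of_notMem h] at hp
  exact lt_irrefl _ hp

lemma Mesh.mem_of_vertex_mem_cell (hK : K ∈ T.elems) (hK' : K' ∈ T.elems) {p : Pt d}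
    (hp : p ∈ K) (hp' : p ∈ cell K') : p ∈ K' :=
  T.mem_of_bary_pos hK hK' (mem_cell_of_mem hp) hp'
    (by rw [(Mesh.isSimplex hK).bary_self hp]; exact one_pos)

lemma Mesh.eq_of_subset (hK : K ∈ T.elems) (hK' : K' ∈ T.elems) (h : K ⊆ K') : K = K' :=
  Finset.eq_of_subset_of_card_le h (by rw [T.card_eq K hK, T.card_eq K' hK'])

/-- Distinct elements have disjoint interiors. -/
lemma Mesh.disjoint_interior (hK : K ∈ T.elems) (hK' : K' ∈ T.elems) (hne : K ≠ K') :
    Disjoint (interior (cell K)) (cell K') := by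
  rw [Set.disjoint_left]
  intro x hx hx'
  have hx2 := hx
  rw [(Mesh.isSimplex hK).interior_cell] at hx2
  exact hne (T.eq_of_subset hK hK' fun p hp =>
    T.mem_of_bary_pos hK hK' (interior_subset hx) hx' (hx2 p hp))

lemma Mesh.interior_cell_subset (hΩ : interior (closure Ω) = Ω) (hK : K ∈ T.elems) :
    interior (cell K) ⊆ Ω := by
  rw [← hΩ]; exact interior_mono (T.cell_subset hK)

lemma Mesh.exists_elem_of_mem_nodes {p : Pt d} (hp : p ∈ T.nodes) : ∃ K ∈ T.elems, p ∈ K := by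
  simpa [Mesh.nodes] using hp

lemma Mesh.mem_nodes (hK : K ∈ T.elems) {p : Pt d} (hp : p ∈ K) : p ∈ T.nodes := by
  simp only [Mesh.nodes, Finset.mem_biUnion]; exact ⟨K, hK, hp⟩

/-- Near a vertex `p` only the elements with vertex `p` matter. -/
lemma Mesh.eventually_mem_of_mem_cell {p : Pt d} (hp : p ∈ T.nodes) :
    ∀ᶠ x in 𝓝 p, ∀ K ∈ T.elems, x ∈ cell K → p ∈ K := by
  obtain ⟨K₀, hK₀, hp₀⟩ := T.exists_elem_of_mem_nodes hp
  rw [Filter.eventually_all_finset]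
  intro K hK
  by_cases hpK : p ∈ K
  · exact Eventually.of_forall fun _ _ => hpK
  · have : p ∈ (cell K)ᶜ := fun h => hpK (T.mem_of_vertex_mem_cell hK₀ hK hp₀ h)
    filter_upwards [(isCompact_cell K).isClosed.isOpen_compl.mem_nhds this] with x hx hxK
    exact absurd hxK hx

/-- The open star of an interior vertex lies in `Ω`. -/
lemma Mesh.mem_of_hat_pos (hΩo : IsOpen Ω) (hΩ : interior (closure Ω) = Ω) {p x : Pt d}
    (hp : p ∈ T.nodes) (hpΩ : p ∈ Ω) (hx : x ∈ closure Ω) (hpos : 0 < T.hat p x) : x ∈ Ω := by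
  have hnear : ∀ᶠ y in 𝓝 p, y ∈ Ω ∧ ∀ K ∈ T.elems, y ∈ cell K → p ∈ K :=
    Filter.Eventually.and (hΩo.mem_nhds hpΩ) (T.eventually_mem_of_mem_cell hp)
  -- scale by a small factor `t` towards `p`, so that everything happens near `p`
  have hcont : Tendsto (fun t : ℝ => p + t • (x - p)) (𝓝[>] 0) (𝓝 p) := by
    have : Continuous fun t : ℝ => p + t • (x - p) := by fun_prop
    have h := this.tendsto 0
    simp only [zero_smul, add_zero] at h
    exact h.mono_left nhdsWithin_le_nhds
  have ht1 : ∀ᶠ t : ℝ in 𝓝[>] 0, t < 1 := by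
    filter_upwards [mem_nhdsWithin_of_mem_nhds (Iio_mem_nhds (one_pos (α := ℝ)))] with t ht
      using ht
  obtain ⟨t, ht, ht1, ht0⟩ := ((hcont.eventually hnear.eventually_nhds).and
    (ht1.and self_mem_nhdsWithin)).exists
  replace ht0 : 0 < t := ht0
  set Φ : Pt d → Pt d := fun y => p + t • (y - p) with hΦ
  have hΦc : Continuous Φ := by fun_prop
  have hxt : T.hat p (Φ x) = 1 - t + t * T.hat p x := by
    obtain ⟨K, hK, hxK⟩ := (T.mem_closure_iff x).1 hx
    rw [T.hat_eq_bary hK hxK] at hpos ⊢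
    have hpK : p ∈ K := by
      by_contra h; rw [bary_of_notMem h] at hpos; exact lt_irrefl _ hpos
    have hmem : Φ x ∈ cell K := by
      have := (convex_cell K) (mem_cell_of_mem hpK) hxK (a := 1 - t) (b := t) (by linarith)
        ht0.le (by ring)
      convert this using 1
      simp only [hΦ]; module
    rw [T.hat_eq_bary hK hmem, hΦ, (Mesh.isSimplex hK).bary_lineMap,
      (Mesh.isSimplex hK).bary_self hpK]
    ring
  have hxΩ : Φ x ∈ Ω := ht.self_of_nhds.1
  have hhat : ContinuousAt (T.hat p) (Φ x) :=
    (T.continuousOn_hat p).continuousAt (mem_of_superset (hΩo.mem_nhds hxΩ) subset_closure)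
  have hgt : ∀ᶠ y in 𝓝 x, 1 - t < T.hat p (Φ y) := by
    have h1 : ContinuousAt (fun y => T.hat p (Φ y)) x :=
      ContinuousAt.comp (f := Φ) hhat hΦc.continuousAt
    refine h1.eventually (lt_mem_nhds ?_)
    change 1 - t < T.hat p (Φ x)
    rw [hxt]
    have := mul_pos ht0 hpos
    linarith
  rw [← hΩ, mem_interior_iff_mem_nhds]
  filter_upwards [hgt, hΦc.continuousAt.eventually ht] with y hy1 hy2
  obtain ⟨K, hK, hyK⟩ := (T.mem_closure_iff (Φ y)).1 (subset_closure hy2.1)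
  have hpK := hy2.2 K hK hyK
  have hs := Mesh.isSimplex hK
  refine T.cell_subset hK ((hs.mem_cell_iff y).2 fun q hq => ?_)
  rw [T.hat_eq_bary hK hyK] at hy1
  have hq0 := bary_nonneg hs hyK q
  simp only [hΦ] at hy1 hq0
  rw [hs.bary_lineMap] at hy1 hq0
  rw [hs.bary_self hpK] at hy1
  by_cases hqp : q = p
  · subst hqp
    exact (pos_of_mul_pos_right (by linarith : 0 < t * bary K q y) ht0.le).le
  · rw [hs.bary_ne hpK hqp, mul_zero, zero_add] at hq0
    exact nonneg_of_mul_nonneg_right hq0 ht0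

lemma Mesh.hat_eq_zero_of_notMem (hΩo : IsOpen Ω) (hΩ : interior (closure Ω) = Ω) {p x : Pt d}
    (hp : p ∈ T.nodes) (hpΩ : p ∈ Ω) (hx : x ∉ Ω) : T.hat p x = 0 := by
  by_cases hxc : x ∈ closure Ω
  · obtain ⟨K, hK, hxK⟩ := (T.mem_closure_iff x).1 hxc
    by_contra h
    refine hx (T.mem_of_hat_pos hΩo hΩ hp hpΩ hxc (lt_of_le_of_ne ?_ (Ne.symm h)))
    rw [T.hat_eq_bary hK hxK]
    exact bary_nonneg (Mesh.isSimplex hK) hxK p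
  · exact T.hat_of_notMem hxc p

/-! ### Facets and neighbours -/

/-- The relative interior of the facet of `K` opposite `q`. -/
def relintFacet (K : Finset (Pt d)) (q : Pt d) : Set (Pt d) :=
  {b | bary K q b = 0 ∧ ∀ p ∈ K, p ≠ q → 0 < bary K p b}

lemma relintFacet_subset (hK : IsSimplex K) (q : Pt d) : relintFacet K q ⊆ cell K := by
  intro b hb
  rw [hK.mem_cell_iff]
  intro p hp
  by_cases h : p = q
  · rw [h, hb.1]
  · exact (hb.2 p hp h).le

/-- Near a relative interior point of a facet the simplex is a half space. -/
lemma eventually_mem_cell_of_relintFacet (hK : IsSimplex K) {q b : Pt d}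
    (hb : b ∈ relintFacet K q) : ∀ᶠ x in 𝓝 b, 0 ≤ bary K q x → x ∈ cell K := by
  have : ∀ᶠ x in 𝓝 b, ∀ p ∈ K, p ≠ q → 0 < bary K p x := by
    rw [Filter.eventually_all_finset]
    intro p hp
    by_cases h : p = q
    · exact Eventually.of_forall fun _ h' => absurd h h'
    · filter_upwards [(hK.continuous_bary p).continuousAt.eventually
        (lt_mem_nhds (hb.2 p hp h))] with x hx _ using hx
  filter_upwards [this] with x hx hq
  rw [hK.mem_cell_iff]
  intro p hp
  by_cases h : p = q
  · rw [h]; exact hq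
  · exact (hx p hp h).le

lemma Mesh.mem_neighbors : K' ∈ T.neighbors K ↔ K' ∈ T.elems ∧ K' ≠ K ∧ (K ∩ K').card = d := by
  simp [Mesh.neighbors]

/-- `K'` is the neighbour of `K` across the facet opposite `q`, and `q'` is its vertex off that
facet. -/
structure Mesh.IsNeighbor (K : Finset (Pt d)) (q : Pt d) (K' : Finset (Pt d)) (q' : Pt d) :
    Prop where
  mem : K ∈ T.elems
  mem' : K' ∈ T.elems
  q_mem : q ∈ K
  q'_mem : q' ∈ K'
  q_notMem : q ∉ K'
  q'_notMem : q' ∉ K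
  erase_eq : K.erase q = K'.erase q'

variable {T} {q q' : Pt d}

lemma Mesh.IsNeighbor.symm (h : T.IsNeighbor K q K' q') : T.IsNeighbor K' q' K q :=
  ⟨h.mem', h.mem, h.q'_mem, h.q_mem, h.q'_notMem, h.q_notMem, h.erase_eq.symm⟩

lemma Mesh.IsNeighbor.inter_eq (h : T.IsNeighbor K q K' q') : K ∩ K' = K.erase q := by
  ext p
  rw [Finset.mem_inter, Finset.mem_erase]
  constructor
  · rintro ⟨h1, h2⟩
    exact ⟨fun e => h.q_notMem (e ▸ h2), h1⟩
  · rintro ⟨h1, h2⟩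
    have : p ∈ K.erase q := Finset.mem_erase.2 ⟨h1, h2⟩
    rw [h.erase_eq] at this
    exact ⟨h2, Finset.mem_of_mem_erase this⟩

lemma Mesh.IsNeighbor.mem_neighbors (h : T.IsNeighbor K q K' q') : K' ∈ T.neighbors K := by
  rw [T.mem_neighbors]
  refine ⟨h.mem', fun e => h.q_notMem (e ▸ h.q_mem), ?_⟩
  rw [h.inter_eq, Finset.card_erase_of_mem h.q_mem, T.card_eq K h.mem]
  rfl

lemma Mesh.exists_isNeighbor (hK : K ∈ T.elems) (hK' : K' ∈ T.neighbors K) :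
    ∃ q q', T.IsNeighbor K q K' q' := by
  rw [T.mem_neighbors] at hK'
  obtain ⟨hK', hne, hcard⟩ := hK'
  have h1 : (K \ K').card = 1 := by
    have := Finset.card_sdiff_add_card_inter K K'
    rw [hcard, T.card_eq K hK] at this; omega
  have h2 : (K' \ K).card = 1 := by
    have := Finset.card_sdiff_add_card_inter K' K
    rw [Finset.inter_comm, hcard, T.card_eq K' hK'] at this; omega
  obtain ⟨q, hq⟩ := Finset.card_eq_one.1 h1
  obtain ⟨q', hq'⟩ := Finset.card_eq_one.1 h2
  have m1 : q ∈ K \ K' := by rw [hq]; simp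
  have m2 : q' ∈ K' \ K := by rw [hq']; simp
  rw [Finset.mem_sdiff] at m1 m2
  refine ⟨q, q', hK, hK', m1.1, m2.1, m1.2, m2.2, ?_⟩
  have e1 : K.erase q = K ∩ K' := by
    rw [Finset.erase_eq, ← hq]
    ext p; simp only [Finset.mem_sdiff, Finset.mem_inter]; tauto
  have e2 : K'.erase q' = K' ∩ K := by
    rw [Finset.erase_eq, ← hq']
    ext p; simp only [Finset.mem_sdiff, Finset.mem_inter]; tauto
  rw [e1, e2, Finset.inter_comm]

/-- An element that meets the relative interior of a facet of another one is a neighbour. -/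
lemma Mesh.exists_isNeighbor_of_mem (hK : K ∈ T.elems) (hK' : K' ∈ T.elems) (hne : K' ≠ K)
    (hq : q ∈ K) {b : Pt d} (hb : b ∈ relintFacet K q) (hbK' : b ∈ cell K') :
    ∃ q', T.IsNeighbor K q K' q' := by
  have hsub : K.erase q ⊆ K ∩ K' := fun p hp => by
    rw [Finset.mem_erase] at hp
    exact Finset.mem_inter.2 ⟨hp.2, T.mem_of_bary_pos hK hK'
      (relintFacet_subset (Mesh.isSimplex hK) q hb) hbK' (hb.2 p hp.2 hp.1)⟩
  have hqK' : q ∉ K' := fun h => hne (T.eq_of_subset hK hK' fun p hp => by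
    by_cases e : p = q
    · rwa [e]
    · exact Finset.mem_of_mem_inter_right (hsub (Finset.mem_erase.2 ⟨e, hp⟩))).symm
  have hcard : (K ∩ K').card = d := by
    have e : K ∩ K' = K.erase q := by
      refine (Finset.Subset.antisymm hsub fun p hp => ?_).symm
      rw [Finset.mem_inter] at hp
      exact Finset.mem_erase.2 ⟨fun e => hqK' (e ▸ hp.2), hp.1⟩
    rw [e, Finset.card_erase_of_mem hq, T.card_eq K hK]; rfl
  obtain ⟨r, r', h⟩ := Mesh.exists_isNeighbor hK ((T.mem_neighbors).2 ⟨hK', hne, hcard⟩)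
  have : r = q := by
    by_contra e
    exact h.q_notMem (Finset.mem_of_mem_inter_right (hsub (Finset.mem_erase.2 ⟨e, h.q_mem⟩)))
  exact ⟨r', this ▸ h⟩

/-- Both coordinates are affine and vanish at the vertices of the common facet. -/
lemma Mesh.IsNeighbor.bary_eq_mul (h : T.IsNeighbor K q K' q') (x : Pt d) :
    bary K q x = bary K q q' * bary K' q' x := by
  have hs := Mesh.isSimplex h.mem
  have hs' := Mesh.isSimplex h.mem'
  have e : ∀ y, bary K q y = ⟪baryGrad K q, y⟫_ℝ + bary K q 0 := fun y => by
    rw [hs.bary_eq_add_inner q 0 y, sub_zero, add_comm]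
  have : bary K q x = ∑ p ∈ K', bary K' p x * bary K q p := by
    rw [e x]
    conv_lhs => rw [← hs'.sum_bary_smul x]
    rw [inner_sum, ← one_mul (bary K q 0), ← hs'.sum_bary x, Finset.sum_mul,
      ← Finset.sum_add_distrib]
    exact Finset.sum_congr rfl fun p _ => by rw [inner_smul_right, e p]; ring
  rw [this, Finset.sum_eq_single_of_mem q' h.q'_mem, mul_comm]
  intro p hp hpq
  have hpK : p ∈ K.erase q := by rw [h.erase_eq]; exact Finset.mem_erase.2 ⟨hpq, hp⟩
  rw [Finset.mem_erase] at hpK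
  rw [hs.bary_ne hpK.2 (Ne.symm hpK.1), mul_zero]

/-- The facet opposite a vertex has a relative interior point. -/
lemma exists_mem_relintFacet (hd : 1 ≤ d) (hK : IsSimplex K) (hq : q ∈ K) :
    ∃ b, b ∈ relintFacet K q := by
  set w : Pt d → ℝ := fun p => if p = q then 0 else (d : ℝ)⁻¹ with hw
  have hd0 : (0 : ℝ) < d := by exact_mod_cast hd
  have h1 : ∑ p ∈ K, w p = 1 := by
    rw [← Finset.add_sum_erase K w hq]
    have : ∀ p ∈ K.erase q, w p = (d : ℝ)⁻¹ := fun p hp => by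
      simp [hw, Finset.ne_of_mem_erase hp]
    rw [Finset.sum_congr rfl this, Finset.sum_const, Finset.card_erase_of_mem hq, hK.card_eq]
    simp [hw, hd0.ne']
  refine ⟨∑ p ∈ K, w p • p, ?_, fun p hp hpq => ?_⟩
  · rw [hK.bary_unique h1 rfl hq]; simp [hw]
  · rw [hK.bary_unique h1 rfl hp]; simp only [hw, if_neg hpq]; positivity

lemma Mesh.IsNeighbor.relintFacet_subset (h : T.IsNeighbor K q K' q') :
    relintFacet K q ⊆ relintFacet K' q' := by
  intro b hb
  have hs := Mesh.isSimplex h.mem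
  have hb' : b ∈ cell K' := by
    have : b ∈ cell (K.erase q) := (hs.mem_facet_iff h.q_mem b).2
      ⟨NEFEM.relintFacet_subset hs q hb, hb.1⟩
    rw [h.erase_eq] at this
    exact cell_mono (Finset.erase_subset _ _) this
  have hbK := NEFEM.relintFacet_subset hs q hb
  refine ⟨?_, fun p hp hpq => ?_⟩
  · rw [← T.bary_eq_bary h.mem h.mem' hbK hb', bary_of_notMem h.q'_notMem]
  · rw [← T.bary_eq_bary h.mem h.mem' hbK hb']
    have hpK : p ∈ K.erase q := by rw [h.erase_eq]; exact Finset.mem_erase.2 ⟨hpq, hp⟩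
    rw [Finset.mem_erase] at hpK
    exact hb.2 p hpK.2 hpK.1

lemma eventually_segment (q : Pt d) {b : Pt d} {s : Set (Pt d)} (h : s ∈ 𝓝 b) :
    ∀ᶠ t : ℝ in 𝓝[>] 0, b + t • (q - b) ∈ s := by
  have hc : Continuous fun t : ℝ => b + t • (q - b) := by fun_prop
  have h1 := hc.tendsto 0
  simp only [zero_smul, add_zero] at h1
  exact (h1.mono_left nhdsWithin_le_nhds).eventually h

/-- Neighbours lie on opposite sides of their common facet. -/
lemma Mesh.IsNeighbor.bary_neg (hd : 1 ≤ d) (h : T.IsNeighbor K q K' q') : bary K q q' < 0 := by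
  have hs := Mesh.isSimplex h.mem
  have hs' := Mesh.isSimplex h.mem'
  obtain ⟨b, hb⟩ := exists_mem_relintFacet hd hs h.q_mem
  have hb' := h.relintFacet_subset hb
  by_contra hc
  rw [not_lt] at hc
  obtain ⟨t, ht, ht0⟩ := ((eventually_segment q' ((eventually_mem_cell_of_relintFacet hs hb).and
    (eventually_mem_cell_of_relintFacet hs' hb'))).and self_mem_nhdsWithin).exists
  replace ht0 : 0 < t := ht0
  set x := b + t • (q' - b) with hx
  have e' : bary K' q' x = t := by
    rw [hx, hs'.bary_lineMap, hb'.1, hs'.bary_self h.q'_mem]; ring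
  have m' : x ∈ cell K' := ht.2 (by rw [e']; exact ht0.le)
  have m : x ∈ cell K := ht.1 (by rw [h.bary_eq_mul, e']; positivity)
  exact h.q'_notMem (T.mem_of_bary_pos h.mem' h.mem m' m (by rw [e']; exact ht0))

/-- Two neighbours cover a neighbourhood of each relative interior point of their common facet, one on
each side of it; since `Ω` is the interior of its closure, such points lie in `Ω`. -/
lemma Mesh.IsNeighbor.relintFacet_subset_domain (hd : 1 ≤ d) (hΩ : interior (closure Ω) = Ω)
    (h : T.IsNeighbor K q K' q') : relintFacet K q ⊆ Ω := by
  intro b hb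
  have hs := Mesh.isSimplex h.mem
  have hs' := Mesh.isSimplex h.mem'
  rw [← hΩ, mem_interior_iff_mem_nhds]
  filter_upwards [eventually_mem_cell_of_relintFacet hs hb,
    eventually_mem_cell_of_relintFacet hs' (h.relintFacet_subset hb)] with x h1 h2
  rcases le_total 0 (bary K q x) with h0 | h0
  · exact T.cell_subset h.mem (h1 h0)
  · refine T.cell_subset h.mem' (h2 ?_)
    rw [h.bary_eq_mul] at h0
    exact nonneg_of_mul_nonpos_right h0 (h.bary_neg hd)

/-- There is at most one neighbour across each facet. -/
lemma Mesh.IsNeighbor.unique (hd : 1 ≤ d) {K'' : Finset (Pt d)} {q'' : Pt d}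
    (h : T.IsNeighbor K q K' q') (h2 : T.IsNeighbor K q K'' q'') : K' = K'' := by
  have hs := Mesh.isSimplex h.mem
  have hs' := Mesh.isSimplex h.mem'
  have hs'' := Mesh.isSimplex h2.mem'
  obtain ⟨b, hb⟩ := exists_mem_relintFacet hd hs h.q_mem
  have hb' := h.relintFacet_subset hb
  have hb'' := h2.relintFacet_subset hb
  obtain ⟨t, ht, ht0⟩ := ((eventually_segment q' ((eventually_mem_cell_of_relintFacet hs' hb').and
    (eventually_mem_cell_of_relintFacet hs'' hb''))).and self_mem_nhdsWithin).exists
  replace ht0 : 0 < t := ht0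
  set x := b + t • (q' - b) with hx
  have e' : bary K' q' x = t := by
    rw [hx, hs'.bary_lineMap, hb'.1, hs'.bary_self h.q'_mem]; ring
  have m' : x ∈ cell K' := ht.1 (by rw [e']; exact ht0.le)
  have e'' : 0 < bary K'' q'' x := by
    have h3 := h.bary_eq_mul x
    rw [h2.bary_eq_mul x, e'] at h3
    have h4 : bary K q q'' * bary K'' q'' x < 0 := by
      rw [h3]; exact mul_neg_of_neg_of_pos (h.bary_neg hd) ht0
    exact pos_of_mul_neg_right h4 (h2.bary_neg hd).le
  have m'' : x ∈ cell K'' := ht.2 e''.le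
  refine (T.eq_of_subset h2.mem' h.mem' fun p hp => ?_).symm
  by_cases e : p = q''
  · rw [e]; exact T.mem_of_bary_pos h2.mem' h.mem' m'' m' e''
  · have : p ∈ K''.erase q'' := Finset.mem_erase.2 ⟨e, hp⟩
    rw [← h2.erase_eq, h.erase_eq] at this
    exact Finset.mem_of_mem_erase this

/-- A facet whose relative interior meets `Ω` is shared with a neighbour. -/
lemma Mesh.exists_isNeighbor_of_mem_domain (hΩo : IsOpen Ω) (hK : K ∈ T.elems) (hq : q ∈ K)
    {b : Pt d} (hb : b ∈ relintFacet K q) (hbΩ : b ∈ Ω) : ∃ K' q', T.IsNeighbor K q K' q' := by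
  have hs := Mesh.isSimplex hK
  suffices h : b ∈ ⋃ K' ∈ T.elems.erase K, cell K' by
    simp only [mem_iUnion, Finset.mem_erase] at h
    obtain ⟨K', ⟨hne, hK'⟩, hbK'⟩ := h
    exact ⟨K', Mesh.exists_isNeighbor_of_mem hK hK' hne hq hb hbK'⟩
  have hcl : IsClosed (⋃ K' ∈ T.elems.erase K, cell K') :=
    (T.elems.erase K).finite_toSet.isClosed_biUnion fun K' _ => (isCompact_cell K').isClosed
  have hc : Continuous fun t : ℝ => b + t • (q - b) := by fun_prop
  have h1 := hc.tendsto 0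
  simp only [zero_smul, add_zero] at h1
  refine hcl.mem_of_tendsto (h1.mono_left (nhdsWithin_le_nhds (s := Iio 0))) ?_
  filter_upwards [(h1.mono_left (nhdsWithin_le_nhds (s := Iio 0))).eventually
    (hΩo.mem_nhds hbΩ), self_mem_nhdsWithin] with t ht ht0
  rw [mem_Iio] at ht0
  obtain ⟨K', hK', hxK'⟩ := (T.mem_closure_iff _).1 (subset_closure ht)
  simp only [mem_iUnion, Finset.mem_erase]
  refine ⟨K', ⟨fun e => ?_, hK'⟩, hxK'⟩
  subst e
  have := bary_nonneg hs hxK' q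
  rw [hs.bary_lineMap, hb.1, hs.bary_self hq] at this
  linarith

end

section

variable {d : ℕ} {Ω : Set (Pt d)} {T : Mesh Ω} {K K' : Finset (Pt d)} {q q' : Pt d}

/-! ### Normals of facets -/

lemma Mesh.IsNeighbor.baryGrad_eq (h : T.IsNeighbor K q K' q') :
    baryGrad K q = bary K q q' • baryGrad K' q' := by
  refine ext_inner_right ℝ fun v => ?_
  have h1 := h.bary_eq_mul v
  have h0 := h.bary_eq_mul 0
  rw [(Mesh.isSimplex h.mem).bary_eq_add_inner q 0 v,
    (Mesh.isSimplex h.mem').bary_eq_add_inner q' 0 v, h0, sub_zero] at h1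
  rw [real_inner_smul_left]
  linarith

lemma Mesh.IsNeighbor.innerNormal_eq (hd : 1 ≤ d) (h : T.IsNeighbor K q K' q') :
    innerNormal K q = -innerNormal K' q' := by
  have hneg := h.bary_neg hd
  have hg : 0 < ‖baryGrad K' q'‖ :=
    norm_pos_iff.2 (baryGrad_ne_zero hd (Mesh.isSimplex h.mem') h.q'_mem)
  rw [innerNormal, innerNormal, h.baryGrad_eq, norm_smul, Real.norm_of_nonpos hneg.le, smul_smul,
    ← neg_smul]
  congr 1
  field_simp
  rw [div_self hneg.ne]

lemma norm_innerNormal (hd : 1 ≤ d) (hK : IsSimplex K) (hq : q ∈ K) : ‖innerNormal K q‖ = 1 := by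
  have hg : 0 < ‖baryGrad K q‖ := norm_pos_iff.2 (baryGrad_ne_zero hd hK hq)
  rw [innerNormal, norm_smul, norm_inv, norm_norm, inv_mul_cancel₀ hg.ne']

/-- The normal of a facet is unique up to its sign. -/
lemma unitNormal_eq (hd : 1 ≤ d) (hK : IsSimplex K) (hq : q ∈ K) :
    unitNormal (K.erase q) = innerNormal K q ∨ unitNormal (K.erase q) = -innerNormal K q := by
  have hg : 0 < ‖baryGrad K q‖ := norm_pos_iff.2 (baryGrad_ne_zero hd hK hq)
  have hex : ∃ n : Pt d, ‖n‖ = 1 ∧ ∀ x ∈ K.erase q, ∀ y ∈ K.erase q, ⟪n, x - y⟫_ℝ = 0 := by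
    refine ⟨innerNormal K q, norm_innerNormal hd hK hq, fun x hx y hy => ?_⟩
    rw [Finset.mem_erase] at hx hy
    have := hK.bary_eq_add_inner q y x
    rw [hK.bary_ne hx.2 hx.1.symm, hK.bary_ne hy.2 hy.1.symm, zero_add] at this
    rw [innerNormal, real_inner_smul_left, ← this, mul_zero]
  obtain ⟨hn1, hn2⟩ := Classical.epsilon_spec hex
  change ‖unitNormal (K.erase q)‖ = 1 at hn1
  change ∀ x ∈ K.erase q, ∀ y ∈ K.erase q, ⟪unitNormal (K.erase q), x - y⟫_ℝ = 0 at hn2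
  set n := unitNormal (K.erase q)
  obtain ⟨p, hp, hpq⟩ := Finset.exists_mem_ne (s := K) (by rw [hK.card_eq]; omega) q
  have hn : n = ⟪n, q - p⟫_ℝ • baryGrad K q := by
    refine ext_inner_right ℝ fun v => ?_
    conv_lhs => rw [← hK.sum_inner_baryGrad_smul p v]
    rw [inner_sum, Finset.sum_eq_single_of_mem q hq]
    · rw [inner_smul_right, real_inner_smul_left, mul_comm]
    · intro r hr hrq
      rw [inner_smul_right, hn2 r (Finset.mem_erase.2 ⟨hrq, hr⟩) p (Finset.mem_erase.2 ⟨hpq, hp⟩),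
        mul_zero]
  set s := ⟪n, q - p⟫_ℝ
  have hs : |s| * ‖baryGrad K q‖ = 1 := by
    rw [← hn1]; conv_rhs => rw [hn, norm_smul, Real.norm_eq_abs]
  rw [innerNormal, ← neg_smul]
  rcases abs_choice s with h | h
  · left
    rw [hn]; congr 1
    rw [h] at hs
    exact eq_inv_of_mul_eq_one_left hs
  · right
    rw [hn]; congr 1
    rw [h] at hs
    rw [← eq_inv_of_mul_eq_one_left hs, neg_neg]

/-! ### Sums over interior facets -/

/-- The vertex of `K` that does not belong to `K'` (for neighbours `K`, `K'`). -/
def apex (K K' : Finset (Pt d)) : Pt d := Classical.epsilon fun q => q ∈ K ∧ q ∉ K'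

lemma Mesh.IsNeighbor.apex_eq (h : T.IsNeighbor K q K' q') : apex K K' = q := by
  have hex : ∃ q, q ∈ K ∧ q ∉ K' := ⟨q, h.q_mem, h.q_notMem⟩
  obtain ⟨h1, h2⟩ := Classical.epsilon_spec hex
  change apex K K' ∈ K at h1
  change apex K K' ∉ K' at h2
  by_contra hne
  have : apex K K' ∈ K.erase q := Finset.mem_erase.2 ⟨hne, h1⟩
  rw [h.erase_eq] at this
  exact h2 (Finset.mem_of_mem_erase this)

lemma Mesh.isNeighbor_apex (hK : K ∈ T.elems) (hK' : K' ∈ T.neighbors K) :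
    T.IsNeighbor K (apex K K') K' (apex K' K) := by
  obtain ⟨q, q', h⟩ := Mesh.exists_isNeighbor hK hK'
  rw [h.apex_eq, h.symm.apex_eq]
  exact h

/-- A sum over the facets of `K`, with vanishing contributions of boundary facets, as a sum over
the neighbours. -/
lemma Mesh.sum_facets_eq_sum_neighbors (hd : 1 ≤ d) (hK : K ∈ T.elems) (G : Pt d → ℝ)
    (hG : ∀ q ∈ K, (¬∃ K' q', T.IsNeighbor K q K' q') → G q = 0) :
    ∑ q ∈ K, G q = ∑ K' ∈ T.neighbors K, G (apex K K') := by
  have himg : (T.neighbors K).image (apex K) ⊆ K := by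
    intro q hq
    obtain ⟨K', hK', rfl⟩ := Finset.mem_image.1 hq
    exact (Mesh.isNeighbor_apex hK hK').q_mem
  rw [← Finset.sum_subset himg, Finset.sum_image]
  · intro K' hK' K'' hK'' he
    have h1 := Mesh.isNeighbor_apex hK hK'
    have h2 := Mesh.isNeighbor_apex hK hK''
    rw [he] at h1
    exact h1.unique hd h2
  · intro q hq hn
    refine hG q hq ?_
    rintro ⟨K', q', h⟩
    exact hn (Finset.mem_image.2 ⟨K', h.mem_neighbors, h.apex_eq⟩)

lemma Mesh.neighbors_symm (hK : K ∈ T.elems) (hK' : K' ∈ T.neighbors K) : K ∈ T.neighbors K' :=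
  (Mesh.isNeighbor_apex hK hK').symm.mem_neighbors

/-- Symmetrization of a sum over ordered pairs of neighbours. -/
lemma Mesh.sum_neighbors_symm (G : Finset (Pt d) → Finset (Pt d) → ℝ) :
    ∑ K ∈ T.elems, ∑ K' ∈ T.neighbors K, G K K' =
      ∑ K ∈ T.elems, ∑ K' ∈ T.neighbors K, 1 / 2 * (G K K' + G K' K) := by
  have h : ∑ K ∈ T.elems, ∑ K' ∈ T.neighbors K, G K K' =
      ∑ K ∈ T.elems, ∑ K' ∈ T.neighbors K, G K' K := by
    rw [Finset.sum_comm' (t' := T.elems) (s' := fun K' => T.neighbors K')]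
    intro K K'
    constructor
    · rintro ⟨h1, h2⟩
      exact ⟨Mesh.neighbors_symm h1 h2, ((T.mem_neighbors).1 h2).1⟩
    · rintro ⟨h1, h2⟩
      exact ⟨((T.mem_neighbors).1 h1).1, Mesh.neighbors_symm h2 h1⟩
  simp only [mul_add, Finset.sum_add_distrib, ← Finset.mul_sum]
  rw [← h]
  ring

lemma Mesh.card_neighbors_le (hd : 1 ≤ d) (hK : K ∈ T.elems) :
    (T.neighbors K).card ≤ d + 1 := by
  rw [← T.card_eq K hK]
  refine Finset.card_le_card_of_injOn (apex K)
    (fun K' hK' => (Mesh.isNeighbor_apex hK hK').q_mem) fun K' hK' K'' hK'' he => ?_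
  have h1 := Mesh.isNeighbor_apex hK hK'
  have h2 := Mesh.isNeighbor_apex hK hK''
  rw [he] at h1
  exact h1.unique hd h2

/-! ### Boundary vertices belong to boundary facets -/

lemma dense_ne_zero_of_affine {f : Pt d → ℝ} {z : Pt d}
    (hf : ∀ x t, f (x + t • (z - x)) = (1 - t) * f x + t * f z) (hz : f z ≠ 0) :
    Dense {x | f x ≠ 0} := by
  intro x
  by_cases hx : f x = 0
  · have hc : Continuous fun t : ℝ => x + t • (z - x) := by fun_prop
    have h1 := hc.tendsto 0
    simp only [zero_smul, add_zero] at h1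
    refine mem_closure_of_tendsto (h1.mono_left (nhdsWithin_le_nhds (s := Ioi 0))) ?_
    filter_upwards [self_mem_nhdsWithin (s := Ioi (0 : ℝ))] with t ht
    rw [hf, hx, mul_zero, zero_add]
    exact mul_ne_zero (ne_of_gt ht) hz
  · exact subset_closure hx

/-- A vertex on the boundary lies on a facet that is not shared. The facet is found where a generic
segment leaving the domain near the vertex crosses the boundary. -/
lemma Mesh.exists_boundary_facet (hd : 2 ≤ d) (hΩo : IsOpen Ω) (hΩ : interior (closure Ω) = Ω)
    {p : Pt d} (hp : p ∈ T.nodes) (hpΩ : p ∉ Ω) :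
    ∃ K ∈ T.elems, ∃ q ∈ K, p ∈ K ∧ q ≠ p ∧ ∀ b ∈ relintFacet K q, b ∉ Ω := by
  have hd1 : 1 ≤ d := by omega
  obtain ⟨K₀, hK₀, hp₀⟩ := T.exists_elem_of_mem_nodes hp
  have hs₀ := Mesh.isSimplex hK₀
  -- a ball around `p` that only meets the star of `p`, where the hat function of `p` is positive
  have hev : ∀ᶠ x in 𝓝 p, ∀ K ∈ T.elems, x ∈ cell K → p ∈ K ∧ 0 < bary K p x := by
    have h2 : ∀ᶠ x in 𝓝 p, ∀ K ∈ T.elems, p ∈ K → 0 < bary K p x := by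
      rw [Filter.eventually_all_finset]
      intro K hK
      by_cases hpK : p ∈ K
      · have hs := Mesh.isSimplex hK
        filter_upwards [(hs.continuous_bary p).continuousAt.eventually
          (lt_mem_nhds (by rw [hs.bary_self hpK]; exact one_pos))] with x hx _ using hx
      · exact Eventually.of_forall fun _ h => absurd h hpK
    filter_upwards [T.eventually_mem_of_mem_cell hp, h2] with x h1 h2 K hK hx
    exact ⟨h1 K hK hx, h2 K hK (h1 K hK hx)⟩
  obtain ⟨ρ, hρ, hball⟩ := Metric.eventually_nhds_iff_ball.1 hev
  -- a generic point `y` outside, near `p`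
  obtain ⟨y, hyB, hyΩ, hygen⟩ : ∃ y ∈ Metric.ball p ρ, y ∉ closure Ω ∧
      ∀ K ∈ T.elems, ∀ q ∈ K, bary K q y ≠ 0 := by
    have hdense : Dense (⋂ i : (Σ K : T.elems, (K : Finset (Pt d))),
        {x | bary (i.1 : Finset (Pt d)) i.2 x ≠ 0}) := by
      refine dense_iInter_of_isOpen (fun i => ?_) fun i => ?_
      · exact isOpen_ne_fun ((Mesh.isSimplex i.1.2).continuous_bary _) continuous_const
      · have hs := Mesh.isSimplex i.1.2
        exact dense_ne_zero_of_affine (z := i.2) (fun x t => hs.bary_lineMap _ _ _ _)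
          (by rw [hs.bary_self i.2.2]; exact one_ne_zero)
    have hne : (Metric.ball p ρ ∩ (closure Ω)ᶜ).Nonempty := by
      by_contra h
      rw [not_nonempty_iff_eq_empty, ← disjoint_iff_inter_eq_empty,
        disjoint_compl_right_iff_subset] at h
      exact hpΩ (hΩ ▸ mem_interior.2 ⟨_, h, Metric.isOpen_ball, Metric.mem_ball_self hρ⟩)
    obtain ⟨y, hy, hy'⟩ := hdense.inter_open_nonempty _
      (Metric.isOpen_ball.inter isClosed_closure.isOpen_compl) hne
    rw [mem_iInter] at hy'
    exact ⟨y, hy.1, hy.2, fun K hK q hq => hy' ⟨⟨K, hK⟩, ⟨q, hq⟩⟩⟩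
  -- a generic interior point `z` of an element at `p`, so that the segment from `y` to `z` avoids
  -- all faces of codimension two
  obtain ⟨z, hzB, hzK, hzgen⟩ : ∃ z ∈ Metric.ball p ρ, z ∈ interior (cell K₀) ∧
      ∀ K ∈ T.elems, ∀ q₁ ∈ K, ∀ q₂ ∈ K, q₁ ≠ q₂ →
        bary K q₁ z * bary K q₂ y - bary K q₂ z * bary K q₁ y ≠ 0 := by
    have hdense : Dense (⋂ i : (Σ K : T.elems, {r : ↥(K : Finset (Pt d)) × ↥(K : Finset (Pt d)) //
        r.1 ≠ r.2}),
        {x | bary (i.1 : Finset (Pt d)) i.2.1.1 x * bary (i.1 : Finset (Pt d)) i.2.1.2 y -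
          bary (i.1 : Finset (Pt d)) i.2.1.2 x * bary (i.1 : Finset (Pt d)) i.2.1.1 y ≠ 0}) := by
      refine dense_iInter_of_isOpen (fun i => ?_) fun i => ?_
      · have hs := Mesh.isSimplex i.1.2
        exact isOpen_ne_fun (((hs.continuous_bary _).mul continuous_const).sub
          ((hs.continuous_bary _).mul continuous_const)) continuous_const
      · have hs := Mesh.isSimplex i.1.2
        obtain ⟨⟨K, hK⟩, ⟨⟨q₁, hq₁⟩, ⟨q₂, hq₂⟩⟩, hne⟩ := i
        have hne' : q₂ ≠ q₁ := fun e => hne (by simp [e])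
        refine dense_ne_zero_of_affine (f := fun x => bary K q₁ x * bary K q₂ y -
          bary K q₂ x * bary K q₁ y) (z := q₁) (fun x t => ?_) ?_
        · simp only [hs.bary_lineMap]; ring
        · simp only [hs.bary_self hq₁, hs.bary_ne hq₁ hne']
          simpa using hygen K hK q₂ hq₂
    have hne : (Metric.ball p ρ ∩ interior (cell K₀)).Nonempty := by
      have hpcl : p ∈ closure (interior (cell K₀)) := by
        rw [(convex_cell K₀).closure_interior_eq_closure_of_nonempty_interior]
        · exact subset_closure (mem_cell_of_mem hp₀)
        · rw [hs₀.interior_cell]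
          have := hs₀.basis.centroid_mem_interior_convexHull
          rw [show range hs₀.basis = (K₀ : Set (Pt d)) from Subtype.range_coe] at this
          have h2 := hs₀.interior_cell
          rw [cell] at h2
          exact ⟨_, h2 ▸ this⟩
      exact _root_.mem_closure_iff.1 hpcl _ Metric.isOpen_ball (Metric.mem_ball_self hρ)
    obtain ⟨z, hz, hz'⟩ := hdense.inter_open_nonempty _
      (Metric.isOpen_ball.inter isOpen_interior) hne
    rw [mem_iInter] at hz'
    exact ⟨z, hz.1, hz.2, fun K hK q₁ hq₁ q₂ hq₂ hne =>
      hz' ⟨⟨K, hK⟩, ⟨⟨⟨q₁, hq₁⟩, ⟨q₂, hq₂⟩⟩, fun e => hne (Subtype.ext_iff.1 e)⟩⟩⟩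
  -- the first point of the segment in `closure Ω`
  set γ : ℝ → Pt d := fun s => y + s • (z - y) with hγ
  have hγc : Continuous γ := by fun_prop
  set S : Set ℝ := Icc 0 1 ∩ γ ⁻¹' closure Ω with hS
  have hScl : IsClosed S := isClosed_Icc.inter (isClosed_closure.preimage hγc)
  have hSne : S.Nonempty := ⟨1, by simp, by
    simp only [mem_preimage, hγ, one_smul, add_sub_cancel]
    exact T.cell_subset hK₀ (interior_subset hzK)⟩
  have hSbd : BddBelow S := ⟨0, fun s hs => hs.1.1⟩
  set s := sInf S with hs
  have hsS : s ∈ S := hScl.csInf_mem hSne hSbd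
  have hs0 : 0 < s := by
    refine lt_of_le_of_ne hsS.1.1 fun h => hyΩ ?_
    have := hsS.2
    rw [← h] at this
    simpa [hγ] using this
  have hxΩ : γ s ∉ Ω := by
    intro h
    have hnear : ∀ᶠ t in 𝓝[<] s, γ t ∈ Ω :=
      (hγc.continuousAt.eventually (hΩo.mem_nhds h)).filter_mono nhdsWithin_le_nhds
    have hnear2 : ∀ᶠ t in 𝓝[<] s, 0 < t :=
      (lt_mem_nhds hs0).filter_mono nhdsWithin_le_nhds
    obtain ⟨t, ⟨ht1, ht2⟩, ht3⟩ := ((hnear.and hnear2).and self_mem_nhdsWithin).exists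
    replace ht3 : t < s := ht3
    exact absurd (csInf_le hSbd ⟨⟨ht2.le, ht3.le.trans hsS.1.2⟩, subset_closure ht1⟩)
      (not_le.2 ht3)
  have hxB : γ s ∈ Metric.ball p ρ := by
    have := (convex_ball p ρ) hyB hzB (a := 1 - s) (b := s) (by linarith [hsS.1.2]) hs0.le (by ring)
    convert this using 1
    simp only [hγ]; module
  obtain ⟨K, hK, hxK⟩ := (T.mem_closure_iff _).1 hsS.2
  have hsim := Mesh.isSimplex hK
  obtain ⟨hpK, hpos⟩ := hball _ hxB K hK hxK
  obtain ⟨q, hq, hq0⟩ : ∃ q ∈ K, bary K q (γ s) = 0 := by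
    by_contra h
    push Not at h
    refine hxΩ (T.interior_cell_subset hΩ hK ?_)
    rw [hsim.interior_cell]
    exact fun r hr => lt_of_le_of_ne (bary_nonneg hsim hxK r) (h r hr).symm
  have hrel : γ s ∈ relintFacet K q := by
    refine ⟨hq0, fun r hr hrq => lt_of_le_of_ne (bary_nonneg hsim hxK r) fun h0 => ?_⟩
    refine hzgen K hK q hq r hr hrq.symm ?_
    simp only [hγ] at hq0 h0
    rw [hsim.bary_lineMap] at hq0 h0
    have : s * (bary K q z * bary K r y - bary K r z * bary K q y) = 0 := by
      linear_combination bary K r y * hq0 + bary K q y * h0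
    exact (mul_eq_zero.1 this).resolve_left hs0.ne'
  refine ⟨K, hK, q, hq, hpK, fun e => ?_, fun b hb hbΩ => ?_⟩
  · rw [e] at hq0; exact hpos.ne' hq0
  · obtain ⟨K', q', h⟩ := Mesh.exists_isNeighbor_of_mem_domain hΩo hK hq hb hbΩ
    exact hxΩ (h.relintFacet_subset_domain hd1 hΩ hrel)

end

section

variable {d : ℕ} {Ω : Set (Pt d)}

/-! ### Weak gradients -/

lemma IsTest.integrable_smul {E : Type*} [NormedAddCommGroup E] [NormedSpace ℝ E]
    {φ : Pt d → ℝ} (hφ : IsTest Ω φ) {G : Pt d → E}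
    (hG : LocallyIntegrableOn G Ω volume) : Integrable (fun x => φ x • G x) volume := by
  have hsupp : Function.support (fun x => φ x • G x) ⊆ tsupport φ := fun x hx =>
    subset_tsupport φ (fun h => hx (by simp only [h, zero_smul]))
  rw [← integrableOn_iff_integrable_of_support_subset hsupp]
  exact (hG.integrableOn_compact_subset hφ.2.2 hφ.2.1).continuousOn_smul
    hφ.1.continuous.continuousOn hφ.2.1

lemma IsTest.setIntegral_smul {E : Type*} [NormedAddCommGroup E] [NormedSpace ℝ E]
    {φ : Pt d → ℝ} (hφ : IsTest Ω φ) (G : Pt d → E) :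
    ∫ x in Ω, φ x • G x = ∫ x, φ x • G x := by
  refine setIntegral_eq_integral_of_forall_compl_eq_zero fun x hx => ?_
  rw [image_eq_zero_of_notMem_tsupport fun h => hx (hφ.2.2 h), zero_smul]

/-- The weak gradient is unique almost everywhere. -/
lemma IsWeakGrad.ae_eq (hΩ : IsOpen Ω) {u : Pt d → ℝ} {G G' : Pt d → Pt d}
    (h : IsWeakGrad Ω u G) (h' : IsWeakGrad Ω u G') : G =ᵐ[volume.restrict Ω] G' := by
  have h0 : ∀ᵐ x ∂volume, x ∈ Ω → (fun x => G x - G' x) x = 0 := by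
    refine hΩ.ae_eq_zero_of_integral_contDiff_smul_eq_zero (h.2.1.sub h'.2.1)
      fun φ h1 h2 h3 => ?_
    have hφ : IsTest Ω φ := ⟨h1, h2, h3⟩
    simp only [smul_sub]
    rw [integral_sub (hφ.integrable_smul h.2.1) (hφ.integrable_smul h'.2.1),
      ← hφ.setIntegral_smul G, ← hφ.setIntegral_smul G', sub_eq_zero]
    exact neg_injective ((h.2.2 φ hφ).symm.trans (h'.2.2 φ hφ))
  rw [EventuallyEq, ae_restrict_iff' hΩ.measurableSet]
  filter_upwards [h0] with x hx hxΩ using sub_eq_zero.1 (hx hxΩ)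

lemma isWeakGrad_weakGrad {u : Pt d → ℝ} {G : Pt d → Pt d} (h : IsWeakGrad Ω u G) :
    IsWeakGrad Ω u (weakGrad Ω u) := by
  have hex : ∃ G, IsWeakGrad Ω u G := ⟨G, h⟩
  rw [weakGrad, dif_pos hex]
  exact hex.choose_spec

lemma IsWeakGrad.weakGrad_ae_eq (hΩ : IsOpen Ω) {u : Pt d → ℝ} {G : Pt d → Pt d}
    (h : IsWeakGrad Ω u G) : weakGrad Ω u =ᵐ[volume.restrict Ω] G :=
  (isWeakGrad_weakGrad h).ae_eq hΩ h

lemma gradient_eq_toDual (φ : Pt d → ℝ) (x : Pt d) :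
    gradient φ x = (InnerProductSpace.toDual ℝ (Pt d)).symm (fderiv ℝ φ x) := rfl

lemma inner_gradient (φ : Pt d → ℝ) (x e : Pt d) : ⟪gradient φ x, e⟫_ℝ = fderiv ℝ φ x e := by
  rw [gradient_eq_toDual, InnerProductSpace.toDual_symm_apply]

lemma norm_gradient_sub (φ g : Pt d → ℝ) (x : Pt d) :
    ‖gradient φ x - gradient g x‖ = ‖fderiv ℝ φ x - fderiv ℝ g x‖ := by
  rw [gradient_eq_toDual, gradient_eq_toDual, ← map_sub, LinearIsometryEquiv.norm_map]

lemma norm_gradient (φ : Pt d → ℝ) (x : Pt d) : ‖gradient φ x‖ = ‖fderiv ℝ φ x‖ := by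
  rw [gradient_eq_toDual, LinearIsometryEquiv.norm_map]

lemma IsTest.continuous_gradient {φ : Pt d → ℝ} (hφ : IsTest Ω φ) : Continuous (gradient φ) :=
  (InnerProductSpace.toDual ℝ (Pt d)).symm.continuous.comp
    (hφ.1.continuous_fderiv (by simp))

lemma IsTest.gradient_eq_zero {φ : Pt d → ℝ} (hφ : IsTest Ω φ) {x : Pt d} (hx : x ∉ Ω) :
    gradient φ x = 0 := by
  have : x ∉ tsupport (fderiv ℝ φ) := fun h => hx (hφ.2.2 (tsupport_fderiv_subset ℝ h))
  rw [gradient_eq_toDual, image_eq_zero_of_notMem_tsupport this, map_zero]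

lemma IsTest.exists_lipschitz {φ : Pt d → ℝ} (hφ : IsTest Ω φ) : ∃ C, LipschitzWith C φ :=
  ContDiff.lipschitzWith_of_hasCompactSupport hφ.2.1
    (hφ.1.of_le (m := 1) (mod_cast le_top)) one_ne_zero

lemma IsTest.integrable_smul_gradient {φ : Pt d → ℝ} (hφ : IsTest Ω φ) {u : Pt d → ℝ}
    (hu : LocallyIntegrableOn u Ω volume) :
    Integrable (fun x => u x • gradient φ x) (volume.restrict Ω) := by
  have hsupp : Function.support (fun x => u x • gradient φ x) ⊆ tsupport φ := fun x hx => by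
    refine tsupport_fderiv_subset ℝ (subset_tsupport _ fun h => hx ?_)
    simp only [gradient_eq_toDual, h, map_zero, smul_zero]
  refine Integrable.restrict ?_
  rw [← integrableOn_iff_integrable_of_support_subset hsupp]
  exact (hu.integrableOn_compact_subset hφ.2.2 hφ.2.1).smul_continuousOn
    hφ.continuous_gradient.continuousOn hφ.2.1

lemma IsWeakGrad.sub {u v : Pt d → ℝ} {G H : Pt d → Pt d} (hu : IsWeakGrad Ω u G)
    (hv : IsWeakGrad Ω v H) : IsWeakGrad Ω (fun x => u x - v x) (fun x => G x - H x) := by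
  refine ⟨hu.1.sub hv.1, hu.2.1.sub hv.2.1, fun φ hφ => ?_⟩
  simp only [sub_smul, smul_sub]
  rw [integral_sub (hφ.integrable_smul_gradient hu.1) (hφ.integrable_smul_gradient hv.1),
    integral_sub (hφ.integrable_smul hu.2.1).restrict (hφ.integrable_smul hv.2.1).restrict,
    hu.2.2 φ hφ, hv.2.2 φ hφ]
  abel

/-! ### Lipschitz functions vanishing outside the domain belong to `H¹₀` -/

lemma measurable_gradient (v : Pt d → ℝ) : Measurable (gradient v) :=
  (InnerProductSpace.toDual ℝ (Pt d)).symm.continuous.measurable.comp (measurable_fderiv ℝ v)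

lemma norm_gradient_le_of_lipschitz {v : Pt d → ℝ} {L : ℝ≥0} (hv : LipschitzWith L v) (x : Pt d) :
    ‖gradient v x‖ ≤ L := by
  rw [norm_gradient]; exact norm_fderiv_le_of_lipschitz ℝ hv

lemma locallyIntegrable_gradient {v : Pt d → ℝ} {L : ℝ≥0} (hv : LipschitzWith L v) :
    LocallyIntegrable (gradient v) volume :=
  (memLp_top_of_bound (measurable_gradient v).aestronglyMeasurable L
    (Eventually.of_forall (norm_gradient_le_of_lipschitz hv))).locallyIntegrable le_top

/-- The classical gradient of a Lipschitz function is its weak gradient. -/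
lemma isWeakGrad_gradient {v : Pt d → ℝ} {L : ℝ≥0} (hv : LipschitzWith L v) :
    IsWeakGrad Ω v (gradient v) := by
  have h1 : LocallyIntegrableOn v Ω volume :=
    hv.continuous.locallyIntegrable.locallyIntegrableOn Ω
  have h2 : LocallyIntegrableOn (gradient v) Ω volume :=
    (locallyIntegrable_gradient hv).locallyIntegrableOn Ω
  refine ⟨h1, h2, fun φ hφ => ?_⟩
  obtain ⟨C, hC⟩ := hφ.exists_lipschitz
  refine ext_inner_left ℝ fun e => ?_
  rw [inner_neg_right, ← integral_inner (hφ.integrable_smul_gradient h1),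
    ← integral_inner (hφ.integrable_smul h2).restrict]
  have e1 : ∫ x in Ω, ⟪e, v x • gradient φ x⟫_ℝ = ∫ x, lineDeriv ℝ φ x e * v x := by
    rw [setIntegral_eq_integral_of_forall_compl_eq_zero fun x hx => by
      rw [hφ.gradient_eq_zero hx, smul_zero, inner_zero_right]]
    refine integral_congr_ae (Eventually.of_forall fun x => ?_)
    simp only [inner_smul_right]
    rw [real_inner_comm, inner_gradient,
      (hφ.1.differentiable (by simp) x).lineDeriv_eq_fderiv, mul_comm]
  have e2 : ∫ x in Ω, ⟪e, φ x • gradient v x⟫_ℝ = ∫ x, lineDeriv ℝ v x e * φ x := by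
    rw [setIntegral_eq_integral_of_forall_compl_eq_zero fun x hx => by
      rw [image_eq_zero_of_notMem_tsupport fun h => hx (hφ.2.2 h), zero_smul, inner_zero_right]]
    refine integral_congr_ae ?_
    filter_upwards [hv.ae_differentiableAt] with x hx
    rw [inner_smul_right, real_inner_comm, inner_gradient, hx.lineDeriv_eq_fderiv, mul_comm]
  rw [e1, e2, hv.integral_lineDeriv_mul_eq hC hφ.2.1 e, ← integral_neg]
  refine integral_congr_ae (Eventually.of_forall fun x => ?_)
  simp only [lineDeriv_neg]
  ring

/-- The derivative of a Lipschitz function vanishes almost everywhere on its zero set: compare with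
the derivative of `|v|`, for which every zero is a minimum. -/
lemma ae_fderiv_eq_zero {v : Pt d → ℝ} {L : ℝ≥0} (hv : LipschitzWith L v) :
    ∀ᵐ x, v x = 0 → fderiv ℝ v x = 0 := by
  have habs : LipschitzWith L fun x => |v x| := by
    simpa [Function.comp_def] using (LipschitzWith.of_dist_le_mul (K := 1) fun a b => by
      rw [NNReal.coe_one, one_mul]; exact abs_abs_sub_abs_le a b : LipschitzWith 1
        (fun t : ℝ => |t|)).comp hv
  filter_upwards [hv.ae_differentiableAt, habs.ae_differentiableAt] with x h1 h2 h0
  have hmin : IsLocalMin (fun y => |v y|) x := Eventually.of_forall fun y => by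
    simp only [h0, abs_zero]; exact abs_nonneg _
  have h3 := h2.hasFDerivAt
  rw [hmin.fderiv_eq_zero, hasFDerivAt_iff_isLittleO] at h3
  refine HasFDerivAt.fderiv ?_
  rw [hasFDerivAt_iff_isLittleO]
  refine (Asymptotics.isLittleO_norm_left.1 ?_)
  simpa [h0] using h3

lemma tendsto_eLpNorm_two_of_ae {E : Type*} [NormedAddCommGroup E] {μ : Measure (Pt d)}
    [IsFiniteMeasure μ] {F : ℕ → Pt d → E} (hF : ∀ n, AEStronglyMeasurable (F n) μ) {C : ℝ}
    (hC : ∀ n, ∀ᵐ x ∂μ, ‖F n x‖ ≤ C)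
    (hlim : ∀ᵐ x ∂μ, Tendsto (fun n => F n x) atTop (𝓝 0)) :
    Tendsto (fun n => eLpNorm (F n) 2 μ) atTop (𝓝 0) := by
  have key : Tendsto (fun n => ∫⁻ x, ‖F n x‖ₑ ^ (2 : ℝ) ∂μ) atTop (𝓝 (∫⁻ _, 0 ∂μ)) := by
    refine tendsto_lintegral_of_dominated_convergence' (fun _ => ENNReal.ofReal C ^ (2 : ℝ))
      (fun n => (hF n).enorm.pow_const _) (fun n => ?_) ?_ ?_
    · filter_upwards [hC n] with x hx
      gcongr
      rw [← ofReal_norm]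
      exact ENNReal.ofReal_le_ofReal hx
    · rw [lintegral_const]
      exact ENNReal.mul_ne_top (by simp) (measure_ne_top _ _)
    · filter_upwards [hlim] with x hx
      have h1 : Tendsto (fun n => ‖F n x‖ₑ) atTop (𝓝 0) := by
        have := hx.enorm
        rwa [enorm_zero] at this
      have h2 := (ENNReal.continuous_rpow_const (y := (2 : ℝ))).tendsto (0 : ℝ≥0∞)
      rw [ENNReal.zero_rpow_of_pos two_pos] at h2
      exact h2.comp h1
  rw [lintegral_zero] at key
  have h2 := (ENNReal.continuous_rpow_const (y := (1 / 2 : ℝ))).tendsto (0 : ℝ≥0∞)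
  rw [ENNReal.zero_rpow_of_pos (by norm_num)] at h2
  refine (h2.comp key).congr fun n => ?_
  rw [eLpNorm_eq_lintegral_rpow_enorm_toReal (by simp) (by simp)]
  simp

end

section

variable {d : ℕ} {Ω : Set (Pt d)}

/-! ### Mollification -/

/-- A sequence of mollifiers whose supports shrink to the origin. -/
def mollifier (d k : ℕ) : ContDiffBump (0 : Pt d) where
  rIn := 1 / (k + 1)
  rOut := 2 / (k + 1)
  rIn_pos := by positivity
  rIn_lt_rOut := by gcongr; norm_num

/-- The mollification of `g`. -/
def mollify {d : ℕ} (k : ℕ) (g : Pt d → ℝ) : Pt d → ℝ :=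
  convolution ((mollifier d k).normed volume) g (ContinuousLinearMap.lsmul ℝ ℝ) volume

lemma tendsto_mollifier_rOut (d : ℕ) :
    Tendsto (fun k => (mollifier d k).rOut) atTop (𝓝 0) := by
  have h := (tendsto_const_div_atTop_nhds_zero_nat (2 : ℝ)).comp (tendsto_add_atTop_nat 1)
  refine h.congr fun k => ?_
  simp [mollifier]

lemma contDiff_mollify (k : ℕ) {g : Pt d → ℝ} (hg : LocallyIntegrable g volume) :
    ContDiff ℝ ∞ (mollify k g) :=
  (mollifier d k).hasCompactSupport_normed.contDiff_convolution_left _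
    (mollifier d k).contDiff_normed hg

lemma abs_mollify_sub_le (k : ℕ) {g : Pt d → ℝ} {L : ℝ≥0} (hg : LipschitzWith L g) (x : Pt d) :
    |mollify k g x - g x| ≤ L * (mollifier d k).rOut := by
  rw [← Real.dist_eq]
  refine (mollifier d k).dist_normed_convolution_le hg.continuous.aestronglyMeasurable
    fun y hy => (hg.dist_le_mul y x).trans ?_
  exact mul_le_mul_of_nonneg_left (Metric.mem_ball.1 hy).le L.coe_nonneg

lemma eventually_isTest_mollify (hΩ : IsOpen Ω) {g : Pt d → ℝ}
    (hg : LocallyIntegrable g volume) (hc : HasCompactSupport g) (hs : tsupport g ⊆ Ω) :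
    ∀ᶠ k in atTop, IsTest Ω (mollify k g) := by
  obtain ⟨δ, hδ, hsub⟩ := hc.isCompact.exists_cthickening_subset_open hΩ hs
  filter_upwards [(tendsto_mollifier_rOut d).eventually (gt_mem_nhds hδ)] with k hk
  have hsupp : Function.support (mollify k g) ⊆ Metric.cthickening δ (tsupport g) := by
    refine (support_convolution_subset _).trans ?_
    rw [ContDiffBump.support_normed_eq]
    rintro _ ⟨a, ha, b, hb, rfl⟩
    refine Metric.mem_cthickening_of_dist_le _ b δ _ (subset_tsupport g hb) ?_
    have := mem_ball_zero_iff.1 ha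
    simp only [dist_eq_norm, add_sub_cancel_right]
    linarith
  have hts : tsupport (mollify k g) ⊆ Metric.cthickening δ (tsupport g) :=
    closure_minimal hsupp Metric.isClosed_cthickening
  exact ⟨contDiff_mollify k hg, (mollifier d k).hasCompactSupport_normed.convolution _ hc,
    hts.trans hsub⟩

lemma hasFDerivAt_mollify (k : ℕ) {g : Pt d → ℝ} {L : ℝ≥0} (hg : LipschitzWith L g) (x : Pt d) :
    HasFDerivAt (mollify k g) (convolution ((mollifier d k).normed volume) (fderiv ℝ g)
      (ContinuousLinearMap.lsmul ℝ ℝ) volume x) x := by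
  set ρ := (mollifier d k).normed (volume : Measure (Pt d)) with hρ
  have hρi : Integrable ρ volume := (mollifier d k).integrable_normed
  have hρc : Continuous ρ := (mollifier d k).continuous_normed
  have hρs : HasCompactSupport ρ := (mollifier d k).hasCompactSupport_normed
  have hgm := hg.continuous
  have key := hasFDerivAt_integral_of_dominated_loc_of_lip (μ := (volume : Measure (Pt d)))
    (F := fun y t => ρ t • g (y - t)) (F' := fun t => ρ t • fderiv ℝ g (x - t))
    (bound := fun t => L * ρ t) (x₀ := x) (s := univ) univ_mem
    (Eventually.of_forall fun y => Continuous.aestronglyMeasurable (by fun_prop))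
    (Continuous.integrable_of_hasCompactSupport (by fun_prop) hρs.smul_right)
    (hρc.aestronglyMeasurable.smul ((measurable_fderiv ℝ g).comp
      (measurable_const.sub measurable_id)).aestronglyMeasurable)
    (Eventually.of_forall fun t => ?_) (hρi.const_mul _) ?_
  · exact key.2
  · refine (LipschitzWith.of_dist_le_mul fun a b => ?_).lipschitzOnWith
    rw [Real.dist_eq, ← smul_sub, smul_eq_mul, abs_mul, Real.coe_nnabs, abs_mul, NNReal.abs_eq]
    have h1 := hg.dist_le_mul (a - t) (b - t)
    rw [dist_sub_right, Real.dist_eq] at h1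
    nlinarith [abs_nonneg (ρ t)]
  · have h1 : ∀ᵐ t ∂(volume : Measure (Pt d)), DifferentiableAt ℝ g (x - t) :=
      (quasiMeasurePreserving_sub_left volume x).ae hg.ae_differentiableAt
    filter_upwards [h1] with t ht
    have h2 : HasFDerivAt (fun y => g (y - t)) (fderiv ℝ g (x - t)) x := by
      simpa [Function.comp_def] using ht.hasFDerivAt.comp x ((hasFDerivAt_id x).sub_const t)
    exact h2.const_smul (ρ t)

lemma lipschitzWith_mollify (k : ℕ) {g : Pt d → ℝ} {L : ℝ≥0} (hg : LipschitzWith L g) :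
    LipschitzWith L (mollify k g) := by
  set ρ := (mollifier d k).normed (volume : Measure (Pt d)) with hρ
  have hρi : Integrable ρ volume := (mollifier d k).integrable_normed
  have hρc : Continuous ρ := (mollifier d k).continuous_normed
  have hρs : HasCompactSupport ρ := (mollifier d k).hasCompactSupport_normed
  have hgm := hg.continuous
  have hint : ∀ y, Integrable (fun t => ρ t • g (y - t)) volume := fun y =>
    Continuous.integrable_of_hasCompactSupport (by fun_prop) hρs.smul_right
  refine LipschitzWith.of_dist_le_mul fun a b => ?_
  have e : mollify k g a - mollify k g b = ∫ t, ρ t • (g (a - t) - g (b - t)) := by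
    simp only [smul_sub]
    rw [integral_sub (hint a) (hint b)]
    rfl
  have hb : ∫ t, ρ t * (L * dist a b) = L * dist a b := by
    rw [integral_mul_const, hρ, (mollifier d k).integral_normed, one_mul]
  rw [Real.dist_eq, ← Real.norm_eq_abs, e, ← hb]
  refine norm_integral_le_of_norm_le (hρi.mul_const _) (Eventually.of_forall fun t => ?_)
  rw [norm_smul, Real.norm_of_nonneg ((mollifier d k).nonneg_normed t)]
  refine mul_le_mul_of_nonneg_left ?_ ((mollifier d k).nonneg_normed t)
  have h1 := hg.dist_le_mul (a - t) (b - t)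
  rwa [dist_sub_right, dist_eq_norm] at h1

lemma ae_tendsto_fderiv_mollify {g : Pt d → ℝ} {L : ℝ≥0} (hg : LipschitzWith L g) :
    ∀ᵐ x, Tendsto (fun k => fderiv ℝ (mollify k g) x) atTop (𝓝 (fderiv ℝ g x)) := by
  have hloc : LocallyIntegrable (fderiv ℝ g) (volume : Measure (Pt d)) :=
    (memLp_top_of_bound (measurable_fderiv ℝ g).aestronglyMeasurable L
      (Eventually.of_forall fun x => norm_fderiv_le_of_lipschitz ℝ hg)).locallyIntegrable le_top
  have h := ContDiffBump.ae_convolution_tendsto_right_of_locallyIntegrable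
    (φ := fun k => mollifier d k) (l := atTop) (K := 2) (tendsto_mollifier_rOut d)
    (Eventually.of_forall fun k => by simp [mollifier, div_eq_mul_inv]) hloc
  filter_upwards [h] with x hx
  exact hx.congr fun k => ((hasFDerivAt_mollify k hg x).fderiv).symm

/-- Soft thresholding at level `ε`. -/
def softThreshold (ε t : ℝ) : ℝ := t - max (-ε) (min t ε)

lemma abs_softThreshold_sub_le {ε : ℝ} (hε : 0 ≤ ε) (t : ℝ) : |softThreshold ε t - t| ≤ ε := by
  rw [softThreshold, sub_sub_cancel_left, abs_neg, abs_le]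
  exact ⟨le_max_left _ _, max_le (by linarith) (min_le_right _ _)⟩

lemma softThreshold_of_abs_le {ε t : ℝ} (h : |t| ≤ ε) : softThreshold ε t = 0 := by
  rw [abs_le] at h
  rw [softThreshold, min_eq_left h.2, max_eq_right h.1, sub_self]

lemma softThreshold_of_lt {ε t : ℝ} (hε : 0 ≤ ε) (h : ε < t) : softThreshold ε t = t - ε := by
  rw [softThreshold, min_eq_right h.le, max_eq_right (by linarith)]

lemma softThreshold_of_lt_neg {ε t : ℝ} (hε : 0 ≤ ε) (h : t < -ε) :
    softThreshold ε t = t + ε := by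
  rw [softThreshold, min_eq_left (by linarith), max_eq_left h.le, sub_neg_eq_add]

lemma lipschitzWith_softThreshold (ε : ℝ) : LipschitzWith 2 (softThreshold ε) := by
  have h : LipschitzWith 1 fun t : ℝ => max (-ε) (min t ε) :=
    (LipschitzWith.id.min_const ε).const_max (-ε)
  have := (LipschitzWith.id (α := ℝ)).sub h
  rw [one_add_one_eq_two] at this
  exact this

/-- Soft thresholding changes a Lipschitz function little in `H¹`. -/
lemma tendsto_fderiv_softThreshold {v : Pt d → ℝ} {L : ℝ≥0} (hv : LipschitzWith L v) {ε : ℕ → ℝ}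
    (hε0 : ∀ n, 0 < ε n) (hε : Tendsto ε atTop (𝓝 0)) :
    ∀ᵐ x, Tendsto (fun n => fderiv ℝ (fun y => softThreshold (ε n) (v y)) x) atTop
      (𝓝 (fderiv ℝ v x)) := by
  filter_upwards [ae_fderiv_eq_zero hv] with x hx
  have hvc := hv.continuous.continuousAt (x := x)
  rcases lt_trichotomy (v x) 0 with h | h | h
  · refine tendsto_const_nhds.congr' ?_
    filter_upwards [hε.eventually (gt_mem_nhds (neg_pos.2 h))] with n hn
    have : ∀ᶠ y in 𝓝 x, softThreshold (ε n) (v y) = v y + ε n := by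
      filter_upwards [hvc.eventually (gt_mem_nhds (show v x < -ε n by linarith))] with y hy
      exact softThreshold_of_lt_neg (hε0 n).le hy
    rw [Filter.EventuallyEq.fderiv_eq this, fderiv_add_const]
  · rw [hx h]
    refine tendsto_const_nhds.congr' (Eventually.of_forall fun n => ?_)
    have : ∀ᶠ y in 𝓝 x, softThreshold (ε n) (v y) = (fun _ => (0 : ℝ)) y := by
      filter_upwards [hvc.abs.eventually (gt_mem_nhds
        (show |v x| < ε n by rw [h, abs_zero]; exact hε0 n))] with y hy
      exact softThreshold_of_abs_le hy.le
    exact ((Filter.EventuallyEq.fderiv_eq this).trans (fderiv_const_apply 0)).symm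
  · refine tendsto_const_nhds.congr' ?_
    filter_upwards [hε.eventually (gt_mem_nhds h)] with n hn
    have : ∀ᶠ y in 𝓝 x, softThreshold (ε n) (v y) = v y - ε n := by
      filter_upwards [hvc.eventually (lt_mem_nhds hn)] with y hy
      exact softThreshold_of_lt (hε0 n).le hy
    rw [Filter.EventuallyEq.fderiv_eq this, fderiv_sub_const]

lemma isFiniteMeasure_restrict_of_isBounded (hb : Bornology.IsBounded Ω) :
    IsFiniteMeasure ((volume : Measure (Pt d)).restrict Ω) :=
  ⟨by rw [Measure.restrict_apply_univ]; exact hb.measure_lt_top⟩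

/-- A Lipschitz function vanishing outside the bounded open set `Ω` is approximated in `H¹` by test
functions: truncate it near its zero set, then mollify. -/
lemma exists_isTest_approx (hΩ : IsOpen Ω) (hb : Bornology.IsBounded Ω) {v : Pt d → ℝ} {L : ℝ≥0}
    (hv : LipschitzWith L v) (h0 : ∀ x ∉ Ω, v x = 0) {δ : ℝ≥0∞} (hδ : 0 < δ) :
    ∃ φ, IsTest Ω φ ∧ eLpNorm (fun x => φ x - v x) 2 (volume.restrict Ω) ≤ δ ∧
      eLpNorm (fun x => fderiv ℝ φ x - fderiv ℝ v x) 2 (volume.restrict Ω) ≤ δ := by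
  have := isFiniteMeasure_restrict_of_isBounded hb
  have hδ2 : 0 < δ / 2 := ENNReal.half_pos hδ.ne'
  set ε : ℕ → ℝ := fun n => 1 / ((n : ℝ) + 1) with hεdef
  have hε0 : ∀ n, 0 < ε n := fun n => by positivity
  have hε : Tendsto ε atTop (𝓝 0) := tendsto_one_div_add_atTop_nhds_zero_nat
  set w : ℕ → Pt d → ℝ := fun n y => softThreshold (ε n) (v y) with hw
  have hwL : ∀ n, LipschitzWith (2 * L) (w n) := fun n => (lipschitzWith_softThreshold _).comp hv
  have t1 : Tendsto (fun n => eLpNorm (fun x => w n x - v x) 2 (volume.restrict Ω)) atTop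
      (𝓝 0) := by
    refine tendsto_eLpNorm_two_of_ae (C := 1) (fun n => ((hwL n).continuous.sub
      hv.continuous).aestronglyMeasurable) (fun n => Eventually.of_forall fun x => ?_)
      (Eventually.of_forall fun x => ?_)
    · refine (abs_softThreshold_sub_le (hε0 n).le _).trans ?_
      rw [hεdef]; simp only
      rw [div_le_one (by positivity)]
      linarith [(n.cast_nonneg : (0 : ℝ) ≤ n)]
    · exact squeeze_zero_norm (fun n => abs_softThreshold_sub_le (hε0 n).le _) hε
  have t2 : Tendsto (fun n => eLpNorm (fun x => fderiv ℝ (w n) x - fderiv ℝ v x) 2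
      (volume.restrict Ω)) atTop (𝓝 0) := by
    refine tendsto_eLpNorm_two_of_ae (C := ((2 * L : ℝ≥0) : ℝ) + L)
      (fun n => ((measurable_fderiv ℝ (w n)).sub
      (measurable_fderiv ℝ v)).aestronglyMeasurable) (fun n => Eventually.of_forall fun x => ?_) ?_
    · exact (norm_sub_le _ _).trans (add_le_add (norm_fderiv_le_of_lipschitz ℝ (hwL n))
        (norm_fderiv_le_of_lipschitz ℝ hv))
    · filter_upwards [ae_restrict_of_ae (tendsto_fderiv_softThreshold hv hε0 hε)] with x hx
      simpa using hx.sub_const (fderiv ℝ v x)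
  obtain ⟨n, hn1, hn2⟩ := ((t1.eventually (gt_mem_nhds hδ2)).and
    (t2.eventually (gt_mem_nhds hδ2))).exists
  -- the truncated function has compact support in `Ω`
  have hts : tsupport (w n) ⊆ {x | ε n ≤ |v x|} := by
    refine closure_minimal (fun x hx => ?_) (isClosed_le continuous_const hv.continuous.abs)
    by_contra h
    exact hx (softThreshold_of_abs_le (not_le.1 h).le)
  have htΩ : tsupport (w n) ⊆ Ω := hts.trans fun x hx => by
    by_contra h
    have h1 : ε n ≤ |v x| := hx
    rw [h0 x h, abs_zero] at h1
    exact absurd h1 (not_le.2 (hε0 n))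
  have hcs : HasCompactSupport (w n) :=
    Metric.isCompact_of_isClosed_isBounded (isClosed_tsupport _) (hb.subset htΩ)
  have s1 : Tendsto (fun k => eLpNorm (fun x => mollify k (w n) x - w n x) 2
      (volume.restrict Ω)) atTop (𝓝 0) := by
    refine tendsto_eLpNorm_two_of_ae (C := (2 * L : ℝ≥0) * 2)
      (fun k => (((contDiff_mollify k (hwL n).continuous.locallyIntegrable).continuous).sub
        (hwL n).continuous).aestronglyMeasurable) (fun k => Eventually.of_forall fun x => ?_)
      (Eventually.of_forall fun x => ?_)
    · refine (abs_mollify_sub_le k (hwL n) x).trans ?_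
      refine mul_le_mul_of_nonneg_left ?_ (NNReal.coe_nonneg _)
      simp only [mollifier]
      rw [div_le_iff₀ (by positivity)]
      linarith [(k.cast_nonneg : (0 : ℝ) ≤ k)]
    · refine squeeze_zero_norm (fun k => abs_mollify_sub_le k (hwL n) x) ?_
      simpa using (tendsto_mollifier_rOut d).const_mul ((2 * L : ℝ≥0) : ℝ)
  have s2 : Tendsto (fun k => eLpNorm (fun x => fderiv ℝ (mollify k (w n)) x - fderiv ℝ (w n) x) 2
      (volume.restrict Ω)) atTop (𝓝 0) := by
    refine tendsto_eLpNorm_two_of_ae (C := ((2 * L : ℝ≥0) : ℝ) + (2 * L : ℝ≥0))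
      (fun k => ((measurable_fderiv ℝ _).sub
      (measurable_fderiv ℝ _)).aestronglyMeasurable) (fun k => Eventually.of_forall fun x => ?_) ?_
    · exact (norm_sub_le _ _).trans (add_le_add
        (norm_fderiv_le_of_lipschitz ℝ (lipschitzWith_mollify k (hwL n)))
        (norm_fderiv_le_of_lipschitz ℝ (hwL n)))
    · filter_upwards [ae_restrict_of_ae (ae_tendsto_fderiv_mollify (hwL n))] with x hx
      simpa using hx.sub_const (fderiv ℝ (w n) x)
  obtain ⟨k, ⟨hk1, hk2⟩, hk3⟩ := (((s1.eventually (gt_mem_nhds hδ2)).and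
    (s2.eventually (gt_mem_nhds hδ2))).and
    (eventually_isTest_mollify hΩ (hwL n).continuous.locallyIntegrable hcs htΩ)).exists
  have hmc : Continuous (mollify k (w n)) :=
    (contDiff_mollify k (hwL n).continuous.locallyIntegrable).continuous
  refine ⟨mollify k (w n), hk3, ?_, ?_⟩
  · have m1 : AEStronglyMeasurable (fun x => mollify k (w n) x - w n x) (volume.restrict Ω) :=
      (hmc.sub (hwL n).continuous).aestronglyMeasurable
    have m2 : AEStronglyMeasurable (fun x => w n x - v x) (volume.restrict Ω) :=
      ((hwL n).continuous.sub hv.continuous).aestronglyMeasurable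
    have h := eLpNorm_add_le m1 m2 (p := 2) (by norm_num)
    have e : (fun x => mollify k (w n) x - v x) =
        (fun x => mollify k (w n) x - w n x) + fun x => w n x - v x :=
      funext fun x => (sub_add_sub_cancel _ _ _).symm
    rw [e]
    refine h.trans ?_
    rw [← ENNReal.add_halves δ]; exact add_le_add hk1.le hn1.le
  · have m1 : AEStronglyMeasurable (fun x => fderiv ℝ (mollify k (w n)) x - fderiv ℝ (w n) x)
        (volume.restrict Ω) :=
      ((measurable_fderiv ℝ _).sub (measurable_fderiv ℝ _)).aestronglyMeasurable
    have m2 : AEStronglyMeasurable (fun x => fderiv ℝ (w n) x - fderiv ℝ v x)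
        (volume.restrict Ω) :=
      ((measurable_fderiv ℝ _).sub (measurable_fderiv ℝ _)).aestronglyMeasurable
    have h := eLpNorm_add_le m1 m2 (p := 2) (by norm_num)
    have e : (fun x => fderiv ℝ (mollify k (w n)) x - fderiv ℝ v x) =
        (fun x => fderiv ℝ (mollify k (w n)) x - fderiv ℝ (w n) x) +
          fun x => fderiv ℝ (w n) x - fderiv ℝ v x :=
      funext fun x => (sub_add_sub_cancel _ _ _).symm
    rw [e]
    refine h.trans ?_
    rw [← ENNReal.add_halves δ]; exact add_le_add hk2.le hn2.le

lemma weakGrad_ae_eq_gradient (hΩ : IsOpen Ω) {v : Pt d → ℝ} {L : ℝ≥0} (hv : LipschitzWith L v) :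
    weakGrad Ω v =ᵐ[volume.restrict Ω] gradient v :=
  (isWeakGrad_gradient hv).weakGrad_ae_eq hΩ

/-- Lipschitz functions vanishing outside a bounded open set belong to `H¹₀`, without any regularity
of the boundary. -/
theorem memH10_of_lipschitz (hΩ : IsOpen Ω) (hb : Bornology.IsBounded Ω) {v : Pt d → ℝ} {L : ℝ≥0}
    (hv : LipschitzWith L v) (h0 : ∀ x ∉ Ω, v x = 0) : MemH10 Ω v := by
  have := isFiniteMeasure_restrict_of_isBounded hb
  have hgrad := weakGrad_ae_eq_gradient hΩ hv
  refine ⟨⟨?_, gradient v, isWeakGrad_gradient hv, ?_⟩, ?_⟩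
  · obtain ⟨M, hM⟩ : ∃ M, ∀ x ∈ closure Ω, ‖v x‖ ≤ M :=
      hb.isCompact_closure.exists_bound_of_continuousOn hv.continuous.continuousOn
    refine MemLp.of_bound hv.continuous.aestronglyMeasurable M ?_
    rw [ae_restrict_iff' hΩ.measurableSet]
    exact Eventually.of_forall fun x hx => hM x (subset_closure hx)
  · exact MemLp.of_bound (measurable_gradient v).aestronglyMeasurable L
      (Eventually.of_forall (norm_gradient_le_of_lipschitz hv))
  · choose φ h1 h2 h3 using fun n : ℕ => exists_isTest_approx hΩ hb hv h0
      (δ := ((n : ℝ≥0∞) + 1)⁻¹) (by simp)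
    have hlim : Tendsto (fun n : ℕ => ((n : ℝ≥0∞) + 1)⁻¹) atTop (𝓝 0) := by
      have := ENNReal.tendsto_inv_nat_nhds_zero.comp (tendsto_add_atTop_nat 1)
      refine this.congr fun n => ?_
      simp
    refine ⟨φ, h1, tendsto_of_tendsto_of_tendsto_of_le_of_le tendsto_const_nhds hlim
      (fun _ => zero_le) h2, tendsto_of_tendsto_of_tendsto_of_le_of_le tendsto_const_nhds hlim
      (fun _ => zero_le) fun n => ?_⟩
    refine le_trans (le_of_eq ?_) (h3 n)
    refine eLpNorm_congr_norm_ae ?_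
    filter_upwards [hgrad] with x hx
    rw [hx, norm_gradient_sub]

end

section

variable {d : ℕ} {Ω : Set (Pt d)}

/-! ### Functions in `W^{1,∞}` are Lipschitz on convex sets -/

lemma fderiv_mollify_apply (k : ℕ) {g : Pt d → ℝ} (hg : LocallyIntegrable g volume) (z e : Pt d) :
    fderiv ℝ (mollify k g) z e =
      ∫ t, fderiv ℝ ((mollifier d k).normed volume) (z - t) e * g t := by
  set ρ := (mollifier d k).normed (volume : Measure (Pt d)) with hρ
  have hρc : ContDiff ℝ 1 ρ := (mollifier d k).contDiff_normed
  have hρs : HasCompactSupport ρ := (mollifier d k).hasCompactSupport_normed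
  have h1 := hρs.hasFDerivAt_convolution_left (ContinuousLinearMap.lsmul ℝ ℝ) hρc hg z
  have hint : ConvolutionExistsAt (fderiv ℝ ρ) g z
      (ContinuousLinearMap.precompL (Pt d) (ContinuousLinearMap.lsmul ℝ ℝ)) volume :=
    (hρs.fderiv ℝ).convolutionExists_left _ (hρc.continuous_fderiv one_ne_zero) hg z
  have h2 : fderiv ℝ (mollify k g) z = _ := h1.fderiv
  rw [h2, convolution, ContinuousLinearMap.integral_apply hint]
  rw [← integral_sub_left_eq_self _ volume z]
  refine integral_congr_ae (Eventually.of_forall fun t => ?_)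
  simp [ContinuousLinearMap.precompL_apply]

/-- The derivative of the mollification is bounded by the bound of the weak gradient. -/
lemma norm_fderiv_mollify_le {b : Pt d → ℝ} {G : Pt d → Pt d} (hΩ : IsOpen Ω)
    (hb : LocallyIntegrable (Ω.indicator b) volume) (hG : IsWeakGrad Ω b G) {M : ℝ}
    (hM0 : 0 ≤ M) (hM : ∀ᵐ x ∂(volume.restrict Ω), ‖G x‖ ≤ M) (k : ℕ) {z : Pt d}
    (hz : Metric.closedBall z (mollifier d k).rOut ⊆ Ω) :
    ‖fderiv ℝ (mollify k (Ω.indicator b)) z‖ ≤ M := by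
  set ρ := (mollifier d k).normed (volume : Measure (Pt d)) with hρ
  set φ : Pt d → ℝ := fun t => ρ (z - t) with hφdef
  have hρd : Differentiable ℝ ρ := (mollifier d k).contDiff_normed (n := 1).differentiable (by simp)
  have hcd : ContDiff ℝ ∞ φ := by
    have : ContDiff ℝ ∞ ρ := (mollifier d k).contDiff_normed
    exact this.comp (contDiff_const.sub contDiff_id)
  have hts : tsupport φ ⊆ Metric.closedBall z (mollifier d k).rOut := by
    refine closure_minimal (fun t ht => ?_) Metric.isClosed_closedBall
    have h1 : z - t ∈ Function.support ρ := ht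
    rw [hρ, ContDiffBump.support_normed_eq, mem_ball_zero_iff] at h1
    rw [Metric.mem_closedBall, dist_comm, dist_eq_norm]
    exact h1.le
  have hφ : IsTest Ω φ := ⟨hcd, HasCompactSupport.intro' (isCompact_closedBall z _)
    Metric.isClosed_closedBall fun x hx => image_eq_zero_of_notMem_tsupport fun h => hx (hts h),
    hts.trans hz⟩
  have hφ0 : ∀ t, 0 ≤ φ t := fun t => (mollifier d k).nonneg_normed _
  have hφ1 : ∫ t, φ t = 1 := by
    rw [hφdef, integral_sub_left_eq_self ρ volume z, hρ]
    exact (mollifier d k).integral_normed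
  have hφi : Integrable φ volume := hcd.continuous.integrable_of_hasCompactSupport hφ.2.1
  have hgrad : ∀ t, gradient φ t = -gradient ρ (z - t) := fun t => by
    have h2 : HasFDerivAt φ (-fderiv ℝ ρ (z - t)) t := by
      have h3 := (hρd (z - t)).hasFDerivAt.comp t ((hasFDerivAt_id t).const_sub z)
      simpa [Function.comp_def] using h3
    rw [gradient_eq_toDual, h2.fderiv, map_neg, gradient_eq_toDual]
  have key : ∀ e, fderiv ℝ (mollify k (Ω.indicator b)) z e = ⟪e, ∫ x in Ω, φ x • G x⟫_ℝ := by
    intro e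
    have h4 := hG.2.2 φ hφ
    rw [fderiv_mollify_apply k hb, ← neg_neg (∫ x in Ω, φ x • G x), ← h4, inner_neg_right,
      ← integral_inner (hφ.integrable_smul_gradient hG.1), ← integral_neg,
      ← integral_indicator hΩ.measurableSet]
    refine integral_congr_ae (Eventually.of_forall fun t => ?_)
    by_cases ht : t ∈ Ω
    · simp only [indicator_of_mem ht, hgrad, smul_neg, inner_neg_right, neg_neg, inner_smul_right]
      rw [real_inner_comm, inner_gradient, mul_comm]
    · simp [indicator_of_notMem ht]
  have hnorm : ‖∫ x in Ω, φ x • G x‖ ≤ M := by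
    have h5 : ∫ x in Ω, φ x * M ≤ M := by
      rw [integral_mul_const]
      have : ∫ x in Ω, φ x ≤ 1 := by
        rw [← hφ1]; exact setIntegral_le_integral hφi (Eventually.of_forall hφ0)
      nlinarith
    refine (norm_integral_le_of_norm_le (hφi.restrict.mul_const M) ?_).trans h5
    filter_upwards [hM] with x hx
    rw [norm_smul, Real.norm_of_nonneg (hφ0 x)]
    exact mul_le_mul_of_nonneg_left hx (hφ0 x)
  refine ContinuousLinearMap.opNorm_le_bound _ hM0 fun e => ?_
  rw [key e]
  refine (norm_inner_le_norm _ _).trans ?_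
  rw [mul_comm]
  exact mul_le_mul_of_nonneg_right hnorm (norm_nonneg _)

/-- The continuous representative of a `W^{1,∞}` function is Lipschitz on convex open subsets. -/
theorem MemW1Inf.exists_lipschitzOnWith (hΩ : IsOpen Ω) {b : Pt d → ℝ} (hb : MemW1Inf Ω b)
    (hbc : ContinuousOn b Ω) :
    ∃ M : ℝ≥0, ∀ U ⊆ Ω, IsOpen U → Convex ℝ U → LipschitzOnWith M b U := by
  obtain ⟨hb1, G, hG, hGi⟩ := hb
  obtain ⟨M, hM0, hM⟩ : ∃ M : ℝ, 0 ≤ M ∧ ∀ᵐ x ∂(volume.restrict Ω), ‖G x‖ ≤ M := by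
    refine ⟨(eLpNorm G ∞ (volume.restrict Ω)).toReal, ENNReal.toReal_nonneg, ?_⟩
    have h1 := ae_le_eLpNormEssSup (f := G) (μ := volume.restrict Ω)
    rw [← eLpNorm_exponent_top] at h1
    filter_upwards [h1] with x hx
    rw [← ENNReal.ofReal_le_iff_le_toReal hGi.2.ne, ofReal_norm]
    exact hx
  have hloc : LocallyIntegrable (Ω.indicator b) volume :=
    (((memLp_indicator_iff_restrict hΩ.measurableSet).2 hb1)).locallyIntegrable le_top
  refine ⟨M.toNNReal, fun U hUΩ hU hUc => LipschitzOnWith.of_dist_le_mul fun x hx y hy => ?_⟩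
  rw [Real.coe_toNNReal M hM0]
  have hseg : segment ℝ y x ⊆ U := hUc.segment_subset hy hx
  have hsegc : IsCompact (segment ℝ y x) := by
    rw [segment_eq_image_lineMap]
    exact isCompact_Icc.image (by fun_prop)
  obtain ⟨δ, hδ, hsub⟩ := hsegc.exists_cthickening_subset_open hU hseg
  have hlim : ∀ z ∈ U, Tendsto (fun k => mollify k (Ω.indicator b) z) atTop (𝓝 (b z)) := by
    intro z hz
    have hca : ContinuousAt (Ω.indicator b) z := by
      have h1 : ContinuousAt b z := hbc.continuousAt (hΩ.mem_nhds (hUΩ hz))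
      refine h1.congr ?_
      filter_upwards [hΩ.mem_nhds (hUΩ hz)] with t ht using (indicator_of_mem ht b).symm
    have h2 := ContDiffBump.convolution_tendsto_right (φ := fun k => mollifier d k)
      (μ := (volume : Measure (Pt d))) (g := fun _ => Ω.indicator b) (l := atTop)
      (tendsto_mollifier_rOut d)
      (Eventually.of_forall fun _ => hloc.aestronglyMeasurable)
      (hca.tendsto.comp tendsto_snd) (tendsto_const_nhds (x := z))
    rwa [indicator_of_mem (hUΩ hz)] at h2
  refine le_of_tendsto ((hlim x hx).dist (hlim y hy)) ?_
  filter_upwards [(tendsto_mollifier_rOut d).eventually (gt_mem_nhds hδ)] with k hk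
  rw [dist_eq_norm, dist_eq_norm]
  refine (convex_segment y x).norm_image_sub_le_of_norm_fderiv_le (𝕜 := ℝ)
    (fun z _ => ((contDiff_mollify k hloc).differentiable (by simp)) z) (fun z hz => ?_)
    (left_mem_segment ℝ y x) (right_mem_segment ℝ y x)
  refine norm_fderiv_mollify_le hΩ hloc hG hM0 hM k ?_
  refine (Metric.closedBall_subset_closedBall hk.le).trans ?_
  refine Subset.trans ?_ (hsub.trans hUΩ)
  exact Metric.closedBall_subset_cthickening hz δ

/-! ### Piecewise smooth functions on the mesh -/

/-- A function that is Lipschitz on each of finitely many closed sets covering an interval is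
Lipschitz on the interval. -/
lemma abs_sub_le_of_closed_cover {ι : Type*} {f : ℝ → ℝ} {L : ℝ} (s : Finset ι) :
    ∀ {A : ι → Set ℝ} {a b : ℝ}, a ≤ b → (∀ i ∈ s, IsClosed (A i)) →
      (∀ i ∈ s, ∀ x ∈ A i, ∀ y ∈ A i, |f y - f x| ≤ L * |y - x|) →
      Icc a b ⊆ (⋃ i ∈ s, A i) → |f b - f a| ≤ L * (b - a) := by
  classical
  induction s using Finset.strongInduction with
  | H s ih =>
    intro A a b hab hcl hL hcov
    have ha := hcov (left_mem_Icc.2 hab)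
    simp only [mem_iUnion] at ha
    obtain ⟨i, hi, hai⟩ := ha
    set S := Icc a b ∩ A i with hS
    have hScl : IsClosed S := isClosed_Icc.inter (hcl i hi)
    have hSbd : BddAbove S := ⟨b, fun t ht => ht.1.2⟩
    have hcS : sSup S ∈ S := hScl.csSup_mem ⟨a, left_mem_Icc.2 hab, hai⟩ hSbd
    set c := sSup S with hc
    have h1 : |f c - f a| ≤ L * (c - a) := by
      have := hL i hi a hai c hcS.2
      rwa [abs_of_nonneg (sub_nonneg.2 hcS.1.1)] at this
    rcases eq_or_lt_of_le hcS.1.2 with hcb | hcb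
    · rw [← hcb]; exact h1
    -- the part to the right of `c` is covered by the remaining sets
    have hcov' : Icc c b ⊆ ⋃ j ∈ s.erase i, A j := by
      have hclos : IsClosed (⋃ j ∈ s.erase i, A j) :=
        (s.erase i).finite_toSet.isClosed_biUnion fun j hj => hcl j (Finset.mem_of_mem_erase hj)
      have hIoc : Ioc c b ⊆ ⋃ j ∈ s.erase i, A j := by
        intro t ht
        have h2 := hcov ⟨hcS.1.1.trans ht.1.le, ht.2⟩
        simp only [mem_iUnion] at h2 ⊢
        obtain ⟨j, hj, htj⟩ := h2
        refine ⟨j, Finset.mem_erase.2 ⟨fun e => ?_, hj⟩, htj⟩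
        rw [e] at htj
        exact absurd (le_csSup hSbd ⟨⟨hcS.1.1.trans ht.1.le, ht.2⟩, htj⟩) (not_le.2 ht.1)
      rw [← closure_Ioc hcb.ne]
      exact closure_minimal hIoc hclos
    have h2 := ih (s.erase i) (Finset.erase_ssubset hi) (A := A) hcb.le
      (fun j hj => hcl j (Finset.mem_of_mem_erase hj))
      (fun j hj => hL j (Finset.mem_of_mem_erase hj)) hcov'
    calc |f b - f a| = |(f b - f c) + (f c - f a)| := by congr 1; ring
      _ ≤ |f b - f c| + |f c - f a| := abs_add_le _ _
      _ ≤ L * (b - c) + L * (c - a) := add_le_add h2 h1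
      _ = L * (b - a) := by ring

/-- The functions that vanish outside `Ω` and are restrictions of `C²` functions on each element. -/
def Mesh.piecewiseC2 (T : Mesh Ω) : Submodule ℝ (Pt d → ℝ) where
  carrier := {v | (∀ x ∉ Ω, v x = 0) ∧
    ∀ K ∈ T.elems, ∃ g : Pt d → ℝ, ContDiff ℝ 2 g ∧ EqOn v g (cell K)}
  zero_mem' := ⟨fun _ _ => rfl, fun _ _ => ⟨fun _ => 0, contDiff_const, fun _ _ => rfl⟩⟩
  add_mem' := by
    rintro v w ⟨hv, hv'⟩ ⟨hw, hw'⟩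
    refine ⟨fun x hx => by rw [Pi.add_apply, hv x hx, hw x hx, add_zero], fun K hK => ?_⟩
    obtain ⟨g, hg, hvg⟩ := hv' K hK
    obtain ⟨k, hk, hwk⟩ := hw' K hK
    exact ⟨fun x => g x + k x, hg.add hk, fun x hx => by
      rw [Pi.add_apply, hvg hx, hwk hx]⟩
  smul_mem' := by
    rintro c v ⟨hv, hv'⟩
    refine ⟨fun x hx => by rw [Pi.smul_apply, hv x hx, smul_zero], fun K hK => ?_⟩
    obtain ⟨g, hg, hvg⟩ := hv' K hK
    exact ⟨fun x => c • g x, hg.const_smul c, fun x hx => by rw [Pi.smul_apply, hvg hx]⟩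

variable (T : Mesh Ω)

lemma exists_lipschitzOnWith_of_contDiff {s : Set (Pt d)} (hs : IsCompact s) (hc : Convex ℝ s)
    {g : Pt d → ℝ} (hg : ContDiff ℝ 1 g) : ∃ C : ℝ≥0, LipschitzOnWith C g s := by
  obtain ⟨C, hC⟩ := hs.exists_bound_of_continuousOn (hg.continuous_fderiv one_ne_zero).continuousOn
  refine ⟨C.toNNReal, hc.lipschitzOnWith_of_nnnorm_fderiv_le (𝕜 := ℝ)
    (fun x _ => (hg.differentiable one_ne_zero) x) fun x hx => ?_⟩
  rw [← NNReal.coe_le_coe, coe_nnnorm]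
  exact (hC x hx).trans (Real.le_coe_toNNReal C)

/-- Gluing: a piecewise Lipschitz function vanishing outside `Ω` is Lipschitz. -/
lemma Mesh.exists_lipschitzWith (hΩ : IsOpen Ω) {v : Pt d → ℝ} (h0 : ∀ x ∉ Ω, v x = 0)
    (hv : ∀ K ∈ T.elems, ∃ C : ℝ≥0, LipschitzOnWith C v (cell K)) :
    ∃ L : ℝ≥0, LipschitzWith L v := by
  choose! C hC using hv
  set L : ℝ≥0 := ∑ K ∈ T.elems, C K with hL
  have hCL : ∀ K ∈ T.elems, C K ≤ L := fun K hK =>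
    Finset.single_le_sum (fun _ _ => zero_le) hK
  refine ⟨L, LipschitzWith.of_dist_le_mul fun x y => ?_⟩
  set γ : ℝ → Pt d := fun t => y + t • (x - y) with hγ
  have hγc : Continuous γ := by fun_prop
  have hγd : ∀ s t, dist (γ s) (γ t) = |s - t| * dist x y := fun s t => by
    simp only [hγ]
    rw [dist_add_left, dist_eq_norm, ← sub_smul, norm_smul, Real.norm_eq_abs, dist_eq_norm]
  have key := abs_sub_le_of_closed_cover (f := fun t => v (γ t)) (L := L * dist x y)
    (Finset.insertNone T.elems)
    (A := fun o => match o with | none => γ ⁻¹' Ωᶜ | some K => γ ⁻¹' cell K) zero_le_one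
    (fun o ho => ?_) (fun o ho => ?_) (fun t _ => ?_)
  · simp only [hγ, one_smul, zero_smul, add_zero, add_sub_cancel, sub_zero, mul_one] at key
    exact key
  · cases o with
    | none => exact hΩ.isClosed_compl.preimage hγc
    | some K => exact (isCompact_cell K).isClosed.preimage hγc
  · cases o with
    | none =>
      intro s hs t ht
      rw [h0 _ hs, h0 _ ht, sub_self, abs_zero]
      positivity
    | some K =>
      intro s hs t ht
      have hK : K ∈ T.elems := by simpa using ho
      have h1 := (hC K hK).dist_le_mul _ ht _ hs
      rw [Real.dist_eq, hγd] at h1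
      refine h1.trans ?_
      have h2 : (C K : ℝ) ≤ L := by exact_mod_cast hCL K hK
      have h3 : 0 ≤ |t - s| * dist x y := by positivity
      nlinarith
  · simp only [mem_iUnion]
    by_cases h : γ t ∈ Ω
    · obtain ⟨K, hK, hxK⟩ := (T.mem_closure_iff _).1 (subset_closure h)
      exact ⟨some K, by simpa using hK, hxK⟩
    · exact ⟨none, by simp, h⟩

variable {T} in
lemma Mesh.exists_lipschitzWith_of_piecewiseC2 (hΩ : IsOpen Ω) {v : Pt d → ℝ}
    (hv : v ∈ T.piecewiseC2) : ∃ L : ℝ≥0, LipschitzWith L v := by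
  refine T.exists_lipschitzWith hΩ hv.1 fun K hK => ?_
  obtain ⟨g, hg, hvg⟩ := hv.2 K hK
  obtain ⟨C, hC⟩ := exists_lipschitzOnWith_of_contDiff (isCompact_cell K) (convex_cell K)
    (hg.of_le (by norm_num))
  exact ⟨C, fun x hx y hy => by rw [hvg hx, hvg hy]; exact hC hx hy⟩

/-! ### The enriched finite element space consists of piecewise smooth functions -/

lemma contDiff_netEval {σ : ℝ → ℝ} (hσ : ContDiff ℝ 2 σ) :
    ∀ (ws : List ℕ) (n : ℕ) (θ : NetParams n ws), ContDiff ℝ 2 (netEval σ n ws θ)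
  | [], n, θ => by
    have : netEval σ n [] θ = fun x => (∑ i, θ.1 i * x i) + θ.2 := by
      funext x; rw [netEval]
    rw [this]
    fun_prop
  | m :: ws, n, θ => by
    have h1 := contDiff_netEval hσ ws m θ.2
    have : netEval σ n (m :: ws) θ = fun x => netEval σ m ws θ.2
        (fun j => σ ((θ.1.1.mulVec x) j + θ.1.2 j)) := by
      funext x; rw [netEval]
    rw [this]
    refine h1.comp (contDiff_pi.2 fun j => hσ.comp ?_)
    simp only [Matrix.mulVec, dotProduct]
    fun_prop

lemma contDiff_neuralEnrichment {σ : Pt d → ℝ → ℝ} (ws : Pt d → List ℕ)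
    (θ : (p : Pt d) → NetParams d (ws p)) {p : Pt d} (hσ : ContDiff ℝ 2 (σ p)) :
    ContDiff ℝ 2 (neuralEnrichment σ ws θ p) := by
  unfold neuralEnrichment
  exact (contDiff_netEval hσ (ws p) d (θ p)).comp (by fun_prop)

lemma Mesh.hat_mem_piecewiseC2 (hΩo : IsOpen Ω) (hΩ : interior (closure Ω) = Ω) {p : Pt d}
    (hp : p ∈ T.nodes) (hpΩ : p ∈ Ω) : T.hat p ∈ T.piecewiseC2 :=
  ⟨fun _ hx => T.hat_eq_zero_of_notMem hΩo hΩ hp hpΩ hx, fun K hK =>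
    ⟨bary K p, (Mesh.isSimplex hK).contDiff_bary p, fun _ hx => T.hat_eq_bary hK hx p⟩⟩

lemma Mesh.mem_domain_of_notMem_frontier (hΩo : IsOpen Ω) {p : Pt d} (hp : p ∈ T.nodes)
    (hpf : p ∉ frontier Ω) : p ∈ Ω := by
  obtain ⟨K, hK, hpK⟩ := T.exists_elem_of_mem_nodes hp
  have hcl := T.cell_subset hK (mem_cell_of_mem hpK)
  by_contra h
  exact hpf (by rw [hΩo.frontier_eq]; exact ⟨hcl, h⟩)

lemma Mesh.enrBasis_mem_piecewiseC2 (hΩo : IsOpen Ω) {p : Pt d} {φ : Pt d → ℝ}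
    (hφ : ContDiff ℝ 2 φ) (h0 : ∀ x ∈ frontier Ω, T.enrBasis p φ x = 0) :
    T.enrBasis p φ ∈ T.piecewiseC2 := by
  refine ⟨fun x hx => ?_, fun K hK => ?_⟩
  · by_cases hxc : x ∈ closure Ω
    · exact h0 x (by rw [hΩo.frontier_eq]; exact ⟨hxc, hx⟩)
    · rw [Mesh.enrBasis, T.hat_of_notMem hxc, zero_mul]
  · have hs := Mesh.isSimplex hK
    refine ⟨fun x => bary K p x * (φ x - ∑ q ∈ T.nodes, φ q * bary K q x), ?_, fun x hx => ?_⟩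
    · exact (hs.contDiff_bary p).mul (hφ.sub (ContDiff.sum fun q _ =>
        contDiff_const.mul (hs.contDiff_bary q)))
    · simp only [Mesh.enrBasis, Mesh.interp, T.hat_eq_bary hK hx]

/-- Conformity of the enrichment at the boundary makes the enriched functions vanish outside `Ω`. -/
lemma Mesh.VN_le_piecewiseC2 (hΩo : IsOpen Ω) (hΩ : interior (closure Ω) = Ω)
    {Ienr : Finset (Pt d)} {φ : Pt d → Pt d → ℝ} (hφ : ∀ p ∈ Ienr, ContDiff ℝ 2 (φ p))
    (h0 : ∀ p ∈ Ienr, ∀ x ∈ frontier Ω, T.enrBasis p (φ p) x = 0) :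
    T.VN Ienr φ ≤ T.piecewiseC2 := by
  refine sup_le (Submodule.span_le.2 ?_) (Submodule.span_le.2 ?_)
  · rintro v ⟨p, hp, hpf, rfl⟩
    exact T.hat_mem_piecewiseC2 hΩo hΩ hp (T.mem_domain_of_notMem_frontier hΩo hp hpf)
  · rintro v ⟨p, hp, rfl⟩
    exact T.enrBasis_mem_piecewiseC2 hΩo (hφ p hp) (h0 p hp)

end

section

variable {d : ℕ} {Ω : Set (Pt d)} {T : Mesh Ω} {K : Finset (Pt d)}

/-! ### The flux on an element -/

lemma toEuclideanLin_apply (A : Matrix (Fin d) (Fin d) ℝ) (ξ : Pt d) (i : Fin d) :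
    A.toEuclideanLin ξ i = ∑ j, A i j * ξ j := by
  simp [Matrix.toEuclideanLin, Matrix.toLpLin_apply, Matrix.mulVec, dotProduct]

lemma gradient_apply (g : Pt d → ℝ) (x : Pt d) (j : Fin d) :
    gradient g x j = fderiv ℝ g x (EuclideanSpace.single j 1) := by
  rw [← inner_gradient, EuclideanSpace.inner_single_right]
  simp

lemma nonempty_interior_cell (hK : IsSimplex K) : (interior (cell K)).Nonempty := by
  have := hK.basis.centroid_mem_interior_convexHull
  rw [show range hK.basis = (K : Set (Pt d)) from Subtype.range_coe] at this
  exact ⟨_, this⟩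

lemma uniqueDiffOn_cell (hK : IsSimplex K) : UniqueDiffOn ℝ (cell K) :=
  uniqueDiffOn_convex (convex_cell K) (nonempty_interior_cell hK)

lemma gradientWithin_eq (hK : IsSimplex K) {v g : Pt d → ℝ} (hg : ContDiff ℝ 2 g)
    (hvg : EqOn v g (cell K)) {x : Pt d} (hx : x ∈ cell K) :
    gradientWithin v (cell K) x = gradient g x := by
  rw [gradientWithin, fderivWithin_congr hvg (hvg hx),
    ((hg.differentiable two_ne_zero) x).fderivWithin ((uniqueDiffOn_cell hK) x hx)]
  rfl

lemma fderiv_eq_of_mem_interior {v g : Pt d → ℝ} (hvg : EqOn v g (cell K)) {x : Pt d}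
    (hx : x ∈ interior (cell K)) : fderiv ℝ v x = fderiv ℝ g x :=
  Filter.EventuallyEq.fderiv_eq
    (Filter.mem_of_superset (mem_interior_iff_mem_nhds.1 hx) fun _ hy => hvg hy)

lemma exists_lipschitzOnWith_sum {ι : Type*} (s : Finset ι) {t : Set (Pt d)}
    {f : ι → Pt d → ℝ} (h : ∀ i ∈ s, ∃ C : ℝ≥0, LipschitzOnWith C (f i) t) :
    ∃ C : ℝ≥0, LipschitzOnWith C (fun x => ∑ i ∈ s, f i x) t := by
  classical
  induction s using Finset.induction_on with
  | empty => exact ⟨0, by simp⟩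
  | insert i s hi ih =>
    obtain ⟨C, hC⟩ := ih fun j hj => h j (Finset.mem_insert_of_mem hj)
    obtain ⟨D, hD⟩ := h i (Finset.mem_insert_self i s)
    refine ⟨D + C, ?_⟩
    simp only [Finset.sum_insert hi]
    exact hD.add hC

variable {α β : ℝ} {a : Pt d → Matrix (Fin d) (Fin d) ℝ}

/-- On each element the components of the flux of a piecewise smooth function have Lipschitz
representatives, which give the flux at all points of `Ω` (on the boundary of `Ω` the coefficient
may take arbitrary values). -/
theorem exists_lipschitz_flux (hΩo : IsOpen Ω) (hΩ : interior (closure Ω) = Ω)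
    (ha : IsCoefficient Ω α β a) {v : Pt d → ℝ} (hv : v ∈ T.piecewiseC2) (hK : K ∈ T.elems) :
    ∃ (P : Fin d → Pt d → ℝ) (D : Fin d → ℝ≥0), (∀ i, LipschitzOnWith (D i) (P i) (cell K)) ∧
      (∀ x ∈ cell K, x ∈ Ω → ∀ i, flux a v K x i = P i x) ∧
      ∀ᵐ x ∂(volume.restrict (cell K)), divOn K (flux a v K) x =
        ∑ i, fderiv ℝ (P i) x (EuclideanSpace.single i 1) := by
  have hs := Mesh.isSimplex hK
  obtain ⟨g, hg, hvg⟩ := hv.2 K hK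
  have hint : interior (cell K) ⊆ Ω := T.interior_cell_subset hΩ hK
  have hA : ∀ i j, ∃ (A : Pt d → ℝ) (M : ℝ≥0), LipschitzWith M A ∧
      EqOn (fun x => a x i j) A (interior (cell K)) := fun i j => by
    obtain ⟨M, hM⟩ := (ha.memW1Inf i j).exists_lipschitzOnWith hΩo (ha.continuousOn i j)
    obtain ⟨A, h1, h2⟩ := (hM _ hint isOpen_interior (convex_cell K).interior).extend_real
    exact ⟨A, M, h1, h2⟩
  choose A M hA1 hA2 using hA
  -- by continuity the extensions agree with the coefficient on the part of the cell inside `Ω`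
  have hA3 : ∀ i j, ∀ x ∈ cell K, x ∈ Ω → a x i j = A i j x := by
    intro i j x hxK hxΩ
    have hcl : x ∈ closure (interior (cell K)) := by
      rw [(convex_cell K).closure_interior_eq_closure_of_nonempty_interior
        (nonempty_interior_cell hs)]
      exact subset_closure hxK
    have : (𝓝[interior (cell K)] x).NeBot := mem_closure_iff_nhdsWithin_neBot.1 hcl
    have h1 : Tendsto (fun x => a x i j) (𝓝[interior (cell K)] x) (𝓝 (a x i j)) :=
      ((ha.continuousOn i j).continuousAt (hΩo.mem_nhds hxΩ)).mono_left nhdsWithin_le_nhds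
    have h2 : Tendsto (A i j) (𝓝[interior (cell K)] x) (𝓝 (A i j x)) :=
      (hA1 i j).continuous.continuousAt.mono_left nhdsWithin_le_nhds
    refine tendsto_nhds_unique h1 (h2.congr' ?_)
    filter_upwards [self_mem_nhdsWithin] with y hy using (hA2 i j hy).symm
  have hder : ∀ j, ∃ C : ℝ≥0, LipschitzOnWith C
      (fun x => fderiv ℝ g x (EuclideanSpace.single j 1)) (cell K) := fun j =>
    exists_lipschitzOnWith_of_contDiff (isCompact_cell K) (convex_cell K)
      ((hg.fderiv_right (m := 1) (by norm_num)).clm_apply contDiff_const)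
  have hP : ∀ i, ∃ C : ℝ≥0, LipschitzOnWith C (fun x =>
      ∑ j, A i j x * fderiv ℝ g x (EuclideanSpace.single j 1)) (cell K) := fun i =>
    exists_lipschitzOnWith_sum _ fun j _ => by
      obtain ⟨C, hC⟩ := hder j
      exact exists_lipschitzOnWith_mul (isCompact_cell K) (hA1 i j).lipschitzOnWith hC
  choose D hD using hP
  have hflux : ∀ x ∈ cell K, x ∈ Ω → ∀ i, flux a v K x i =
      ∑ j, A i j x * fderiv ℝ g x (EuclideanSpace.single j 1) := by
    intro x hx hxΩ i
    rw [flux, gradientWithin_eq hs hg hvg hx, toEuclideanLin_apply]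
    exact Finset.sum_congr rfl fun j _ => by rw [hA3 i j x hx hxΩ, gradient_apply]
  refine ⟨_, D, hD, hflux, ?_⟩
  have hPd : ∀ᵐ x ∂(volume.restrict (cell K)), ∀ i, DifferentiableAt ℝ (fun x =>
      ∑ j, A i j x * fderiv ℝ g x (EuclideanSpace.single j 1)) x :=
    ae_all_iff.2 fun i => ae_differentiableAt_of_lipschitzOn (hD i)
  filter_upwards [hPd, ae_mem_interior_cell K] with x hx hxi
  set F : Pt d → Pt d := fun x => WithLp.toLp 2 fun i =>
    ∑ j, A i j x * fderiv ℝ g x (EuclideanSpace.single j 1) with hF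
  have hFd : DifferentiableAt ℝ F x := by
    rw [differentiableAt_euclidean]
    exact hx
  have hev : flux a v K =ᶠ[𝓝 x] F := by
    filter_upwards [isOpen_interior.mem_nhds hxi] with y hy
    ext i
    exact hflux y (interior_subset hy) (hint hy) i
  rw [divOn, fderivWithin_of_mem_nhds (mem_interior_iff_mem_nhds.1 hxi),
    Filter.EventuallyEq.fderiv_eq hev]
  refine Finset.sum_congr rfl fun i _ => ?_
  have h1 : HasFDerivAt (fun y => F y i) ((EuclideanSpace.proj i).comp (fderiv ℝ F x)) x :=
    ((EuclideanSpace.proj (𝕜 := ℝ) i).hasFDerivAt (x := F x)).comp x hFd.hasFDerivAt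
  have h2 : fderiv ℝ (fun y => F y i) x = _ := h1.fderiv
  have h3 : (fun y => F y i) = fun x => ∑ j, A i j x * fderiv ℝ g x (EuclideanSpace.single j 1) :=
    rfl
  rw [← h3, h2]
  rfl

end

section

variable {d : ℕ} {Ω : Set (Pt d)} {T : Mesh Ω} {K : Finset (Pt d)}

/-! ### Poincaré's inequality on balls -/

lemma lintegral_comp_affine_le {G : Pt d → ℝ≥0∞} (hG : Measurable G) (c : Pt d) {t : ℝ}
    (ht : 1 / 2 ≤ t) : ∫⁻ x, G (c + t • x) ≤ 2 ^ d * ∫⁻ x, G x := by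
  have ht0 : 0 < t := by linarith
  have h1 : ∫⁻ x, G (c + t • x) = ∫⁻ z, G (c + z) ∂(Measure.map (fun x : Pt d => t • x) volume) := by
    rw [lintegral_map (by fun_prop) (by fun_prop)]
  rw [h1, Measure.map_addHaar_smul _ ht0.ne', lintegral_smul_measure,
    lintegral_add_left_eq_self (fun z => G z) c, smul_eq_mul]
  gcongr
  rw [abs_of_pos (by positivity)]
  refine ENNReal.ofReal_le_of_le_toReal ?_
  rw [ENNReal.toReal_pow, ENNReal.toReal_ofNat, finrank_euclideanSpace_fin, ← inv_pow]
  gcongr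
  rw [inv_le_comm₀ ht0 two_pos]
  linarith

/-- Averaging a function over all segments with end points in `B`. The change of variables
replaces the end point nearer to the evaluation point, which has weight at least `1 / 2`. -/
lemma lintegral_segments_le {G : Pt d → ℝ≥0∞} (hG : Measurable G) (B : Set (Pt d)) :
    ∫⁻ x in B, ∫⁻ y in B, ∫⁻ t in Icc (0 : ℝ) 1, G (y + t • (x - y)) ≤
      2 ^ d * volume B * ∫⁻ x, G x := by
  have hm : Measurable fun z : (Pt d × Pt d) × ℝ => G (z.1.2 + z.2 • (z.1.1 - z.1.2)) := by
    fun_prop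
  -- bring the integral over `t` outside
  have hswap : ∫⁻ x in B, ∫⁻ y in B, ∫⁻ t in Icc (0 : ℝ) 1, G (y + t • (x - y)) =
      ∫⁻ t in Icc (0 : ℝ) 1, ∫⁻ x in B, ∫⁻ y in B, G (y + t • (x - y)) := by
    have h1 : ∀ x, ∫⁻ y in B, ∫⁻ t in Icc (0 : ℝ) 1, G (y + t • (x - y)) =
        ∫⁻ t in Icc (0 : ℝ) 1, ∫⁻ y in B, G (y + t • (x - y)) := fun x => by
      refine lintegral_lintegral_swap (Measurable.aemeasurable ?_)
      exact hm.comp ((measurable_const.prodMk measurable_fst).prodMk measurable_snd)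
    simp only [h1]
    refine lintegral_lintegral_swap (Measurable.aemeasurable ?_)
    have h2 : Measurable fun z : (Pt d × ℝ) × Pt d => G (z.2 + z.1.2 • (z.1.1 - z.2)) := by
      fun_prop
    exact h2.lintegral_prod_right'
  have hbound : ∀ t ∈ Icc (0 : ℝ) 1, ∫⁻ x in B, ∫⁻ y in B, G (y + t • (x - y)) ≤
      2 ^ d * volume B * ∫⁻ x, G x := by
    intro t ht
    have hconst : ∫⁻ _ in B, (2 ^ d * ∫⁻ x, G x) = 2 ^ d * volume B * ∫⁻ x, G x := by
      rw [setLIntegral_const]; ring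
    rw [← hconst]
    rcases le_total (1 / 2) t with h | h
    · have hs : ∫⁻ x in B, ∫⁻ y in B, G (y + t • (x - y)) =
          ∫⁻ y in B, ∫⁻ x in B, G (y + t • (x - y)) := by
        refine lintegral_lintegral_swap (Measurable.aemeasurable ?_)
        fun_prop
      rw [hs]
      refine lintegral_mono fun y => (setLIntegral_le_lintegral _ _).trans ?_
      have := lintegral_comp_affine_le hG (y - t • y) h
      refine le_trans (le_of_eq ?_) this
      refine lintegral_congr fun x => ?_
      congr 1; module
    · refine lintegral_mono fun x => (setLIntegral_le_lintegral _ _).trans ?_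
      have := lintegral_comp_affine_le hG (t • x) (t := 1 - t) (by linarith)
      refine le_trans (le_of_eq ?_) this
      refine lintegral_congr fun y => ?_
      congr 1; module
  rw [hswap]
  refine (setLIntegral_mono' measurableSet_Icc hbound).trans ?_
  rw [setLIntegral_const]
  simp

lemma sq_sub_le_integral {φ : Pt d → ℝ} (hφ : ContDiff ℝ 1 φ) (x y : Pt d) :
    (φ x - φ y) ^ 2 ≤ ‖x - y‖ ^ 2 * ∫ t in (0 : ℝ)..1, ‖fderiv ℝ φ (y + t • (x - y))‖ ^ 2 := by
  set k : ℝ → ℝ := fun t => fderiv ℝ φ (y + t • (x - y)) (x - y) with hk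
  have hfc : Continuous fun t : ℝ => fderiv ℝ φ (y + t • (x - y)) :=
    (hφ.continuous_fderiv one_ne_zero).comp (by fun_prop)
  have hkc : Continuous k := hfc.clm_apply continuous_const
  have hftc : ∫ t in (0 : ℝ)..1, k t = φ x - φ y := by
    have h1 : ∀ t ∈ uIcc (0 : ℝ) 1, HasDerivAt (fun t : ℝ => φ (y + t • (x - y))) (k t) t := by
      intro t _
      have h2 : HasDerivAt (fun t : ℝ => y + t • (x - y)) (x - y) t := by
        simpa using ((hasDerivAt_id t).smul_const (x - y)).const_add y
      exact ((hφ.differentiable one_ne_zero) _).hasFDerivAt.comp_hasDerivAt t h2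
    rw [intervalIntegral.integral_eq_sub_of_hasDerivAt h1 (hkc.intervalIntegrable _ _)]
    simp
  -- the variance of `k` is nonnegative
  have hvar : (∫ t in (0 : ℝ)..1, k t) ^ 2 ≤ ∫ t in (0 : ℝ)..1, k t ^ 2 := by
    set c := ∫ t in (0 : ℝ)..1, k t with hc
    have h0 : 0 ≤ ∫ t in (0 : ℝ)..1, (k t - c) ^ 2 :=
      intervalIntegral.integral_nonneg zero_le_one fun t _ => sq_nonneg _
    have h1 : ∫ t in (0 : ℝ)..1, (k t - c) ^ 2 = (∫ t in (0 : ℝ)..1, k t ^ 2) - c ^ 2 := by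
      have : ∀ t, (k t - c) ^ 2 = (k t ^ 2 - 2 * c * k t) + c ^ 2 := fun t => by ring
      simp only [this]
      rw [intervalIntegral.integral_add (Continuous.intervalIntegrable (by fun_prop) _ _)
        (by simp), intervalIntegral.integral_sub (Continuous.intervalIntegrable (by fun_prop) _ _)
        (Continuous.intervalIntegrable (by fun_prop) _ _), intervalIntegral.integral_const_mul,
        ← hc]
      simp
      ring
    linarith
  rw [← hftc]
  refine hvar.trans ?_
  rw [← intervalIntegral.integral_const_mul]
  refine intervalIntegral.integral_mono_on zero_le_one
    (Continuous.intervalIntegrable (by fun_prop) _ _)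
    (Continuous.intervalIntegrable (by fun_prop) _ _) fun t _ => ?_
  rw [← sq_abs, ← mul_pow, mul_comm]
  gcongr
  exact (fderiv ℝ φ _).le_opNorm _

/-- Poincaré's inequality on a ball, for the mean value `m`. -/
theorem integral_sub_average_sq_le {φ : Pt d → ℝ} (hφ : ContDiff ℝ 1 φ) (p : Pt d) {h : ℝ}
    (hh : 0 < h) :
    ∫ x in Metric.closedBall p h, (φ x - ⨍ y in Metric.closedBall p h, φ y) ^ 2 ≤
      2 ^ d * (2 * h) ^ 2 * ∫ x in Metric.closedBall p h, ‖fderiv ℝ φ x‖ ^ 2 := by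
  set B := Metric.closedBall p h with hB
  have hBc : IsCompact B := isCompact_closedBall p h
  have hBm : MeasurableSet B := hBc.isClosed.measurableSet
  have hBfin : volume B ≠ ⊤ := hBc.measure_lt_top.ne
  have hBpos : 0 < volume.real B := by
    rw [measureReal_def, ENNReal.toReal_pos_iff]
    exact ⟨Metric.measure_closedBall_pos volume p hh, hBc.measure_lt_top⟩
  have hφc := hφ.continuous
  have hfc : Continuous (fderiv ℝ φ) := hφ.continuous_fderiv one_ne_zero
  have hint : ∀ {g : Pt d → ℝ}, Continuous g → Integrable g (volume.restrict B) := fun hg =>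
    hg.continuousOn.integrableOn_compact hBc
  set m := ⨍ y in B, φ y with hm
  have hm' : ∫ y in B, φ y = volume.real B * m := by
    rw [hm, setAverage_eq, smul_eq_mul, mul_inv_cancel_left₀ hBpos.ne']
  have h1 : ∀ x, volume.real B * (φ x - m) ^ 2 ≤ ∫ y in B, (φ x - φ y) ^ 2 := by
    intro x
    have e1 : ∀ y, (φ x - φ y) ^ 2 = ((φ x - m) ^ 2 + (φ y - m) ^ 2) +
        (-(2 * (φ x - m))) * (φ y - m) := fun y => by ring
    have e2 : ∫ y in B, (φ y - m) = 0 := by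
      rw [integral_sub (hint hφc) (hint continuous_const), hm', setIntegral_const, smul_eq_mul,
        sub_self]
    simp only [e1]
    rw [integral_add (hint (by fun_prop)) (hint (by fun_prop)), integral_const_mul, e2, mul_zero,
      add_zero, integral_add (hint (by fun_prop)) (hint (by fun_prop)), setIntegral_const,
      smul_eq_mul]
    have : 0 ≤ ∫ y in B, (φ y - m) ^ 2 := integral_nonneg fun y => sq_nonneg _
    linarith
  set G : Pt d → ℝ≥0∞ := B.indicator fun x => ENNReal.ofReal (‖fderiv ℝ φ x‖ ^ 2) with hG
  have hGm : Measurable G := Measurable.indicator (by fun_prop) hBm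
  have h2 : ∀ x ∈ B, ∀ y ∈ B, ENNReal.ofReal ((φ x - φ y) ^ 2) ≤
      ENNReal.ofReal ((2 * h) ^ 2) * ∫⁻ t in Icc (0 : ℝ) 1, G (y + t • (x - y)) := by
    intro x hx y hy
    have hc : Continuous fun t : ℝ => ‖fderiv ℝ φ (y + t • (x - y))‖ ^ 2 :=
      ((hfc.comp (by fun_prop : Continuous fun t : ℝ => y + t • (x - y))).norm.pow 2)
    have e1 : ∫⁻ t in Icc (0 : ℝ) 1, G (y + t • (x - y)) =
        ENNReal.ofReal (∫ t in (0 : ℝ)..1, ‖fderiv ℝ φ (y + t • (x - y))‖ ^ 2) := by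
      rw [intervalIntegral.integral_of_le zero_le_one, ← integral_Icc_eq_integral_Ioc,
        ofReal_integral_eq_lintegral_ofReal (hc.continuousOn.integrableOn_compact isCompact_Icc)
        (Eventually.of_forall fun t => by positivity)]
      refine setLIntegral_congr_fun measurableSet_Icc fun t ht => ?_
      have hmem : y + t • (x - y) ∈ B := by
        have := (convex_closedBall p h) hy hx (a := 1 - t) (b := t) (by linarith [ht.2]) ht.1
          (by ring)
        convert this using 1
        module
      simp only [hG, indicator_of_mem hmem]
    rw [e1, ← ENNReal.ofReal_mul (by positivity)]
    refine ENNReal.ofReal_le_ofReal ((sq_sub_le_integral hφ x y).trans ?_)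
    have hxy : ‖x - y‖ ≤ 2 * h := by
      rw [← dist_eq_norm]
      have h3 := dist_triangle_right x y p
      have h4 := Metric.mem_closedBall.1 hx
      have h5 := Metric.mem_closedBall.1 hy
      linarith
    gcongr
    exact intervalIntegral.integral_nonneg zero_le_one fun t _ => by positivity
  have h3 : ENNReal.ofReal (∫ x in B, volume.real B * (φ x - m) ^ 2) ≤
      ENNReal.ofReal ((2 * h) ^ 2) * (2 ^ d * volume B * ∫⁻ x, G x) := by
    rw [ofReal_integral_eq_lintegral_ofReal (hint (by fun_prop))
      (Eventually.of_forall fun x => by positivity)]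
    refine le_trans ?_ (mul_le_mul_right (lintegral_segments_le hGm B) _)
    rw [← lintegral_const_mul' _ _ ENNReal.ofReal_ne_top]
    refine setLIntegral_mono' hBm fun x hx => ?_
    rw [← lintegral_const_mul' _ _ ENNReal.ofReal_ne_top]
    refine (ENNReal.ofReal_le_ofReal (h1 x)).trans ?_
    rw [ofReal_integral_eq_lintegral_ofReal (hint (by fun_prop))
      (Eventually.of_forall fun x => by positivity)]
    exact setLIntegral_mono' hBm fun y hy => h2 x hx y hy
  have h4 : ∫⁻ x, G x = ENNReal.ofReal (∫ x in B, ‖fderiv ℝ φ x‖ ^ 2) := by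
    rw [ofReal_integral_eq_lintegral_ofReal (hint (by fun_prop))
      (Eventually.of_forall fun x => by positivity), hG, lintegral_indicator hBm]
  rw [h4, ← ENNReal.ofReal_toReal hBfin, ← measureReal_def,
    show (2 : ℝ≥0∞) ^ d = ENNReal.ofReal (2 ^ d) by
      rw [ENNReal.ofReal_pow two_pos.le, ENNReal.ofReal_ofNat],
    ← ENNReal.ofReal_mul (by positivity), ← ENNReal.ofReal_mul (by positivity),
    ← ENNReal.ofReal_mul (by positivity), ENNReal.ofReal_le_ofReal_iff (mul_nonneg (by positivity)
      (mul_nonneg (by positivity) (integral_nonneg fun x => by positivity))),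
    integral_const_mul] at h3
  have h5 : volume.real B * ∫ x in B, (φ x - m) ^ 2 ≤ volume.real B *
      (2 ^ d * (2 * h) ^ 2 * ∫ x in B, ‖fderiv ℝ φ x‖ ^ 2) := by
    refine h3.trans (le_of_eq ?_)
    ring
  exact le_of_mul_le_mul_left h5 hBpos

end

section

variable {d : ℕ} {Ω : Set (Pt d)} {T : Mesh Ω} {K : Finset (Pt d)} {κ h : ℝ}

/-! ### Mesh size and Friedrichs inequalities at the nodes -/

/-- All elements have diameter at most `h` and contain a ball of radius `h / κ`. -/
structure Mesh.HasSize (T : Mesh Ω) (κ h : ℝ) : Prop where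
  size_pos : 0 < h
  ratio_pos : 0 < κ
  diam_le : ∀ K ∈ T.elems, Metric.diam (cell K) ≤ h
  exists_ball : ∀ K ∈ T.elems, ∃ c, Metric.closedBall c (h / κ) ⊆ cell K

lemma le_diam_cell (hd : 1 ≤ d) {c : Pt d} {r : ℝ} (hr : 0 < r)
    (hc : Metric.closedBall c r ⊆ cell K) : r ≤ Metric.diam (cell K) := by
  have e : ‖(EuclideanSpace.single (⟨0, hd⟩ : Fin d) r : Pt d)‖ = r := by
    simp [abs_of_pos hr]
  have h1 : c + EuclideanSpace.single (⟨0, hd⟩ : Fin d) r ∈ cell K := hc (by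
    rw [Metric.mem_closedBall, dist_eq_norm, add_sub_cancel_left, e])
  have h2 : c ∈ cell K := hc (Metric.mem_closedBall_self hr.le)
  have := Metric.dist_le_diam_of_mem (isCompact_cell K).isBounded h1 h2
  rwa [dist_eq_norm, add_sub_cancel_left, e] at this

/-- The size is the largest diameter of an element. -/
lemma Mesh.QuasiUniform.exists_hasSize (hd : 1 ≤ d) (hne : Ω.Nonempty) (hq : T.QuasiUniform κ) :
    ∃ h, T.HasSize κ h := by
  have hTne : T.elems.Nonempty := by
    obtain ⟨x, hx⟩ := hne
    obtain ⟨K, hK, -⟩ := (T.mem_closure_iff x).1 (subset_closure hx)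
    exact ⟨K, hK⟩
  obtain ⟨K₀, hK₀, hmax⟩ := T.elems.exists_max_image (fun K => Metric.diam (cell K)) hTne
  have hpos : 0 < Metric.diam (cell K₀) := by
    obtain ⟨c, r, hr, hc, -⟩ := hq K₀ hK₀
    exact hr.trans_le (le_diam_cell hd hr hc)
  have hκ : 0 < κ := by
    obtain ⟨c, r, hr, -, h1⟩ := hq K₀ hK₀
    exact pos_of_mul_pos_left (hpos.trans_le (h1 K₀ hK₀)) hr.le
  refine ⟨Metric.diam (cell K₀), hpos, hκ, hmax, fun K hK => ?_⟩
  obtain ⟨c, r, hr, hc, h1⟩ := hq K hK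
  refine ⟨c, (Metric.closedBall_subset_closedBall ?_).trans hc⟩
  rw [div_le_iff₀ hκ, mul_comm]
  exact h1 K₀ hK₀

namespace Mesh.HasSize

lemma norm_baryGrad_le (hT : T.HasSize κ h) (hK : K ∈ T.elems) (p : Pt d) :
    ‖baryGrad K p‖ ≤ κ / (2 * h) := by
  obtain ⟨c, hc⟩ := hT.exists_ball K hK
  refine (NEFEM.norm_baryGrad_le (Mesh.isSimplex hK) (div_pos hT.size_pos hT.ratio_pos) hc
    p).trans_eq ?_
  have := hT.size_pos
  have := hT.ratio_pos
  field_simp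

lemma norm_sub_le (hT : T.HasSize κ h) (hK : K ∈ T.elems) {x y : Pt d} (hx : x ∈ cell K)
    (hy : y ∈ cell K) : ‖x - y‖ ≤ h := by
  rw [← dist_eq_norm]
  exact (Metric.dist_le_diam_of_mem (isCompact_cell K).isBounded hx hy).trans (hT.diam_le K hK)

lemma cell_subset_closedBall (hT : T.HasSize κ h) (hK : K ∈ T.elems) {p : Pt d}
    (hp : p ∈ K) : cell K ⊆ Metric.closedBall p h := fun x hx => by
  rw [Metric.mem_closedBall, dist_eq_norm]
  exact hT.norm_sub_le hK hx (mem_cell_of_mem hp)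

lemma volume_closedBall_le (hT : T.HasSize κ h) (hK : K ∈ T.elems) (p : Pt d) {t : ℝ}
    (ht : 0 ≤ t) :
    volume.real (Metric.closedBall p (t * h)) ≤ (t * κ) ^ d * volume.real (cell K) := by
  obtain ⟨c, hc⟩ := hT.exists_ball K hK
  have hh := hT.size_pos
  have hκ := hT.ratio_pos
  have h1 : volume.real (Metric.closedBall c (h / κ)) ≤ volume.real (cell K) :=
    measureReal_mono hc (isCompact_cell K).measure_lt_top.ne
  refine le_trans (le_of_eq ?_) (mul_le_mul_of_nonneg_left h1 (by positivity))
  rw [measureReal_def, measureReal_def, Measure.addHaar_closedBall _ _ (by positivity),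
    Measure.addHaar_closedBall _ _ (by positivity), ENNReal.toReal_mul, ENNReal.toReal_mul,
    ENNReal.toReal_ofReal (by positivity), ENNReal.toReal_ofReal (by positivity),
    finrank_euclideanSpace_fin, ← mul_assoc, ← mul_pow]
  congr 2
  field_simp

end Mesh.HasSize

/-- The constant in the Poincaré and Friedrichs inequalities on the balls around the nodes. -/
def nodeConst (d : ℕ) (κ : ℝ) : ℝ := 8 * 2 ^ d + 2 * κ ^ d * (4 * (d + 1) * 2 ^ d + 1)

open Classical in
/-- The value at the node `p` of the quasi-interpolant: the average of `φ` over the ball of radius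
`h` for interior nodes, `0` for boundary nodes. -/
def nodeValue (Ω : Set (Pt d)) (h : ℝ) (φ : Pt d → ℝ) (p : Pt d) : ℝ :=
  if p ∈ Ω then ⨍ y in Metric.closedBall p h, φ y else 0

lemma integrableOn_sub_sq {φ : Pt d → ℝ} (hφ : Continuous φ) (c : ℝ) {s : Set (Pt d)}
    (hs : IsCompact s) : IntegrableOn (fun x => (φ x - c) ^ 2) s :=
  (Continuous.continuousOn (by fun_prop)).integrableOn_compact hs

lemma integrableOn_norm_fderiv_sq {φ : Pt d → ℝ} (hφ : ContDiff ℝ 1 φ) {s : Set (Pt d)}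
    (hs : IsCompact s) : IntegrableOn (fun x => ‖fderiv ℝ φ x‖ ^ 2) s := by
  have := hφ.continuous_fderiv one_ne_zero
  exact (Continuous.continuousOn (by fun_prop)).integrableOn_compact hs

/-- Friedrichs' inequality on the ball around a boundary node. The node lies on a boundary facet of
an element inside the ball, where `φ` vanishes; the trace inequality on that element bounds the
average of `φ`. -/
lemma Mesh.HasSize.integral_sq_le_of_notMem (hT : T.HasSize κ h) (hd : 2 ≤ d) (hΩo : IsOpen Ω)
    (hΩ : interior (closure Ω) = Ω) {φ : Pt d → ℝ} (hφ : ContDiff ℝ 1 φ)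
    (h0 : ∀ x ∉ Ω, φ x = 0) {p : Pt d} (hp : p ∈ T.nodes) (hpΩ : p ∉ Ω) :
    ∫ x in Metric.closedBall p h, φ x ^ 2 ≤
      nodeConst d κ * h ^ 2 * ∫ x in Metric.closedBall p h, ‖fderiv ℝ φ x‖ ^ 2 := by
  obtain ⟨K, hK, q, hq, hpK, -, hbd⟩ := T.exists_boundary_facet hd hΩo hΩ hp hpΩ
  have hd1 : 1 ≤ d := by omega
  have hs := Mesh.isSimplex hK
  have hh := hT.size_pos
  have hκ := hT.ratio_pos
  have hsub := hT.cell_subset_closedBall hK hpK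
  set B := Metric.closedBall p h with hB
  have hBc : IsCompact B := isCompact_closedBall p h
  set G := ∫ x in B, ‖fderiv ℝ φ x‖ ^ 2 with hG
  set m := ⨍ y in B, φ y with hm
  have hG0 : 0 ≤ G := integral_nonneg fun x => by positivity
  have hP : ∫ x in B, (φ x - m) ^ 2 ≤ 2 ^ d * (2 * h) ^ 2 * G :=
    integral_sub_average_sq_le hφ p hh
  have hψ : ContDiff ℝ 1 fun x => φ x - m := hφ.sub contDiff_const
  obtain ⟨C, hC⟩ := exists_lipschitzOnWith_of_contDiff (isCompact_cell K) (convex_cell K) hψ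
  have htr := integral_facet_sq_le hd1 hs hq hC (h := h)
    fun x hx => hT.norm_sub_le hK hx (mem_cell_of_mem hq)
  have hfac : ∫ y, (φ y - m) ^ 2 ∂(facetMeasure (K.erase q)) =
      m ^ 2 * (‖baryGrad K q‖ * (d * volume.real (cell K))) := by
    rw [← facetMeasure_univ hd1 hs hq]
    have : (fun y => (φ y - m) ^ 2) =ᵐ[facetMeasure (K.erase q)] fun _ => m ^ 2 := by
      filter_upwards [ae_facetMeasure_bary_pos hd1 hs hq,
        (ae_restrict_mem (measurableSet_cell _) :
          ∀ᵐ y ∂(facetMeasure (K.erase q)), y ∈ cell (K.erase q))] with y hy hyc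
      rw [h0 y (hbd y ⟨((hs.mem_facet_iff hq y).1 hyc).2, hy⟩)]
      ring
    rw [integral_congr_ae this, integral_const, smul_eq_mul, mul_comm]
  have hg : 0 < ‖baryGrad K q‖ := norm_pos_iff.2 (baryGrad_ne_zero hd1 hs hq)
  rw [hfac] at htr
  have e1 : ‖baryGrad K q‖⁻¹ * (m ^ 2 * (‖baryGrad K q‖ * (d * volume.real (cell K)))) =
      d * (m ^ 2 * volume.real (cell K)) := by field_simp
  have e2 : ∫ x in cell K, (φ x - m) ^ 2 ≤ 2 ^ d * (2 * h) ^ 2 * G :=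
    (setIntegral_mono_set (integrableOn_sub_sq hφ.continuous m hBc)
      (ae_of_all _ fun x => by positivity) hsub.eventuallyLE).trans hP
  have e3 : ∫ x in cell K, ‖fderiv ℝ (fun x => φ x - m) x‖ ^ 2 ≤ G := by
    simp only [fderiv_sub_const]
    exact setIntegral_mono_set (integrableOn_norm_fderiv_sq hφ hBc)
      (ae_of_all _ fun x => by positivity) hsub.eventuallyLE
  have hvol : volume.real B ≤ κ ^ d * volume.real (cell K) := by
    have := hT.volume_closedBall_le hK p zero_le_one
    rwa [one_mul, one_mul] at this
  have hd1' : (1 : ℝ) ≤ d := by exact_mod_cast hd1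
  have hmK : m ^ 2 * volume.real (cell K) ≤ (4 * (d + 1) * 2 ^ d + 1) * h ^ 2 * G := by
    rw [e1] at htr
    have hnn : 0 ≤ m ^ 2 * volume.real (cell K) := by positivity
    calc m ^ 2 * volume.real (cell K) ≤ d * (m ^ 2 * volume.real (cell K)) :=
          le_mul_of_one_le_left hnn hd1'
      _ ≤ _ := htr
      _ ≤ (d + 1) * (2 ^ d * (2 * h) ^ 2 * G) + h ^ 2 * G := by gcongr
      _ = _ := by ring
  have hmB : m ^ 2 * volume.real B ≤ κ ^ d * ((4 * (d + 1) * 2 ^ d + 1) * h ^ 2 * G) :=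
    calc m ^ 2 * volume.real B ≤ m ^ 2 * (κ ^ d * volume.real (cell K)) := by gcongr
      _ = κ ^ d * (m ^ 2 * volume.real (cell K)) := by ring
      _ ≤ _ := by gcongr
  have hsplit : ∫ x in B, φ x ^ 2 ≤ ∫ x in B, (2 * (φ x - m) ^ 2 + 2 * m ^ 2) := by
    refine integral_mono ?_ ?_ fun x => ?_
    · have := integrableOn_sub_sq hφ.continuous 0 hBc
      simp only [sub_zero] at this
      exact this
    · exact ((integrableOn_sub_sq hφ.continuous m hBc).const_mul 2).add
        (integrableOn_const hBc.measure_lt_top.ne)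
    · simp only
      nlinarith [sq_nonneg (φ x - 2 * m)]
  rw [integral_add ((integrableOn_sub_sq hφ.continuous m hBc).const_mul 2)
    (integrableOn_const hBc.measure_lt_top.ne), integral_const_mul, setIntegral_const,
    smul_eq_mul] at hsplit
  calc _ ≤ _ := hsplit
    _ ≤ 2 * (2 ^ d * (2 * h) ^ 2 * G) +
        2 * (κ ^ d * ((4 * (d + 1) * 2 ^ d + 1) * h ^ 2 * G)) := by linarith
    _ = _ := by rw [nodeConst]; ring

/-- Poincaré's inequality at interior nodes and Friedrichs' inequality at boundary nodes. -/
lemma Mesh.HasSize.integral_sub_nodeValue_sq_le (hT : T.HasSize κ h) (hd : 2 ≤ d)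
    (hΩo : IsOpen Ω) (hΩ : interior (closure Ω) = Ω) {φ : Pt d → ℝ} (hφ : ContDiff ℝ 1 φ)
    (h0 : ∀ x ∉ Ω, φ x = 0) {p : Pt d} (hp : p ∈ T.nodes) :
    ∫ x in Metric.closedBall p h, (φ x - nodeValue Ω h φ p) ^ 2 ≤
      nodeConst d κ * h ^ 2 * ∫ x in Metric.closedBall p h, ‖fderiv ℝ φ x‖ ^ 2 := by
  by_cases hpΩ : p ∈ Ω
  · rw [nodeValue, if_pos hpΩ]
    refine (integral_sub_average_sq_le hφ p hT.size_pos).trans ?_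
    refine mul_le_mul_of_nonneg_right ?_ (integral_nonneg fun x => by positivity)
    have := hT.ratio_pos
    have h1 : 0 ≤ 2 * κ ^ d * (4 * (d + 1) * 2 ^ d + 1) * h ^ 2 := by positivity
    have h2 : 0 ≤ 2 ^ d * h ^ 2 := by positivity
    rw [nodeConst]
    linarith
  · simpa [nodeValue, hpΩ] using hT.integral_sq_le_of_notMem hd hΩo hΩ hφ h0 hp hpΩ

/-- Boundedly many node balls of elements overlap, since the elements have disjoint interiors and
comparable volumes. -/
lemma Mesh.HasSize.sum_indicator_le (hT : T.HasSize κ h) (x : Pt d) :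
    ∑ K ∈ T.elems, ∑ p ∈ K, (Metric.closedBall p h).indicator (fun _ => (1 : ℝ)) x ≤
      (d + 1) * (2 * κ) ^ d := by
  classical
  have hh := hT.size_pos
  have hκ := hT.ratio_pos
  set S := T.elems.filter fun K => cell K ⊆ Metric.closedBall x (2 * h) with hS
  have h1 : ∑ K ∈ T.elems, ∑ p ∈ K, (Metric.closedBall p h).indicator (fun _ => (1 : ℝ)) x ≤
      ∑ K ∈ T.elems, if cell K ⊆ Metric.closedBall x (2 * h) then ((d : ℝ) + 1) else 0 := by
    refine Finset.sum_le_sum fun K hK => ?_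
    split_ifs with hsub
    · have : ∑ p ∈ K, (Metric.closedBall p h).indicator (fun _ => (1 : ℝ)) x ≤ ∑ p ∈ K, 1 :=
        Finset.sum_le_sum fun p _ => Set.indicator_le_self' (fun _ _ => zero_le_one) x
      refine this.trans_eq ?_
      rw [Finset.sum_const, T.card_eq K hK]
      simp
    · refine (Finset.sum_eq_zero fun p hp => Set.indicator_of_notMem (fun hx => hsub ?_) _).le
      intro y hy
      have h2 := hT.norm_sub_le hK hy (mem_cell_of_mem hp)
      rw [Metric.mem_closedBall] at hx ⊢
      rw [← dist_eq_norm] at h2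
      linarith [dist_triangle y p x, dist_comm x p]
  rw [← Finset.sum_filter, Finset.sum_const, nsmul_eq_mul] at h1
  refine h1.trans ?_
  have hV : 0 < volume.real (Metric.closedBall x (2 * h)) :=
    ENNReal.toReal_pos (Metric.measure_closedBall_pos volume x (by positivity)).ne'
      (isCompact_closedBall x _).measure_lt_top.ne
  have hdisj : ∑ K ∈ S, volume.real (interior (cell K)) ≤
      volume.real (Metric.closedBall x (2 * h)) := by
    rw [← measureReal_biUnion_finset ?_ (fun _ _ => isOpen_interior.measurableSet)
      fun K _ => ((measure_mono interior_subset).trans_lt (isCompact_cell K).measure_lt_top).ne]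
    · refine measureReal_mono (iUnion₂_subset fun K hK => interior_subset.trans
        (Finset.mem_filter.1 hK).2) (isCompact_closedBall x _).measure_lt_top.ne
    · intro K hK K' hK' hne
      exact (T.disjoint_interior (Finset.mem_filter.1 hK).1 (Finset.mem_filter.1 hK').1
        hne).mono_right interior_subset
  have hint : ∀ K : Finset (Pt d), volume.real (interior (cell K)) = volume.real (cell K) := fun K =>
    measureReal_congr ((ae_eq_set.2 ⟨by simp [sdiff_eq_empty.2 interior_subset],
      volume_cell_diff_interior K⟩))
  have hcard : (S.card : ℝ) * volume.real (Metric.closedBall x (2 * h)) ≤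
      (2 * κ) ^ d * volume.real (Metric.closedBall x (2 * h)) := by
    calc (S.card : ℝ) * volume.real (Metric.closedBall x (2 * h))
        = ∑ K ∈ S, volume.real (Metric.closedBall x (2 * h)) := by
          rw [Finset.sum_const, nsmul_eq_mul]
      _ ≤ ∑ K ∈ S, (2 * κ) ^ d * volume.real (interior (cell K)) :=
          Finset.sum_le_sum fun K hK => by
            rw [hint]
            exact hT.volume_closedBall_le (Finset.mem_filter.1 hK).1 x zero_le_two
      _ = (2 * κ) ^ d * ∑ K ∈ S, volume.real (interior (cell K)) := by rw [Finset.mul_sum]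
      _ ≤ _ := by gcongr
  have := le_of_mul_le_mul_right hcard hV
  rw [mul_comm]
  exact mul_le_mul_of_nonneg_left this (by positivity)

lemma Mesh.HasSize.sum_integral_closedBall_le (hT : T.HasSize κ h) {G : Pt d → ℝ}
    (hG : Integrable G volume) (hG0 : ∀ x, 0 ≤ G x) :
    ∑ K ∈ T.elems, ∑ p ∈ K, ∫ x in Metric.closedBall p h, G x ≤
      (d + 1) * (2 * κ) ^ d * ∫ x, G x := by
  have hi : ∀ p : Pt d, Integrable ((Metric.closedBall p h).indicator G) volume := fun p =>
    hG.indicator Metric.isClosed_closedBall.measurableSet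
  simp_rw [← integral_indicator (Metric.isClosed_closedBall.measurableSet)]
  simp_rw [← integral_finsetSum _ fun p _ => hi p]
  rw [← integral_finsetSum _ fun K _ => integrable_finsetSum _ fun p _ => hi p,
    ← integral_const_mul]
  refine integral_mono (integrable_finsetSum _ fun K _ => integrable_finsetSum _ fun p _ => hi p)
    (hG.const_mul _) fun x => ?_
  have e : ∀ p : Pt d, (Metric.closedBall p h).indicator G x =
      (Metric.closedBall p h).indicator (fun _ => (1 : ℝ)) x * G x := fun p => by
    by_cases hx : x ∈ Metric.closedBall p h <;> simp [hx]
  simp_rw [e, ← Finset.sum_mul]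
  exact mul_le_mul_of_nonneg_right (hT.sum_indicator_le x) (hG0 x)

end

section

variable {d : ℕ} {Ω : Set (Pt d)} {T : Mesh Ω} {K : Finset (Pt d)} {κ h : ℝ}

/-! ### The quasi-interpolation error -/

lemma nodeConst_pos (hκ : 0 < κ) : 0 < nodeConst d κ := by rw [nodeConst]; positivity

/-- The quasi-interpolant of `φ` in the linear finite element space. -/
def Mesh.quasiInterp (T : Mesh Ω) (h : ℝ) (φ : Pt d → ℝ) : Pt d → ℝ :=
  ∑ p ∈ T.nodes, nodeValue Ω h φ p • T.hat p

lemma Mesh.quasiInterp_mem_VFEM (hΩo : IsOpen Ω) (φ : Pt d → ℝ) :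
    T.quasiInterp h φ ∈ T.VFEM := by
  refine Submodule.sum_mem _ fun p hp => ?_
  by_cases hpΩ : p ∈ Ω
  · refine Submodule.smul_mem _ _ (Submodule.subset_span ⟨p, hp, ?_, rfl⟩)
    rw [hΩo.frontier_eq]
    exact fun hx => hx.2 hpΩ
  · simp [nodeValue, hpΩ]

lemma Mesh.quasiInterp_mem_piecewiseC2 (hΩo : IsOpen Ω) (hΩ : interior (closure Ω) = Ω)
    (φ : Pt d → ℝ) : T.quasiInterp h φ ∈ T.piecewiseC2 := by
  refine Submodule.sum_mem _ fun p hp => ?_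
  by_cases hpΩ : p ∈ Ω
  · exact Submodule.smul_mem _ _ (T.hat_mem_piecewiseC2 hΩo hΩ hp hpΩ)
  · simp [nodeValue, hpΩ]

lemma Mesh.quasiInterp_eq (hK : K ∈ T.elems) (φ : Pt d → ℝ) {x : Pt d} (hx : x ∈ cell K) :
    T.quasiInterp h φ x = ∑ p ∈ K, nodeValue Ω h φ p * bary K p x := by
  rw [quasiInterp, Finset.sum_apply]
  refine (Finset.sum_congr rfl fun p _ => ?_).trans
    (Finset.sum_subset (fun p hp => T.mem_nodes hK hp) fun p _ hp => ?_).symm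
  · rw [Pi.smul_apply, T.hat_eq_bary hK hx, smul_eq_mul]
  · rw [bary_of_notMem hp, mul_zero]

/-- The Dirichlet energies of `φ` on the balls around the vertices of `K`, added up. -/
def patchEnergy (h : ℝ) (φ : Pt d → ℝ) (K : Finset (Pt d)) : ℝ :=
  ∑ p ∈ K, ∫ x in Metric.closedBall p h, ‖fderiv ℝ φ x‖ ^ 2

lemma patchEnergy_nonneg (h : ℝ) (φ : Pt d → ℝ) (K : Finset (Pt d)) : 0 ≤ patchEnergy h φ K :=
  Finset.sum_nonneg fun _ _ => integral_nonneg fun _ => by positivity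

lemma IsSimplex.sub_sum_bary_eq (hK : IsSimplex K) (φ : Pt d → ℝ) (c : Pt d → ℝ) (x : Pt d) :
    φ x - ∑ p ∈ K, c p * bary K p x = ∑ p ∈ K, bary K p x * (φ x - c p) := by
  simp_rw [mul_sub, Finset.sum_sub_distrib, ← Finset.sum_mul, hK.sum_bary, one_mul]
  congr 1
  exact Finset.sum_congr rfl fun p _ => mul_comm _ _

lemma IsSimplex.sub_sum_bary_sq_le (hK : IsSimplex K) (φ : Pt d → ℝ) (c : Pt d → ℝ) {x : Pt d}
    (hx : x ∈ cell K) :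
    (φ x - ∑ p ∈ K, c p * bary K p x) ^ 2 ≤ ∑ p ∈ K, (φ x - c p) ^ 2 := by
  rw [hK.sub_sum_bary_eq]
  refine (Finset.sum_mul_sq_le_sq_mul_sq _ _ _).trans
    (mul_le_of_le_one_left (Finset.sum_nonneg fun _ _ => sq_nonneg _) ?_)
  rw [← hK.sum_bary x]
  refine Finset.sum_le_sum fun p _ => ?_
  rw [sq]
  exact mul_le_of_le_one_left (bary_nonneg hK hx p) (bary_le_one hK hx p)

/-- Since the gradients of the barycentric coordinates sum to zero, the interpolation error has a
derivative that involves only `φ` minus its nodal values. -/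
lemma IsSimplex.fderiv_sub_sum_bary (hK : IsSimplex K) {φ : Pt d → ℝ} (hφ : ContDiff ℝ 1 φ)
    (c : Pt d → ℝ) (x : Pt d) :
    fderiv ℝ (fun x => φ x - ∑ p ∈ K, c p * bary K p x) x =
      fderiv ℝ φ x + ∑ p ∈ K, (φ x - c p) • innerSL ℝ (baryGrad K p) := by
  have h1 : HasFDerivAt (fun x => ∑ p ∈ K, c p * bary K p x)
      (∑ p ∈ K, c p • innerSL ℝ (baryGrad K p)) x :=
    HasFDerivAt.fun_sum fun p _ => (hK.hasFDerivAt_bary p x).const_mul (c p)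
  have h2 : HasFDerivAt φ (fderiv ℝ φ x) x :=
    (hφ.differentiable one_ne_zero x).hasFDerivAt
  rw [(h2.fun_sub h1).fderiv, sub_eq_add_neg]
  congr 1
  simp_rw [sub_smul, Finset.sum_sub_distrib, ← Finset.smul_sum]
  rw [← map_sum, hK.sum_baryGrad, map_zero, smul_zero, zero_sub]

lemma Mesh.HasSize.norm_fderiv_sub_sum_bary_sq_le (hT : T.HasSize κ h) (hK : K ∈ T.elems)
    {φ : Pt d → ℝ} (hφ : ContDiff ℝ 1 φ) (c : Pt d → ℝ) (x : Pt d) :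
    ‖fderiv ℝ (fun x => φ x - ∑ p ∈ K, c p * bary K p x) x‖ ^ 2 ≤
      2 * ‖fderiv ℝ φ x‖ ^ 2 +
        κ ^ 2 * (d + 1) / (2 * h ^ 2) * ∑ p ∈ K, (φ x - c p) ^ 2 := by
  have hs := Mesh.isSimplex hK
  have hh := hT.size_pos
  rw [hs.fderiv_sub_sum_bary hφ]
  have h1 : ‖∑ p ∈ K, (φ x - c p) • innerSL ℝ (baryGrad K p)‖ ≤
      ∑ p ∈ K, |φ x - c p| * (κ / (2 * h)) := by
    refine norm_sum_le_of_le _ fun p _ => ?_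
    rw [norm_smul, innerSL_apply_norm, Real.norm_eq_abs]
    exact mul_le_mul_of_nonneg_left (hT.norm_baryGrad_le hK p) (abs_nonneg _)
  have h2 : (∑ p ∈ K, |φ x - c p| * (κ / (2 * h))) ^ 2 ≤
      (∑ p ∈ K, (φ x - c p) ^ 2) * ((d + 1) * (κ / (2 * h)) ^ 2) := by
    refine (Finset.sum_mul_sq_le_sq_mul_sq _ _ _).trans_eq ?_
    simp [hs.card_eq]
  calc _ ≤ (‖fderiv ℝ φ x‖ + ∑ p ∈ K, |φ x - c p| * (κ / (2 * h))) ^ 2 := by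
        gcongr
        exact (norm_add_le _ _).trans (by gcongr)
    _ ≤ 2 * (‖fderiv ℝ φ x‖ ^ 2 + (∑ p ∈ K, |φ x - c p| * (κ / (2 * h))) ^ 2) := add_sq_le
    _ ≤ 2 * (‖fderiv ℝ φ x‖ ^ 2 + (∑ p ∈ K, (φ x - c p) ^ 2) * ((d + 1) * (κ / (2 * h)) ^ 2)) := by
        gcongr
    _ = _ := by field_simp

/-- The constant in the local estimates for the quasi-interpolation error. -/
def interpConst (d : ℕ) (κ : ℝ) : ℝ :=
  nodeConst d κ + κ / 2 * ((d + 1) * nodeConst d κ + (2 + κ ^ 2 * (d + 1) / 2 * nodeConst d κ))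

lemma interpConst_pos (hκ : 0 < κ) : 0 < interpConst d κ := by
  have := nodeConst_pos (d := d) hκ
  rw [interpConst]
  positivity

section

variable (hT : T.HasSize κ h) (hd : 2 ≤ d) (hΩo : IsOpen Ω) (hΩ : interior (closure Ω) = Ω)
  {φ : Pt d → ℝ} (hφ : ContDiff ℝ 1 φ) (h0 : ∀ x ∉ Ω, φ x = 0)

include hT hd hΩo hΩ hφ h0

lemma Mesh.HasSize.sum_integral_sub_nodeValue_sq_le (hK : K ∈ T.elems) :
    ∑ p ∈ K, ∫ x in cell K, (φ x - nodeValue Ω h φ p) ^ 2 ≤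
      nodeConst d κ * h ^ 2 * patchEnergy h φ K := by
  rw [patchEnergy, Finset.mul_sum]
  refine Finset.sum_le_sum fun p hp => ?_
  exact (setIntegral_mono_set (integrableOn_sub_sq hφ.continuous _ (isCompact_closedBall p h))
    (ae_of_all _ fun x => by positivity) (hT.cell_subset_closedBall hK hp).eventuallyLE).trans
    (hT.integral_sub_nodeValue_sq_le hd hΩo hΩ hφ h0 (T.mem_nodes hK hp))

lemma Mesh.HasSize.integral_sub_sum_nodeValue_sq_le (hK : K ∈ T.elems) :
    ∫ x in cell K, (φ x - ∑ p ∈ K, nodeValue Ω h φ p * bary K p x) ^ 2 ≤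
      nodeConst d κ * h ^ 2 * patchEnergy h φ K := by
  have hs := Mesh.isSimplex hK
  have hc : ∀ p, Continuous (bary K p) := fun p => hs.continuous_bary p
  have hφc := hφ.continuous
  refine le_trans ?_ (hT.sum_integral_sub_nodeValue_sq_le hd hΩo hΩ hφ h0 hK)
  rw [← integral_finsetSum _ fun p _ => integrableOn_sub_sq hφ.continuous _ (isCompact_cell K)]
  refine setIntegral_mono_on ?_ ?_ (measurableSet_cell K) fun x hx =>
    hs.sub_sum_bary_sq_le φ _ hx
  · exact (Continuous.continuousOn (by fun_prop)).integrableOn_compact (isCompact_cell K)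
  · exact integrable_finsetSum _ fun p _ => integrableOn_sub_sq hφ.continuous _ (isCompact_cell K)

lemma Mesh.HasSize.integral_norm_fderiv_sub_sum_nodeValue_sq_le (hK : K ∈ T.elems) :
    ∫ x in cell K, ‖fderiv ℝ (fun x => φ x - ∑ p ∈ K, nodeValue Ω h φ p * bary K p x) x‖ ^ 2 ≤
      (2 + κ ^ 2 * (d + 1) / 2 * nodeConst d κ) * patchEnergy h φ K := by
  have hs := Mesh.isSimplex hK
  have hh := hT.size_pos
  have hg : ContDiff ℝ 1 (fun x => φ x - ∑ p ∈ K, nodeValue Ω h φ p * bary K p x) :=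
    hφ.sub (ContDiff.sum fun p _ => contDiff_const.mul (hs.contDiff_bary p))
  have i1 := integrableOn_norm_fderiv_sq hφ (isCompact_cell K)
  have i2 := integrable_finsetSum K fun p _ =>
    integrableOn_sub_sq hφ.continuous (nodeValue Ω h φ p) (isCompact_cell K)
  obtain ⟨p, hp⟩ : K.Nonempty := Finset.card_pos.1 (by rw [hs.card_eq]; omega)
  have h1 : ∫ x in cell K, ‖fderiv ℝ φ x‖ ^ 2 ≤ patchEnergy h φ K := by
    refine le_trans ?_ (Finset.single_le_sum (f := fun p =>
      ∫ x in Metric.closedBall p h, ‖fderiv ℝ φ x‖ ^ 2)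
      (fun _ _ => integral_nonneg fun _ => by positivity) hp)
    exact setIntegral_mono_set (integrableOn_norm_fderiv_sq hφ (isCompact_closedBall p h))
      (ae_of_all _ fun x => by positivity) (hT.cell_subset_closedBall hK hp).eventuallyLE
  have h2 := hT.sum_integral_sub_nodeValue_sq_le hd hΩo hΩ hφ h0 hK
  have h3 := integral_mono (integrableOn_norm_fderiv_sq hg (isCompact_cell K))
    ((i1.const_mul 2).add (i2.const_mul (κ ^ 2 * (d + 1) / (2 * h ^ 2))))
    (fun x => hT.norm_fderiv_sub_sum_bary_sq_le hK hφ (nodeValue Ω h φ) x)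
  refine h3.trans ?_
  simp only [Pi.add_apply]
  rw [integral_add (i1.const_mul 2) (i2.const_mul _), integral_const_mul, integral_const_mul,
    integral_finsetSum _ fun p _ => integrableOn_sub_sq hφ.continuous _ (isCompact_cell K)]
  calc _ ≤ 2 * patchEnergy h φ K + κ ^ 2 * (d + 1) / (2 * h ^ 2) *
        (nodeConst d κ * h ^ 2 * patchEnergy h φ K) := by gcongr
    _ = _ := by field_simp

/-- The quasi-interpolation error on an element. -/
theorem Mesh.HasSize.integral_sub_quasiInterp_sq_le (hK : K ∈ T.elems) :
    ∫ x in cell K, (φ x - T.quasiInterp h φ x) ^ 2 ≤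
      h ^ 2 * (interpConst d κ * patchEnergy h φ K) := by
  have e : ∫ x in cell K, (φ x - T.quasiInterp h φ x) ^ 2 =
      ∫ x in cell K, (φ x - ∑ p ∈ K, nodeValue Ω h φ p * bary K p x) ^ 2 :=
    setIntegral_congr_fun (measurableSet_cell K) fun x hx => by
      simp only [T.quasiInterp_eq hK φ hx]
  rw [e]
  refine (hT.integral_sub_sum_nodeValue_sq_le hd hΩo hΩ hφ h0 hK).trans ?_
  have hE := patchEnergy_nonneg h φ K
  have hκ := hT.ratio_pos
  have hN := nodeConst_pos (d := d) hκ
  rw [interpConst]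
  have : 0 ≤ h ^ 2 * (κ / 2 * ((d + 1) * nodeConst d κ +
    (2 + κ ^ 2 * (d + 1) / 2 * nodeConst d κ)) * patchEnergy h φ K) := by positivity
  linarith

/-- The quasi-interpolation error on a facet. -/
theorem Mesh.HasSize.integral_facet_sub_quasiInterp_sq_le (hK : K ∈ T.elems) {q : Pt d}
    (hq : q ∈ K) :
    ∫ x, (φ x - T.quasiInterp h φ x) ^ 2 ∂(facetMeasure (K.erase q)) ≤
      h * (interpConst d κ * patchEnergy h φ K) := by
  have hs := Mesh.isSimplex hK
  have hh := hT.size_pos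
  have hd1 : 1 ≤ d := by omega
  have e : ∫ x, (φ x - T.quasiInterp h φ x) ^ 2 ∂(facetMeasure (K.erase q)) =
      ∫ x, (φ x - ∑ p ∈ K, nodeValue Ω h φ p * bary K p x) ^ 2 ∂(facetMeasure (K.erase q)) :=
    setIntegral_congr_fun (measurableSet_cell _) fun x hx => by
      simp only [T.quasiInterp_eq hK φ (cell_mono (Finset.erase_subset _ _) hx)]
  rw [e]
  have hg : ContDiff ℝ 1 (fun x => φ x - ∑ p ∈ K, nodeValue Ω h φ p * bary K p x) :=
    hφ.sub (ContDiff.sum fun p _ => contDiff_const.mul (hs.contDiff_bary p))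
  obtain ⟨C, hC⟩ := exists_lipschitzOnWith_of_contDiff (isCompact_cell K) (convex_cell K) hg
  have htr := integral_facet_sq_le hd1 hs hq hC (h := h)
    fun x hx => hT.norm_sub_le hK hx (mem_cell_of_mem hq)
  have h1 := hT.integral_sub_sum_nodeValue_sq_le hd hΩo hΩ hφ h0 hK
  have h2 := hT.integral_norm_fderiv_sub_sum_nodeValue_sq_le hd hΩo hΩ hφ h0 hK
  have hb : 0 < ‖baryGrad K q‖ := norm_pos_iff.2 (baryGrad_ne_zero hd1 hs hq)
  have hE := patchEnergy_nonneg h φ K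
  have hκ := hT.ratio_pos
  have hN := nodeConst_pos (d := d) hκ
  rw [inv_mul_le_iff₀ hb] at htr
  refine htr.trans ?_
  calc _ ≤ κ / (2 * h) * ((d + 1) * (nodeConst d κ * h ^ 2 * patchEnergy h φ K) +
        h ^ 2 * ((2 + κ ^ 2 * (d + 1) / 2 * nodeConst d κ) * patchEnergy h φ K)) := by
        gcongr
        exact hT.norm_baryGrad_le hK q
    _ = h * (κ / 2 * ((d + 1) * nodeConst d κ +
        (2 + κ ^ 2 * (d + 1) / 2 * nodeConst d κ)) * patchEnergy h φ K) := by field_simp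
    _ ≤ _ := by
        rw [interpConst]
        gcongr
        linarith

end

/-- By the finite overlap of the node balls, the local energies add up to the global one. -/
lemma Mesh.HasSize.sum_patchEnergy_le (hT : T.HasSize κ h) {φ : Pt d → ℝ} (hφ : ContDiff ℝ 1 φ)
    (hc : HasCompactSupport φ) :
    ∑ K ∈ T.elems, patchEnergy h φ K ≤ (d + 1) * (2 * κ) ^ d * ∫ x, ‖fderiv ℝ φ x‖ ^ 2 := by
  refine hT.sum_integral_closedBall_le ?_ fun x => by positivity
  refine Continuous.integrable_of_hasCompactSupport
    ((hφ.continuous_fderiv one_ne_zero).norm.pow 2) ?_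
  exact (hc.fderiv (𝕜 := ℝ)).norm.comp_left (g := fun t => t ^ 2) (by norm_num)

end

section

variable {d : ℕ} {Ω : Set (Pt d)} {T : Mesh Ω} {K K' : Finset (Pt d)} {α β : ℝ}
  {a : Pt d → Matrix (Fin d) (Fin d) ℝ}

/-! ### The bilinear form on square integrable fields -/

lemma integral_norm_mul_norm_le {E F : Type*} [NormedAddCommGroup E] [NormedAddCommGroup F]
    {μ : Measure (Pt d)} {f : Pt d → E} {g : Pt d → F} (hf : MemLp f 2 μ) (hg : MemLp g 2 μ) :
    ∫ x, ‖f x‖ * ‖g x‖ ∂μ ≤ √(∫ x, ‖f x‖ ^ 2 ∂μ) * √(∫ x, ‖g x‖ ^ 2 ∂μ) := by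
  have h2 : ENNReal.ofReal 2 = 2 := by norm_num
  have := integral_mul_norm_le_Lp_mul_Lq (μ := μ) (f := fun x => ‖f x‖) (g := fun x => ‖g x‖)
    (p := 2) (q := 2) (Real.holderConjugate_iff.2 ⟨by norm_num, by norm_num⟩)
    (by rw [h2]; exact hf.norm) (by rw [h2]; exact hg.norm)
  simpa [Real.sqrt_eq_rpow] using this

lemma abs_integral_mul_le {μ : Measure (Pt d)} {f g : Pt d → ℝ} (hf : MemLp f 2 μ)
    (hg : MemLp g 2 μ) :
    |∫ x, f x * g x ∂μ| ≤ √(∫ x, f x ^ 2 ∂μ) * √(∫ x, g x ^ 2 ∂μ) := by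
  refine (norm_integral_le_integral_norm (fun x => f x * g x)).trans ?_
  simpa using integral_norm_mul_norm_le hf hg

lemma IsCoefficient.memLp_apply (ha : IsCoefficient Ω α β a) {V : Pt d → Pt d}
    (hV : MemLp V 2 (volume.restrict Ω)) :
    MemLp (fun x => (a x).toEuclideanLin (V x)) 2 (volume.restrict Ω) := by
  have e : (fun x => (a x).toEuclideanLin (V x)) = fun x =>
      ∑ i, ContinuousLinearMap.toSpanSingleton ℝ (EuclideanSpace.single i (1 : ℝ) : Pt d)
        (∑ j, a x i j * V x j) := by
    funext x
    ext k
    rw [toEuclideanLin_apply]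
    simp [Finset.sum_apply, Pi.single_apply]
  rw [e]
  refine memLp_finsetSum _ fun i _ => ContinuousLinearMap.comp_memLp' _
    (memLp_finsetSum _ fun j _ => ?_)
  have hj : MemLp (fun x => V x j) 2 (volume.restrict Ω) :=
    (EuclideanSpace.proj (𝕜 := ℝ) j : Pt d →L[ℝ] ℝ).comp_memLp' hV
  exact hj.mul (ha.memW1Inf i j).1

lemma integrable_inner_of_memLp {μ : Measure (Pt d)} {V W : Pt d → Pt d} (hV : MemLp V 2 μ)
    (hW : MemLp W 2 μ) : Integrable (fun x => ⟪V x, W x⟫_ℝ) μ := by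
  refine (hV.norm.integrable_mul hW.norm).mono' (hV.1.inner hW.1) (ae_of_all _ fun x => ?_)
  exact norm_inner_le_norm _ _

lemma abs_integral_inner_le {μ : Measure (Pt d)} {V W : Pt d → Pt d} (hV : MemLp V 2 μ)
    (hW : MemLp W 2 μ) :
    |∫ x, ⟪V x, W x⟫_ℝ ∂μ| ≤ √(∫ x, ‖V x‖ ^ 2 ∂μ) * √(∫ x, ‖W x‖ ^ 2 ∂μ) := by
  refine (norm_integral_le_integral_norm (fun x => ⟪V x, W x⟫_ℝ)).trans (le_trans ?_ (integral_norm_mul_norm_le hV hW))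
  refine integral_mono (integrable_inner_of_memLp hV hW).norm (hV.norm.integrable_mul hW.norm)
    fun x => norm_inner_le_norm _ _

lemma memLp_gradient (hb : Bornology.IsBounded Ω) {v : Pt d → ℝ} {L : ℝ≥0}
    (hv : LipschitzWith L v) : MemLp (gradient v) 2 (volume.restrict Ω) := by
  have := isFiniteMeasure_restrict_of_isBounded hb
  exact MemLp.of_bound (measurable_gradient v).aestronglyMeasurable L
    (ae_of_all _ (norm_gradient_le_of_lipschitz hv))

lemma memLp_of_lipschitz (hb : Bornology.IsBounded Ω) {v : Pt d → ℝ} {L : ℝ≥0}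
    (hv : LipschitzWith L v) : MemLp v 2 (volume.restrict Ω) := by
  have := isFiniteMeasure_restrict_of_isBounded hb
  obtain ⟨M, hM⟩ : ∃ M, ∀ x ∈ closure Ω, ‖v x‖ ≤ M :=
    hb.isCompact_closure.exists_bound_of_continuousOn hv.continuous.continuousOn
  have h1 : ∀ᵐ x ∂(volume.restrict Ω), x ∈ closure Ω :=
    ae_restrict_of_ae_restrict_of_subset subset_closure
      (ae_restrict_mem isClosed_closure.measurableSet)
  refine MemLp.of_bound hv.continuous.aestronglyMeasurable M ?_
  filter_upwards [h1] with x hx using hM x hx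

/-! ### Element-wise integration by parts of the residual -/

variable (T) in
/-- The elements cover `Ω` up to their boundaries, which are null sets. -/
lemma Mesh.integral_eq_sum (hΩ : interior (closure Ω) = Ω) {g : Pt d → ℝ}
    (hg : IntegrableOn g Ω) : ∫ x in Ω, g x = ∑ K ∈ T.elems, ∫ x in cell K, g x := by
  have h1 : ∀ K : Finset (Pt d), (interior (cell K) : Set (Pt d)) =ᵐ[volume] cell K := fun K =>
    ae_eq_set.2 ⟨by simp [sdiff_eq_empty.2 interior_subset], volume_cell_diff_interior K⟩
  have h2 : Ω =ᵐ[volume] ⋃ K ∈ T.elems, interior (cell K) := by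
    refine ae_eq_set.2 ⟨?_, ?_⟩
    · refine measure_mono_null (t := ⋃ K ∈ T.elems, cell K \ interior (cell K)) ?_
        ((measure_biUnion_null_iff T.elems.countable_toSet).2 fun K _ =>
          volume_cell_diff_interior K)
      rintro x ⟨hx, hx'⟩
      obtain ⟨K, hK, hxK⟩ := (T.mem_closure_iff x).1 (subset_closure hx)
      exact mem_iUnion₂.2 ⟨K, hK, hxK, fun h => hx' (mem_iUnion₂.2 ⟨K, hK, h⟩)⟩
    · have : (⋃ K ∈ T.elems, interior (cell K)) ⊆ Ω :=
        iUnion₂_subset fun K hK => T.interior_cell_subset hΩ hK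
      rw [sdiff_eq_empty.2 this, measure_empty]
  rw [setIntegral_congr_set h2, integral_biUnion_finset _ fun K _ => isOpen_interior.measurableSet]
  · exact Finset.sum_congr rfl fun K _ => setIntegral_congr_set (h1 K)
  · intro K hK K' hK' hne
    exact (T.disjoint_interior hK hK' hne).mono_right interior_subset
  · exact fun K hK => hg.mono_set (T.interior_cell_subset hΩ hK)

lemma Mesh.memLp_cell {f : Pt d → ℝ} (hΩ : interior (closure Ω) = Ω)
    (hf : MemLp f 2 (volume.restrict Ω)) (hK : K ∈ T.elems) :
    MemLp f 2 (volume.restrict (cell K)) := by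
  have h1 : (interior (cell K) : Set (Pt d)) =ᵐ[volume] cell K :=
    ae_eq_set.2 ⟨by simp [sdiff_eq_empty.2 interior_subset], volume_cell_diff_interior K⟩
  rw [← Measure.restrict_congr_set h1]
  exact hf.mono_measure (Measure.restrict_mono (T.interior_cell_subset hΩ hK) le_rfl)

lemma memLp_cell_of_bounded {g : Pt d → ℝ} (hg : AEStronglyMeasurable g (volume.restrict (cell K)))
    {M : ℝ} (hM : ∀ᵐ x ∂(volume.restrict (cell K)), ‖g x‖ ≤ M) :
    MemLp g 2 (volume.restrict (cell K)) := by
  have : IsFiniteMeasure (volume.restrict (cell K)) :=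
    ⟨by rw [Measure.restrict_apply_univ]; exact (isCompact_cell K).measure_lt_top⟩
  exact MemLp.of_bound hg M hM

lemma memLp_divOn_flux (hΩo : IsOpen Ω) (hΩ : interior (closure Ω) = Ω)
    (ha : IsCoefficient Ω α β a) {v : Pt d → ℝ} (hv : v ∈ T.piecewiseC2) (hK : K ∈ T.elems) :
    MemLp (divOn K (flux a v K)) 2 (volume.restrict (cell K)) := by
  obtain ⟨P, D, hP, -, hdiv⟩ := exists_lipschitz_flux hΩo hΩ ha hv hK
  refine (memLp_congr_ae hdiv).2 (memLp_finsetSum _ fun i _ => ?_)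
  refine memLp_cell_of_bounded (M := D i * ‖(EuclideanSpace.single i (1 : ℝ) : Pt d)‖)
    (integrable_fderiv_apply _ (hP i)).1 ?_
  filter_upwards [ae_norm_fderiv_le_of_lipschitzOn (hP i)] with x hx
  exact ((fderiv ℝ (P i) x).le_opNorm _).trans (mul_le_mul_of_nonneg_right hx (norm_nonneg _))

/-- The contribution of the facet between `K` and `K'` to the integration by parts on `K`. -/
def facetTerm (a : Pt d → Matrix (Fin d) (Fin d) ℝ) (v ψ : Pt d → ℝ) (K K' : Finset (Pt d)) : ℝ :=
  ∫ x, ψ x * ⟪innerNormal K (apex K K'), flux a v K x⟫_ℝ ∂(facetMeasure (K ∩ K'))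

lemma ae_facetMeasure_mem_relintFacet (hd : 1 ≤ d) (hK : IsSimplex K) {q : Pt d} (hq : q ∈ K) :
    ∀ᵐ y ∂(facetMeasure (K.erase q)), y ∈ relintFacet K q ∧ y ∈ cell (K.erase q) := by
  filter_upwards [ae_facetMeasure_bary_pos hd hK hq,
    (ae_restrict_mem (measurableSet_cell _) :
      ∀ᵐ y ∂(facetMeasure (K.erase q)), y ∈ cell (K.erase q))] with y hy hyc
  exact ⟨⟨((hK.mem_facet_iff hq y).1 hyc).2, hy⟩, hyc⟩

/-- On an interior facet the flux agrees almost everywhere with a continuous field. -/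
lemma Mesh.IsNeighbor.exists_continuousOn_flux (hd : 1 ≤ d) (hΩo : IsOpen Ω)
    (hΩ : interior (closure Ω) = Ω) (ha : IsCoefficient Ω α β a) {v : Pt d → ℝ}
    (hv : v ∈ T.piecewiseC2) {q q' : Pt d} (h : T.IsNeighbor K q K' q') :
    ∃ F : Pt d → Pt d, ContinuousOn F (cell (K.erase q)) ∧
      flux a v K =ᵐ[facetMeasure (K.erase q)] F := by
  obtain ⟨P, D, hP, hflux, -⟩ := exists_lipschitz_flux hΩo hΩ ha hv h.mem
  refine ⟨fun x => WithLp.toLp 2 fun i => P i x, ?_, ?_⟩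
  · refine (PiLp.continuous_toLp 2 _).comp_continuousOn (continuousOn_pi.2 fun i => ?_)
    exact (hP i).continuousOn.mono (cell_mono (Finset.erase_subset _ _))
  · filter_upwards [ae_facetMeasure_mem_relintFacet hd (Mesh.isSimplex h.mem) h.q_mem]
      with x hx
    ext i
    exact hflux x (cell_mono (Finset.erase_subset _ _) hx.2)
      (h.relintFacet_subset_domain hd hΩ hx.1) i

/-- Integration by parts on an element, for test functions vanishing outside `Ω`. -/
lemma Mesh.integral_cell_residual (hd : 1 ≤ d) (hΩo : IsOpen Ω) (hΩ : interior (closure Ω) = Ω)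
    (ha : IsCoefficient Ω α β a) {f : Pt d → ℝ} (hf : MemLp f 2 (volume.restrict Ω))
    {v : Pt d → ℝ} (hv : v ∈ T.piecewiseC2) {ψ : Pt d → ℝ} {L : ℝ≥0} (hψ : LipschitzWith L ψ)
    (hψ0 : ∀ x ∉ Ω, ψ x = 0) (hK : K ∈ T.elems) :
    ∫ x in cell K, (f x * ψ x - ⟪(a x).toEuclideanLin (gradient v x), gradient ψ x⟫_ℝ) =
      (∫ x in cell K, (f x + divOn K (flux a v K) x) * ψ x) +
        ∑ K' ∈ T.neighbors K, facetTerm a v ψ K K' := by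
  have hs := Mesh.isSimplex hK
  obtain ⟨P, D, hP, hflux, hdiv⟩ := exists_lipschitz_flux hΩo hΩ ha hv hK
  obtain ⟨g, hg, hvg⟩ := hv.2 K hK
  have hint : interior (cell K) ⊆ Ω := T.interior_cell_subset hΩ hK
  have hparts := integral_parts hd hs (hψ.lipschitzOnWith (s := cell K)) hP
  have hψm : MemLp ψ 2 (volume.restrict (cell K)) :=
    memLp_of_lipschitz (isCompact_cell K).isBounded hψ
  have hfm := T.memLp_cell hΩ hf hK
  have hdm := memLp_divOn_flux hΩo hΩ ha hv hK
  have hgrad : ∀ᵐ x ∂(volume.restrict (cell K)),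
      ⟪(a x).toEuclideanLin (gradient v x), gradient ψ x⟫_ℝ =
        ∑ i, fderiv ℝ ψ x (EuclideanSpace.single i 1) * P i x := by
    filter_upwards [ae_mem_interior_cell K] with x hx
    have hxK := interior_subset hx
    have h1 : gradient v x = gradientWithin v (cell K) x := by
      rw [gradientWithin_eq hs hg hvg hxK, gradient, gradient, fderiv_eq_of_mem_interior hvg hx]
    have h2 : (a x).toEuclideanLin (gradient v x) = WithLp.toLp 2 fun i => P i x := by
      ext i
      rw [h1]
      exact hflux x hxK (hint hx) i
    rw [h2, PiLp.inner_apply]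
    refine Finset.sum_congr rfl fun i _ => ?_
    rw [gradient_apply]
    simp [mul_comm]
  have i1 : Integrable (fun x => (f x + divOn K (flux a v K) x) * ψ x)
      (volume.restrict (cell K)) := (hfm.add hdm).integrable_mul hψm
  have hfacets : -∑ p ∈ K, ∫ y, ψ y * ∑ i, innerNormal K p i * P i y ∂(facetMeasure (K.erase p)) =
      -∑ K' ∈ T.neighbors K, facetTerm a v ψ K K' := by
    rw [T.sum_facets_eq_sum_neighbors hd hK]
    · congr 1
      refine Finset.sum_congr rfl fun K' hK' => ?_
      have hN := Mesh.isNeighbor_apex hK hK'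
      rw [facetTerm, hN.inter_eq]
      refine integral_congr_ae ?_
      filter_upwards [ae_facetMeasure_mem_relintFacet hd hs hN.q_mem] with x hx
      congr 1
      rw [PiLp.inner_apply]
      refine Finset.sum_congr rfl fun i _ => ?_
      rw [hflux x (cell_mono (Finset.erase_subset _ _) hx.2)
        (hN.relintFacet_subset_domain hd hΩ hx.1) i]
      simp [mul_comm]
    · intro q hq hno
      refine integral_eq_zero_of_ae ?_
      filter_upwards [ae_facetMeasure_mem_relintFacet hd hs hq] with x hx
      have : x ∉ Ω := fun hxΩ => by
        obtain ⟨K', q', h⟩ := Mesh.exists_isNeighbor_of_mem_domain hΩo hK hq hx.1 hxΩ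
        exact hno ⟨K', q', h⟩
      simp [hψ0 x this]
  have i2 : Integrable (fun x => ψ x * ∑ i, fderiv ℝ (P i) x (EuclideanSpace.single i 1) +
      ∑ i, fderiv ℝ ψ x (EuclideanSpace.single i 1) * P i x) (volume.restrict (cell K)) := by
    refine Integrable.add ?_ (integrable_finsetSum _ fun i _ => ?_)
    · refine (hψm.integrable_mul hdm).congr ?_
      filter_upwards [hdiv] with x hx
      simp [hx]
    · obtain ⟨M, hM⟩ := (isCompact_cell K).exists_bound_of_continuousOn (hP i).continuousOn
      refine (integrable_fderiv_apply _ (hψ.lipschitzOnWith (s := cell K))).mul_bdd (c := M)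
        ((hP i).continuousOn.aestronglyMeasurable (measurableSet_cell K)) ?_
      exact (ae_restrict_mem (measurableSet_cell K)).mono hM
  have hsplit : ∫ x in cell K, (f x * ψ x - ⟪(a x).toEuclideanLin (gradient v x), gradient ψ x⟫_ℝ) =
      (∫ x in cell K, (f x + divOn K (flux a v K) x) * ψ x) -
        ∫ x in cell K, (ψ x * ∑ i, fderiv ℝ (P i) x (EuclideanSpace.single i 1) +
          ∑ i, fderiv ℝ ψ x (EuclideanSpace.single i 1) * P i x) := by
    rw [← integral_sub i1 i2]
    refine integral_congr_ae ?_
    filter_upwards [hgrad, hdiv] with x h1 h2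
    rw [h1, h2]
    ring
  rw [hsplit, hparts, hfacets, sub_neg_eq_add]

/-- The two contributions of an interior facet combine to the jump of the normal flux. -/
lemma Mesh.abs_facetTerm_add_le (hd : 1 ≤ d) (hΩo : IsOpen Ω) (hΩ : interior (closure Ω) = Ω)
    (ha : IsCoefficient Ω α β a) {v : Pt d → ℝ} (hv : v ∈ T.piecewiseC2) {ψ : Pt d → ℝ}
    (hψ : Continuous ψ) (hK : K ∈ T.elems) (hK' : K' ∈ T.neighbors K) :
    |facetTerm a v ψ K K' + facetTerm a v ψ K' K| ≤
      √(∫ x in cell (K ∩ K'), fluxJump a v K K' x ^ 2 ∂μHE[d - 1]) *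
        √(∫ x, ψ x ^ 2 ∂(facetMeasure (K.erase (apex K K')))) := by
  have hN := Mesh.isNeighbor_apex hK hK'
  have hs := Mesh.isSimplex hK
  set q := apex K K' with hq
  set q' := apex K' K with hq'
  obtain ⟨F, hF, hFe⟩ := hN.exists_continuousOn_flux hd hΩo hΩ ha hv
  obtain ⟨F', hF', hFe'⟩ := hN.symm.exists_continuousOn_flux hd hΩo hΩ ha hv
  rw [← hN.erase_eq] at hF' hFe'
  have hfin := isFiniteMeasure_facetMeasure hd hs hN.q_mem
  set μ := facetMeasure (K.erase q) with hμ
  set n := innerNormal K q with hn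
  have hi : ∀ G : Pt d → Pt d, ContinuousOn G (cell (K.erase q)) →
      Integrable (fun x => ψ x * ⟪n, G x⟫_ℝ) μ := fun G hG =>
    integrable_facet_of_continuousOn hd hs hN.q_mem
      (hψ.continuousOn.mul (continuousOn_const.inner hG))
  have e1 : facetTerm a v ψ K K' = ∫ x, ψ x * ⟪n, F x⟫_ℝ ∂μ := by
    rw [facetTerm, hN.inter_eq]
    refine integral_congr_ae ?_
    filter_upwards [hFe] with x hx
    rw [hx]
  have e2 : facetTerm a v ψ K' K = -∫ x, ψ x * ⟪n, F' x⟫_ℝ ∂μ := by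
    rw [facetTerm, hN.symm.inter_eq, ← hN.erase_eq, ← integral_neg]
    refine integral_congr_ae ?_
    filter_upwards [hFe'] with x hx
    rw [hx, hn, hN.innerNormal_eq hd, inner_neg_left, mul_neg, neg_neg]
  have e3 : facetTerm a v ψ K K' + facetTerm a v ψ K' K =
      ∫ x, ⟪n, F x - F' x⟫_ℝ * ψ x ∂μ := by
    rw [e1, e2, ← sub_eq_add_neg, ← integral_sub (hi F hF) (hi F' hF')]
    refine integral_congr_ae (ae_of_all _ fun x => ?_)
    simp only [inner_sub_right]
    ring
  have e4 : ∫ x in cell (K ∩ K'), fluxJump a v K K' x ^ 2 ∂μHE[d - 1] =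
      ∫ x, ⟪n, F x - F' x⟫_ℝ ^ 2 ∂μ := by
    have : ∫ x in cell (K ∩ K'), fluxJump a v K K' x ^ 2 ∂μHE[d - 1] =
        ∫ x, fluxJump a v K K' x ^ 2 ∂μ := by rw [hμ, facetMeasure, hN.inter_eq]
    rw [this]
    refine integral_congr_ae ?_
    filter_upwards [hFe, hFe'] with x h1 h2
    rw [fluxJump, hN.inter_eq, h1, h2]
    rcases unitNormal_eq hd hs hN.q_mem with h | h
    · rw [h]
    · rw [h, inner_neg_left, neg_sq]
  have hmem : ∀ g : Pt d → ℝ, ContinuousOn g (cell (K.erase q)) → MemLp g 2 μ := fun g hg => by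
    obtain ⟨M, hM⟩ := (isCompact_cell (K.erase q)).exists_bound_of_continuousOn hg
    exact MemLp.of_bound (hg.aestronglyMeasurable (measurableSet_cell _)) M
      ((ae_restrict_mem (measurableSet_cell _)).mono hM)
  rw [e3, e4]
  exact abs_integral_mul_le (hmem _ (continuousOn_const.inner (hF.sub hF')))
    (hmem _ hψ.continuousOn)

end

section

variable {d : ℕ} {Ω : Set (Pt d)} {T : Mesh Ω} {K K' : Finset (Pt d)} {κ h α β : ℝ}
  {a : Pt d → Matrix (Fin d) (Fin d) ℝ} {f v : Pt d → ℝ}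

/-! ### The residual is bounded by the estimator -/

lemma Mesh.HasSize.size_le_diam_cell (hT : T.HasSize κ h) (hd : 1 ≤ d) (hK : K ∈ T.elems) :
    h ≤ κ * Metric.diam (cell K) := by
  obtain ⟨c, hc⟩ := hT.exists_ball K hK
  have := le_diam_cell hd (div_pos hT.size_pos hT.ratio_pos) hc
  rwa [div_le_iff₀' hT.ratio_pos] at this

/-- Facets have at least two vertices because `2 ≤ d`, and these are far apart since the gradients of
the barycentric coordinates are bounded. -/
lemma Mesh.HasSize.size_le_diam_facet (hT : T.HasSize κ h) (hd : 2 ≤ d) (hK : K ∈ T.elems)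
    {q : Pt d} (hq : q ∈ K) : h ≤ κ * Metric.diam (cell (K.erase q)) := by
  have hs := Mesh.isSimplex hK
  have hh := hT.size_pos
  have hcard : 1 < (K.erase q).card := by
    rw [Finset.card_erase_of_mem hq, hs.card_eq]
    omega
  obtain ⟨p, hp, p', hp', hne⟩ := Finset.one_lt_card.1 hcard
  have h1 := Metric.dist_le_diam_of_mem (isCompact_cell (K.erase q)).isBounded
    (mem_cell_of_mem hp) (mem_cell_of_mem hp')
  rw [Finset.mem_erase] at hp hp'
  -- the barycentric coordinate of `p` varies by `1` between `p` and `p'`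
  have h2 : 1 ≤ ‖baryGrad K p‖ * dist p p' := by
    have := hs.bary_eq_add_inner p p' p
    rw [hs.bary_self hp.2, hs.bary_ne hp'.2 hne, zero_add] at this
    rw [dist_eq_norm, this]
    exact real_inner_le_norm _ _
  have h3 : 1 ≤ κ / (2 * h) * Metric.diam (cell (K.erase q)) :=
    h2.trans (mul_le_mul (hT.norm_baryGrad_le hK p) h1 dist_nonneg
      (div_nonneg hT.ratio_pos.le (by positivity)))
  have h4 : κ / (2 * h) * Metric.diam (cell (K.erase q)) * (2 * h) =
      κ * Metric.diam (cell (K.erase q)) := by field_simp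
  nlinarith

lemma Mesh.etaSq_nonneg (K : Finset (Pt d)) : 0 ≤ T.etaSq a f v K := by
  refine add_nonneg (mul_nonneg (sq_nonneg _) (integral_nonneg fun x => sq_nonneg _))
    (Finset.sum_nonneg fun K' _ => ?_)
  exact mul_nonneg (mul_nonneg (by norm_num) Metric.diam_nonneg)
    (integral_nonneg fun x => sq_nonneg _)

lemma Mesh.diam_sq_mul_le_etaSq (K : Finset (Pt d)) :
    Metric.diam (cell K) ^ 2 * (∫ x in cell K, (f x + divOn K (flux a v K) x) ^ 2) ≤
      T.etaSq a f v K :=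
  le_add_of_nonneg_right (Finset.sum_nonneg fun K' _ =>
    mul_nonneg (mul_nonneg (by norm_num) Metric.diam_nonneg) (integral_nonneg fun x => sq_nonneg _))

lemma Mesh.diam_mul_le_etaSq (hK' : K' ∈ T.neighbors K) :
    1 / 2 * Metric.diam (cell (K ∩ K')) *
      (∫ x in cell (K ∩ K'), fluxJump a v K K' x ^ 2 ∂μHE[d - 1]) ≤ T.etaSq a f v K := by
  refine le_trans (Finset.single_le_sum (f := fun K' => 1 / 2 * Metric.diam (cell (K ∩ K')) *
    ∫ x in cell (K ∩ K'), fluxJump a v K K' x ^ 2 ∂μHE[d - 1]) (fun K' _ => ?_) hK')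
    (le_add_of_nonneg_left (mul_nonneg (sq_nonneg _) (integral_nonneg fun x => sq_nonneg _)))
  exact mul_nonneg (mul_nonneg (by norm_num) Metric.diam_nonneg)
    (integral_nonneg fun x => sq_nonneg _)

/-- The residual on one element, applied to a function `ψ` that satisfies the scaled bounds of a
quasi-interpolation error. -/
lemma Mesh.HasSize.abs_local_residual_le (hT : T.HasSize κ h) (hd : 2 ≤ d) (hΩo : IsOpen Ω)
    (hΩ : interior (closure Ω) = Ω) (ha : IsCoefficient Ω α β a)
    (hf : MemLp f 2 (volume.restrict Ω)) (hv : v ∈ T.piecewiseC2) {ψ : Pt d → ℝ} {L : ℝ≥0}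
    (hψ : LipschitzWith L ψ) (hK : K ∈ T.elems) {D : ℝ} (hD : 0 ≤ D)
    (h1 : ∫ x in cell K, ψ x ^ 2 ≤ h ^ 2 * D)
    (h2 : ∀ q ∈ K, ∫ x, ψ x ^ 2 ∂(facetMeasure (K.erase q)) ≤ h * D) :
    |(∫ x in cell K, (f x + divOn K (flux a v K) x) * ψ x) +
        ∑ K' ∈ T.neighbors K, 1 / 2 * (facetTerm a v ψ K K' + facetTerm a v ψ K' K)| ≤
      (κ + (d + 1) * √κ) * (√(T.etaSq a f v K) * √D) := by
  have hd1 : 1 ≤ d := by omega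
  have hh := hT.size_pos
  have hκ := hT.ratio_pos
  set η := T.etaSq a f v K with hη
  have hη0 : 0 ≤ η := T.etaSq_nonneg K
  have hvol : |∫ x in cell K, (f x + divOn K (flux a v K) x) * ψ x| ≤ κ * (√η * √D) := by
    have hψm : MemLp ψ 2 (volume.restrict (cell K)) :=
      memLp_of_lipschitz (isCompact_cell K).isBounded hψ
    refine (abs_integral_mul_le ((T.memLp_cell hΩ hf hK).add
      (memLp_divOn_flux hΩo hΩ ha hv hK)) hψm).trans ?_
    set A := ∫ x in cell K, (f + divOn K (flux a v K)) x ^ 2 with hA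
    have hA0 : 0 ≤ A := integral_nonneg fun x => sq_nonneg _
    have hAη : Metric.diam (cell K) ^ 2 * A ≤ η := T.diam_sq_mul_le_etaSq K
    calc √A * √(∫ x in cell K, ψ x ^ 2) ≤ √A * √(h ^ 2 * D) := by gcongr
      _ = h * √A * √D := by rw [Real.sqrt_mul (sq_nonneg h), Real.sqrt_sq hh.le]; ring
      _ ≤ (κ * Metric.diam (cell K)) * √A * √D := by
          gcongr
          exact hT.size_le_diam_cell hd1 hK
      _ = κ * (√(Metric.diam (cell K) ^ 2 * A) * √D) := by
          rw [Real.sqrt_mul (sq_nonneg _), Real.sqrt_sq Metric.diam_nonneg]; ring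
      _ ≤ κ * (√η * √D) := by gcongr
  have hfac : ∀ K' ∈ T.neighbors K,
      |1 / 2 * (facetTerm a v ψ K K' + facetTerm a v ψ K' K)| ≤ √κ * (√η * √D) := by
    intro K' hK'
    have hN := Mesh.isNeighbor_apex hK hK'
    rw [abs_mul, abs_of_nonneg (by norm_num : (0 : ℝ) ≤ 1 / 2)]
    have h3 := T.abs_facetTerm_add_le hd1 hΩo hΩ ha hv hψ.continuous hK hK'
    set J := ∫ x in cell (K ∩ K'), fluxJump a v K K' x ^ 2 ∂μHE[d - 1] with hJ
    have hJ0 : 0 ≤ J := integral_nonneg fun x => sq_nonneg _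
    have hJη : 1 / 2 * Metric.diam (cell (K ∩ K')) * J ≤ η := T.diam_mul_le_etaSq hK'
    have hl := hT.size_le_diam_facet hd hK hN.q_mem
    rw [← hN.inter_eq] at hl
    have h4 : J * (h * D) ≤ 2 ^ 2 * (κ * (η * D)) :=
      calc J * (h * D) ≤ J * (κ * Metric.diam (cell (K ∩ K')) * D) := by gcongr
        _ = 2 * (κ * (1 / 2 * Metric.diam (cell (K ∩ K')) * J * D)) := by ring
        _ ≤ 2 * (κ * (η * D)) := by gcongr
        _ ≤ 2 ^ 2 * (κ * (η * D)) := by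
            have : 0 ≤ κ * (η * D) := by positivity
            linarith
    calc _ ≤ 1 / 2 * (√J * √(h * D)) := by
          refine mul_le_mul_of_nonneg_left (h3.trans ?_) (by norm_num)
          gcongr
          exact h2 _ hN.q_mem
      _ = 1 / 2 * √(J * (h * D)) := by rw [Real.sqrt_mul hJ0]
      _ ≤ 1 / 2 * √(2 ^ 2 * (κ * (η * D))) := by gcongr
      _ = √κ * (√η * √D) := by
          rw [Real.sqrt_mul (by norm_num), Real.sqrt_sq (by norm_num), Real.sqrt_mul hκ.le,
            Real.sqrt_mul hη0]
          ring
  calc _ ≤ |∫ x in cell K, (f x + divOn K (flux a v K) x) * ψ x| +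
        ∑ K' ∈ T.neighbors K, |1 / 2 * (facetTerm a v ψ K K' + facetTerm a v ψ K' K)| :=
        (abs_add_le _ _).trans (by gcongr; exact Finset.abs_sum_le_sum_abs _ _)
    _ ≤ κ * (√η * √D) + ∑ K' ∈ T.neighbors K, √κ * (√η * √D) :=
        add_le_add hvol (Finset.sum_le_sum hfac)
    _ ≤ κ * (√η * √D) + (d + 1) * (√κ * (√η * √D)) := by
        rw [Finset.sum_const, nsmul_eq_mul]
        gcongr
        exact_mod_cast T.card_neighbors_le hd1 hK
    _ = _ := by ring

/-- The constant in the bound of the residual by the estimator. -/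
def residualConst (d : ℕ) (κ : ℝ) : ℝ :=
  (κ + (d + 1) * √κ) * √(interpConst d κ * ((d + 1) * (2 * κ) ^ d))

lemma residualConst_nonneg (hκ : 0 < κ) : 0 ≤ residualConst d κ := by
  rw [residualConst]; positivity

/-- The residual of a piecewise smooth function, applied to a quasi-interpolation error. -/
theorem Mesh.HasSize.abs_residual_le (hT : T.HasSize κ h) (hd : 2 ≤ d) (hΩo : IsOpen Ω)
    (hΩ : interior (closure Ω) = Ω) (hb : Bornology.IsBounded Ω) (ha : IsCoefficient Ω α β a)
    (hf : MemLp f 2 (volume.restrict Ω)) (hv : v ∈ T.piecewiseC2) {φ : Pt d → ℝ}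
    (hφ : IsTest Ω φ) {L : ℝ≥0}
    (hψ : LipschitzWith L fun x => φ x - T.quasiInterp h φ x) :
    |load Ω f (fun x => φ x - T.quasiInterp h φ x) -
        aForm Ω a v (fun x => φ x - T.quasiInterp h φ x)| ≤
      residualConst d κ * (√(∑ K ∈ T.elems, T.etaSq a f v K) * √(∫ x, ‖gradient φ x‖ ^ 2)) := by
  have hd1 : 1 ≤ d := by omega
  have hκ := hT.ratio_pos
  have hφ1 : ContDiff ℝ 1 φ := hφ.1.of_le (by exact_mod_cast le_top)
  have hφ0 : ∀ x ∉ Ω, φ x = 0 := fun x hx => image_eq_zero_of_notMem_tsupport fun h =>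
    hx (hφ.2.2 h)
  set ψ : Pt d → ℝ := fun x => φ x - T.quasiInterp h φ x with hψdef
  have hψ0 : ∀ x ∉ Ω, ψ x = 0 := fun x hx => by
    rw [hψdef]
    simp only
    rw [hφ0 x hx, (T.quasiInterp_mem_piecewiseC2 hΩo hΩ φ).1 x hx, sub_zero]
  obtain ⟨M, hM⟩ := T.exists_lipschitzWith_of_piecewiseC2 hΩo hv
  set D : Finset (Pt d) → ℝ := fun K => interpConst d κ * patchEnergy h φ K with hD
  have hD0 : ∀ K, 0 ≤ D K := fun K =>
    mul_nonneg (interpConst_pos hκ).le (patchEnergy_nonneg h φ K)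
  have iF : Integrable (fun x => f x * ψ x) (volume.restrict Ω) :=
    hf.integrable_mul (memLp_of_lipschitz hb hψ)
  have iA : Integrable (fun x => ⟪(a x).toEuclideanLin (gradient v x), gradient ψ x⟫_ℝ)
      (volume.restrict Ω) :=
    integrable_inner_of_memLp (ha.memLp_apply (memLp_gradient hb hM)) (memLp_gradient hb hψ)
  have hA : aForm Ω a v ψ =
      ∫ x in Ω, ⟪(a x).toEuclideanLin (gradient v x), gradient ψ x⟫_ℝ := by
    refine integral_congr_ae ?_
    filter_upwards [weakGrad_ae_eq_gradient hΩo hM, weakGrad_ae_eq_gradient hΩo hψ] with x h1 h2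
    rw [h1, h2]
  have hrep : load Ω f ψ - aForm Ω a v ψ = ∑ K ∈ T.elems,
      ((∫ x in cell K, (f x + divOn K (flux a v K) x) * ψ x) +
        ∑ K' ∈ T.neighbors K, 1 / 2 * (facetTerm a v ψ K K' + facetTerm a v ψ K' K)) := by
    have hsum := T.integral_eq_sum hΩ (iF.sub iA)
    simp only [Pi.sub_apply] at hsum
    rw [hA, load, ← integral_sub iF iA, hsum, Finset.sum_add_distrib,
      ← T.sum_neighbors_symm, ← Finset.sum_add_distrib]
    exact Finset.sum_congr rfl fun K hK => T.integral_cell_residual hd1 hΩo hΩ ha hf hv hψ hψ0 hK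
  have hsumD : ∑ K ∈ T.elems, D K ≤
      interpConst d κ * ((d + 1) * (2 * κ) ^ d) * ∫ x, ‖gradient φ x‖ ^ 2 := by
    rw [hD, ← Finset.mul_sum, mul_assoc]
    simp_rw [norm_gradient]
    exact mul_le_mul_of_nonneg_left (hT.sum_patchEnergy_le hφ1 hφ.2.1) (interpConst_pos hκ).le
  have hc0 : 0 ≤ κ + (d + 1) * √κ := by positivity
  have hi := interpConst_pos (d := d) hκ
  rw [hrep]
  calc _ ≤ ∑ K ∈ T.elems, (κ + (d + 1) * √κ) * (√(T.etaSq a f v K) * √(D K)) := by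
        refine (Finset.abs_sum_le_sum_abs _ _).trans (Finset.sum_le_sum fun K hK => ?_)
        exact hT.abs_local_residual_le hd hΩo hΩ ha hf hv hψ hK (hD0 K)
          (hT.integral_sub_quasiInterp_sq_le hd hΩo hΩ hφ1 hφ0 hK)
          fun q hq => hT.integral_facet_sub_quasiInterp_sq_le hd hΩo hΩ hφ1 hφ0 hK hq
    _ = (κ + (d + 1) * √κ) * ∑ K ∈ T.elems, √(T.etaSq a f v K) * √(D K) := by
        rw [Finset.mul_sum]
    _ ≤ (κ + (d + 1) * √κ) * (√(∑ K ∈ T.elems, T.etaSq a f v K) * √(∑ K ∈ T.elems, D K)) := by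
        gcongr
        exact Real.sum_sqrt_mul_sqrt_le _ (fun K => T.etaSq_nonneg K) hD0
    _ ≤ (κ + (d + 1) * √κ) * (√(∑ K ∈ T.elems, T.etaSq a f v K) *
        √(interpConst d κ * ((d + 1) * (2 * κ) ^ d) * ∫ x, ‖gradient φ x‖ ^ 2)) := by
        gcongr
    _ = _ := by
        rw [residualConst, Real.sqrt_mul (by positivity)]
        ring

/-! ### Galerkin orthogonality and density -/

/-- The error of the Galerkin approximation tested with a test function. -/
lemma Mesh.HasSize.abs_load_sub_aForm_le (hT : T.HasSize κ h) (hd : 2 ≤ d) (hΩo : IsOpen Ω)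
    (hΩ : interior (closure Ω) = Ω) (hb : Bornology.IsBounded Ω) (ha : IsCoefficient Ω α β a)
    (hf : MemLp f 2 (volume.restrict Ω)) {V : Submodule ℝ (Pt d → ℝ)} (hV : T.VFEM ≤ V)
    (hV2 : V ≤ T.piecewiseC2) (hv : IsGalerkin Ω a f V v) {φ : Pt d → ℝ} (hφ : IsTest Ω φ) :
    |load Ω f φ - aForm Ω a v φ| ≤
      residualConst d κ * (√(∑ K ∈ T.elems, T.etaSq a f v K) * √(∫ x, ‖gradient φ x‖ ^ 2)) := by
  have hv2 := hV2 hv.1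
  set w := T.quasiInterp h φ with hw
  have hwF : w ∈ T.VFEM := T.quasiInterp_mem_VFEM hΩo φ
  obtain ⟨Lv, hLv⟩ := T.exists_lipschitzWith_of_piecewiseC2 hΩo hv2
  obtain ⟨Lw, hLw⟩ := T.exists_lipschitzWith_of_piecewiseC2 hΩo
    (T.quasiInterp_mem_piecewiseC2 (h := h) hΩo hΩ φ)
  obtain ⟨Lφ, hLφ⟩ := hφ.exists_lipschitz
  have hψ : LipschitzWith (Lφ + Lw) fun x => φ x - w x := hLφ.sub hLw
  have hgal := hv.2 w (hV hwF)
  have e1 : load Ω f (fun x => φ x - w x) = load Ω f φ - load Ω f w := by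
    have i1 : Integrable (fun x => f x * φ x) (volume.restrict Ω) :=
      hf.integrable_mul (memLp_of_lipschitz hb hLφ)
    have i2 : Integrable (fun x => f x * w x) (volume.restrict Ω) :=
      hf.integrable_mul (memLp_of_lipschitz hb hLw)
    rw [load, load, load, ← integral_sub i1 i2]
    simp only [mul_sub]
  have e2 : aForm Ω a v (fun x => φ x - w x) = aForm Ω a v φ - aForm Ω a v w := by
    have hF := ha.memLp_apply (memLp_gradient hb hLv)
    have h1 := weakGrad_ae_eq_gradient hΩo hLφ
    have h2 := weakGrad_ae_eq_gradient hΩo hLw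
    have h3 := ((isWeakGrad_gradient hLφ).sub (isWeakGrad_gradient hLw)).weakGrad_ae_eq hΩo
    have h4 := weakGrad_ae_eq_gradient hΩo hLv
    have hF' : MemLp (fun x => (a x).toEuclideanLin (weakGrad Ω v x)) 2 (volume.restrict Ω) :=
      (memLp_congr_ae (by filter_upwards [h4] with x hx; rw [hx])).1 hF
    rw [aForm, aForm, aForm, ← integral_sub
      (integrable_inner_of_memLp hF' ((memLp_congr_ae h1).2 (memLp_gradient hb hLφ)))
      (integrable_inner_of_memLp hF' ((memLp_congr_ae h2).2 (memLp_gradient hb hLw)))]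
    refine integral_congr_ae ?_
    filter_upwards [h1, h2, h3] with x h1 h2 h3
    rw [h1, h2, h3, inner_sub_right]
  have e3 : load Ω f φ - aForm Ω a v φ =
      load Ω f (fun x => φ x - w x) - aForm Ω a v (fun x => φ x - w x) := by
    rw [e1, e2, hgal]; ring
  rw [e3]
  exact hT.abs_residual_le hd hΩo hΩ hb ha hf hv2 hφ hψ

/-- The gradients of `H¹₀` functions are limits of gradients of test functions. -/
lemma exists_tendsto_weakGrad_sub {u v : Pt d → ℝ} (hΩ : IsOpen Ω) (hu : MemH10 Ω u)
    (hv : MemH10 Ω v) :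
    MemLp (weakGrad Ω fun x => u x - v x) 2 (volume.restrict Ω) ∧
    (weakGrad Ω fun x => u x - v x) =ᵐ[volume.restrict Ω]
      (fun x => weakGrad Ω u x - weakGrad Ω v x) ∧
    ∃ φ : ℕ → Pt d → ℝ, (∀ n, IsTest Ω (φ n)) ∧
      Tendsto (fun n => eLpNorm (fun x => gradient (φ n) x - weakGrad Ω (fun x => u x - v x) x) 2
        (volume.restrict Ω)) atTop (𝓝 0) := by
  obtain ⟨⟨-, G, hG, hG2⟩, φ, hφ, -, hφ2⟩ := hu
  obtain ⟨⟨-, H, hH, hH2⟩, χ, hχ, -, hχ2⟩ := hv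
  have hae : (weakGrad Ω fun x => u x - v x) =ᵐ[volume.restrict Ω]
      (fun x => weakGrad Ω u x - weakGrad Ω v x) :=
    ((isWeakGrad_weakGrad hG).sub (isWeakGrad_weakGrad hH)).weakGrad_ae_eq hΩ
  have hGu := (memLp_congr_ae (hG.weakGrad_ae_eq hΩ)).2 hG2
  have hHv := (memLp_congr_ae (hH.weakGrad_ae_eq hΩ)).2 hH2
  refine ⟨(memLp_congr_ae hae).2 (hGu.sub hHv), hae, fun n x => φ n x - χ n x,
    fun n => ⟨(hφ n).1.sub (hχ n).1, (hφ n).2.1.sub (hχ n).2.1, ?_⟩, ?_⟩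
  · exact (tsupport_sub _ _).trans (union_subset (hφ n).2.2 (hχ n).2.2)
  · refine tendsto_of_tendsto_of_tendsto_of_le_of_le tendsto_const_nhds
      (by simpa using hφ2.add hχ2) (fun n => zero_le) fun n => ?_
    have e : (fun x => gradient (fun x => φ n x - χ n x) x - weakGrad Ω (fun x => u x - v x) x)
        =ᵐ[volume.restrict Ω] (fun x => gradient (φ n) x - weakGrad Ω u x) -
          (fun x => gradient (χ n) x - weakGrad Ω v x) := by
      filter_upwards [hae] with x hx
      have hd1 : DifferentiableAt ℝ (φ n) x := ((hφ n).1.differentiable (by simp)) x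
      have hd2 : DifferentiableAt ℝ (χ n) x := ((hχ n).1.differentiable (by simp)) x
      rw [Pi.sub_apply, hx, gradient, fderiv_fun_sub hd1 hd2, map_sub, ← gradient, ← gradient]
      abel
    rw [eLpNorm_congr_ae e]
    exact eLpNorm_sub_le ((measurable_gradient _).aestronglyMeasurable.sub hGu.1)
      ((measurable_gradient _).aestronglyMeasurable.sub hHv.1) (by norm_num)

/-- Reliability of the residual estimator for Galerkin approximations in a conforming space of
piecewise smooth functions that contains the linear finite element functions. -/
theorem Mesh.HasSize.energyNorm_sub_sq_le (hT : T.HasSize κ h) (hd : 2 ≤ d) (hΩo : IsOpen Ω)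
    (hΩ : interior (closure Ω) = Ω) (hb : Bornology.IsBounded Ω) (hα : 0 < α)
    (ha : IsCoefficient Ω α β a) (hf : MemLp f 2 (volume.restrict Ω))
    {V : Submodule ℝ (Pt d → ℝ)} (hV : T.VFEM ≤ V) (hV2 : V ≤ T.piecewiseC2)
    (hv : IsGalerkin Ω a f V v) {u : Pt d → ℝ} (hu : IsSolution Ω a f u) :
    energyNorm Ω a (fun x => u x - v x) ^ 2 ≤
      residualConst d κ ^ 2 / α * ∑ K ∈ T.elems, T.etaSq a f v K := by
  have hv2 := hV2 hv.1
  obtain ⟨Lv, hLv⟩ := T.exists_lipschitzWith_of_piecewiseC2 hΩo hv2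
  have hvH : MemH10 Ω v := memH10_of_lipschitz hΩo hb hLv hv2.1
  obtain ⟨hW, hWae, φ, hφ, hlim⟩ := exists_tendsto_weakGrad_sub hΩo hu.1 hvH
  set W := weakGrad Ω fun x => u x - v x with hWdef
  set μ := volume.restrict Ω with hμ
  set S := √(∑ K ∈ T.elems, T.etaSq a f v K) with hS
  set R := residualConst d κ with hR
  set E := aForm Ω a (fun x => u x - v x) (fun x => u x - v x) with hE
  have hEdef : E = ∫ x in Ω, ⟪(a x).toEuclideanLin (W x), W x⟫_ℝ := rfl
  have haW := ha.memLp_apply hW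
  have hR0 : 0 ≤ R := residualConst_nonneg hT.ratio_pos
  have hg : ∀ n, MemLp (gradient (φ n)) 2 μ := fun n => by
    obtain ⟨L, hL⟩ := (hφ n).exists_lipschitz
    exact memLp_gradient hb hL
  -- the error equation for the approximating test functions
  have hbn : ∀ n, |∫ x in Ω, ⟪(a x).toEuclideanLin (W x), gradient (φ n) x⟫_ℝ| ≤
      R * (S * √(∫ x in Ω, ‖gradient (φ n) x‖ ^ 2)) := by
    intro n
    obtain ⟨L, hL⟩ := (hφ n).exists_lipschitz
    have hφH : MemH10 Ω (φ n) := memH10_of_lipschitz hΩo hb hL fun x hx =>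
      image_eq_zero_of_notMem_tsupport fun h => hx ((hφ n).2.2 h)
    have hmain := hT.abs_load_sub_aForm_le hd hΩo hΩ hb ha hf hV hV2 hv (hφ n)
    rw [← hu.2 _ hφH] at hmain
    have hgw := weakGrad_ae_eq_gradient hΩo hL
    have hgw2 := (memLp_congr_ae hgw).2 (hg n)
    obtain ⟨⟨-, G, hG, hG2⟩, -⟩ := hu.1
    obtain ⟨⟨-, H, hH, hH2⟩, -⟩ := hvH
    have hGu := (memLp_congr_ae (hG.weakGrad_ae_eq hΩo)).2 hG2
    have hHv := (memLp_congr_ae (hH.weakGrad_ae_eq hΩo)).2 hH2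
    have e1 : aForm Ω a u (φ n) - aForm Ω a v (φ n) =
        ∫ x in Ω, ⟪(a x).toEuclideanLin (W x), gradient (φ n) x⟫_ℝ := by
      rw [aForm, aForm, ← integral_sub (integrable_inner_of_memLp (ha.memLp_apply hGu) hgw2)
        (integrable_inner_of_memLp (ha.memLp_apply hHv) hgw2)]
      refine integral_congr_ae ?_
      filter_upwards [hWae, hgw] with x h1 h2
      rw [h1, h2, map_sub, inner_sub_left]
    have e2 : ∫ x, ‖gradient (φ n) x‖ ^ 2 = ∫ x in Ω, ‖gradient (φ n) x‖ ^ 2 := by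
      refine (setIntegral_eq_integral_of_forall_compl_eq_zero fun x hx => ?_).symm
      rw [(hφ n).gradient_eq_zero hx]
      simp
    rw [e1, e2] at hmain
    exact hmain
  -- passage to the limit
  set X := √(∫ x in Ω, ‖W x‖ ^ 2) with hX
  have hnorm : ∀ Y : Pt d → Pt d, MemLp Y 2 μ →
      √(∫ x in Ω, ‖Y x‖ ^ 2) = (eLpNorm Y 2 μ).toReal := fun Y hY => by
    rw [hY.eLpNorm_eq_integral_rpow_norm (by norm_num) (by norm_num),
      ENNReal.toReal_ofReal (by positivity)]
    simp [Real.sqrt_eq_rpow, hμ]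
  have hdiff : Tendsto (fun n => √(∫ x in Ω, ‖W x - gradient (φ n) x‖ ^ 2)) atTop (𝓝 0) := by
    have h1 := (ENNReal.tendsto_toReal ENNReal.zero_ne_top).comp hlim
    rw [ENNReal.toReal_zero] at h1
    refine h1.congr fun n => ?_
    have := hnorm (fun x => gradient (φ n) x - W x) ((hg n).sub hW)
    rw [Function.comp_apply, ← this]
    simp_rw [norm_sub_rev (W _)]
  have hY : ∀ n, MemLp (fun x => W x - gradient (φ n) x) 2 μ := fun n => hW.sub (hg n)
  have htri : ∀ n, √(∫ x in Ω, ‖gradient (φ n) x‖ ^ 2) ≤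
      X + √(∫ x in Ω, ‖W x - gradient (φ n) x‖ ^ 2) := fun n => by
    have h1 : eLpNorm (gradient (φ n)) 2 μ ≤ eLpNorm W 2 μ + 
        eLpNorm (fun x => W x - gradient (φ n) x) 2 μ := by
      have := eLpNorm_sub_le (p := 2) (μ := μ) hW.1 (hY n).1 (by norm_num)
      have e : (W - fun x => W x - gradient (φ n) x) = gradient (φ n) := by
        funext x
        simp
      rwa [e] at this
    rw [hX, hnorm _ (hg n), hnorm _ hW, hnorm _ (hY n),
      ← ENNReal.toReal_add hW.eLpNorm_ne_top (hY n).eLpNorm_ne_top]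
    exact ENNReal.toReal_mono (ENNReal.add_ne_top.2 ⟨hW.eLpNorm_ne_top,
      (hY n).eLpNorm_ne_top⟩) h1
  have hEle : E ≤ R * (S * X) := by
    set B := √(∫ x in Ω, ‖(a x).toEuclideanLin (W x)‖ ^ 2) with hB
    have hbound : ∀ n, E ≤ R * (S * (X + √(∫ x in Ω, ‖W x - gradient (φ n) x‖ ^ 2))) +
        B * √(∫ x in Ω, ‖W x - gradient (φ n) x‖ ^ 2) := by
      intro n
      have e1 : E = (∫ x in Ω, ⟪(a x).toEuclideanLin (W x), gradient (φ n) x⟫_ℝ) +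
          ∫ x in Ω, ⟪(a x).toEuclideanLin (W x), W x - gradient (φ n) x⟫_ℝ := by
        rw [hEdef, ← integral_add (integrable_inner_of_memLp haW (hg n))
          (integrable_inner_of_memLp haW (hY n))]
        refine integral_congr_ae (ae_of_all _ fun x => ?_)
        simp only
        rw [← inner_add_right, add_sub_cancel]
      rw [e1]
      refine add_le_add ((le_abs_self _).trans ((hbn n).trans ?_))
        ((le_abs_self _).trans (abs_integral_inner_le haW (hY n)))
      gcongr
      exact htri n
    have hlim2 : Tendsto (fun n => R * (S * (X + √(∫ x in Ω, ‖W x - gradient (φ n) x‖ ^ 2))) +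
        B * √(∫ x in Ω, ‖W x - gradient (φ n) x‖ ^ 2)) atTop (𝓝 (R * (S * X))) := by
      have := (((hdiff.const_add X).const_mul S).const_mul R).add (hdiff.const_mul B)
      simpa using this
    exact ge_of_tendsto' hlim2 hbound
  have hcoer : α * X ^ 2 ≤ E := by
    rw [hX, Real.sq_sqrt (integral_nonneg fun x => by positivity), hEdef, ← integral_const_mul]
    refine integral_mono_ae (((memLp_two_iff_integrable_sq_norm hW.1).1 hW).const_mul α)
      (integrable_inner_of_memLp haW hW) ?_
    filter_upwards [ae_restrict_mem hΩo.measurableSet] with x hx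
    rw [real_inner_comm]
    exact ha.lower x hx (W x)
  have hX0 : 0 ≤ X := Real.sqrt_nonneg _
  have hE0 : 0 ≤ E := le_trans (by positivity) hcoer
  rw [energyNorm, Real.sq_sqrt hE0]
  have hS2 : S ^ 2 = ∑ K ∈ T.elems, T.etaSq a f v K :=
    Real.sq_sqrt (Finset.sum_nonneg fun K _ => T.etaSq_nonneg K)
  rw [← hS2, div_mul_eq_mul_div, le_div_iff₀ hα]
  -- `E² ≤ R² S² X² ≤ R² S² E / α`
  rcases hE0.eq_or_lt with h0 | hpos
  · rw [← h0, zero_mul]; positivity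
  · refine le_of_mul_le_mul_right ?_ hpos
    have h1 : E * E ≤ (R * (S * X)) * (R * (S * X)) :=
      mul_le_mul hEle hEle hE0 (hE0.trans hEle)
    calc E * α * E = α * (E * E) := by ring
      _ ≤ α * ((R * (S * X)) * (R * (S * X))) := by gcongr
      _ = R ^ 2 * S ^ 2 * (α * X ^ 2) := by ring
      _ ≤ R ^ 2 * S ^ 2 * E := by gcongr

end

end NEFEM

end

open NEFEM
theorem mainTheorem1 (d : ℕ) (hd : 2 ≤ d) (κ α β : ℝ) (hα : 0 < α) :
    ∃ C : ℝ, 0 < C ∧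
      ∀ (Ω : Set (Pt d)), IsOpen Ω → IsConnected Ω → Bornology.IsBounded Ω →
        interior (closure Ω) = Ω →
      ∀ (T : Mesh Ω), T.QuasiUniform κ →
      ∀ (a : Pt d → Matrix (Fin d) (Fin d) ℝ), IsCoefficient Ω α β a →
      ∀ (f : Pt d → ℝ), MemLp f 2 (volume.restrict Ω) →
      ∀ (Ienr : Finset (Pt d)), Ienr ⊆ T.nodes →
      ∀ (σ : Pt d → ℝ → ℝ) (ws : Pt d → List ℕ) (θ : (p : Pt d) → NetParams d (ws p)),
        (∀ p ∈ Ienr, ContDiff ℝ 2 (σ p)) →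
        (∀ p ∈ Ienr, ∀ x ∈ frontier Ω, T.enrBasis p (neuralEnrichment σ ws θ p) x = 0) →
      ∀ (u uh : Pt d → ℝ), IsSolution Ω a f u →
        IsGalerkin Ω a f (T.VN Ienr (neuralEnrichment σ ws θ)) uh →
        energyNorm Ω a (fun x => u x - uh x) ^ 2 ≤ C * ∑ K ∈ T.elems, T.etaSq a f uh K := by
  -- the summand `1` makes the constant positive for all values of `κ`
  refine ⟨residualConst d κ ^ 2 / α + 1, by positivity, ?_⟩
  intro Ω hΩo hΩc hb hΩ T hT a ha f hf Ienr _ σ ws θ hσ h0 u uh hu huh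
  obtain ⟨h, hh⟩ := hT.exists_hasSize (by omega) hΩc.nonempty
  have hV2 : T.VN Ienr (neuralEnrichment σ ws θ) ≤ T.piecewiseC2 :=
    T.VN_le_piecewiseC2 hΩo hΩ (fun p hp => contDiff_neuralEnrichment ws θ (hσ p hp)) h0
  refine (hh.energyNorm_sub_sq_le hd hΩo hΩ hb hα ha hf le_sup_left hV2 huh hu).trans ?_
  exact mul_le_mul_of_nonneg_right (by linarith)
    (Finset.sum_nonneg fun K _ => T.etaSq_nonneg K)
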